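/- **Setting.** Let $T>0$. For $R>0$ let $C_R=\{x\in\mathbb R^N: |x_i|\le R/2,\ i=1,\dots,N\}$, let $N_1(h)=\limsup_{R\to\infty}R^{-N}\int_{C_R}|h|\,dx$, and write $\operatorname{M}(h)=\lim_{R\to\infty}R^{-N}\int_{C_R}h\,dx$ for the mean value of $h$. Let $\operatorname{AP}(\mathbb R^N)$ be the space of Bohr almost periodic functions, that is, the closure in the sup norm of the real span of the functions $\cos(2\pi\lambda\cdot x)$, $\sin(2\pi\lambda\cdot x)$, $\lambda\in\mathbb R^N$; let $\operatorname{AP}^2(\mathbb R^N)$ be the space of $C^2$ functions all of whose derivatives of order at most $2$ are in $\operatorname{AP}(\mathbb R^N)$; and let $\mathcal B^1(\mathbb R^N)$ be the completion of $\operatorname{AP}(\mathbb R^N)$ for $N_1$. Thus $h\in L^1_{\rm loc}\cap\mathcal B^1(\mathbb R^N)$ means that $h$ is locally integrable and is a limit of functions of $\operatorname{AP}(\mathbb R^N)$ for $N_1$; this space carries the topology of the seminorms $\int_{\{|x|\le r\}}|h|\,dx$, $r>0$, and $N_1$. Let $\mathbf f\in C^2(\mathbb R;\mathbb R^N)$ have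 bounded first and second derivatives, let $(\beta_k)_{k\ge1}$ be independent real Brownian motions on a probability space $(\Omega,\mathcal F,\mathbb P)$, with completed canonical filtration $(\mathcal F_t)$, and let $g_k\in \operatorname{AP}^2(\mathbb R^N)$ satisfy $|g_k(x)|+|\nabla g_k(x)|+|\nabla^2g_k(x)|\le\alpha_k$ for all $x\in\mathbb R^N$ and $k\ge1$, where $\alpha_k>0$ and $\sum_k(\alpha_k+\alpha_k^2)<\infty$. Put $J(t,x)=\sum_k g_k(x)\beta_k(t)$. Consider $$du+\operatorname{div}\mathbf f(u)\,dt=\sum_k g_k\,d\beta_k,\qquad u(0,\cdot)=u_0. \tag{1}$$ **Definition.** Let $u_0\in L^\infty\cap\mathcal B^1(\mathbb R^N)$. An $L^1_{\rm loc}\cap\mathcal B^1(\mathbb R^N)$-valued process $u$ on $[0,T]$, adapted to $(\mathcal F_t)$, is a *BAP-entropy solution* of (1) if, almost surely, (i) $u$ is weakly continuous on $[0,T]$ with values in $L^1_{\rm loc}\cap\mathcal B^1(\mathbb R^N)$; (ii) $u\in L^\infty([0,T];L^1_{\rm loc}\cap\mathcal B^1(\mathbb R^N))$; (iii) with $w=u-J$,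 for all $0\le\varphi\in C_c^\infty((-T,T)\times\mathbb R^N)$ and all $\alpha\in\mathbb R$, $$\int_0^T\!\!\int_{\mathbb R^N}\Big\{(|w-\alpha|-|u_0-\alpha|)\varphi_t+\operatorname{sgn}(w-\alpha)\big(\mathbf f(w+J)-\mathbf f(\alpha+J)\big)\cdot\nabla\varphi-\operatorname{sgn}(w-\alpha)\,\mathbf f'(\alpha+J)\cdot\nabla J\,\varphi\Big\}\,dx\,dt\ge0,$$ where $\operatorname{sgn}(0)=0$. **Proposition ($L^1$-mean contraction).** Let $u,v$ be two BAP-entropy solutions of (1) on $[0,T]$ with initial data $u_0,v_0\in L^\infty\cap\mathcal B^1(\mathbb R^N)$, respectively. Then the mean value $\operatorname{M}(|u_0-v_0|)$ exists and, almost surely, for a.e. $t\in[0,T]$, the mean value $\operatorname{M}(|u(t,\cdot)-v(t,\cdot)|)$ exists and $$\operatorname{M}\big(|u(t,\cdot)-v(t,\cdot)|\big)\le\operatorname{M}\big(|u_0-v_0|\big).$$ -/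

import Mathlib

open MeasureTheory ProbabilityTheory Filter Topology Set
open scoped ENNReal NNReal BoundedContinuousFunction

noncomputable section

namespace BAP

/-- The space `ℝ^N` with its Euclidean norm. -/
abbrev E (N : ℕ) : Type := EuclideanSpace ℝ (Fin N)

/-- The cube `C_R = {x : |x_i| ≤ R / 2}`. -/
def cube (N : ℕ) (R : ℝ) : Set (E N) := {x | ∀ i, |x i| ≤ R / 2}

/-- The function `x ↦ cos (2 π lam · x)`. -/
def cosWave {N : ℕ} (lam : E N) : E N →ᵇ ℝ :=
  BoundedContinuousFunction.ofNormedAddCommGroup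
    (fun x => Real.cos (2 * Real.pi * inner ℝ lam x)) (by fun_prop) 1
    (fun x => by simpa using Real.abs_cos_le_one _)

/-- The function `x ↦ sin (2 π lam · x)`. -/
def sinWave {N : ℕ} (lam : E N) : E N →ᵇ ℝ :=
  BoundedContinuousFunction.ofNormedAddCommGroup
    (fun x => Real.sin (2 * Real.pi * inner ℝ lam x)) (by fun_prop) 1
    (fun x => by simpa using Real.abs_sin_le_one _)

/-- The space `AP(ℝ^N)` of (Bohr) almost periodic functions: the closure, for the sup norm, of the
real trigonometric polynomials in the space of bounded continuous functions. -/
def AP (N : ℕ) : Submodule ℝ (E N →ᵇ ℝ) :=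
  (Submodule.span ℝ (range (cosWave (N := N)) ∪ range (sinWave (N := N)))).topologicalClosure

/-- The function `g` is almost periodic. -/
def IsAP {N : ℕ} (g : E N → ℝ) : Prop := ∃ a ∈ AP N, (a : E N → ℝ) = g

/-- `g` belongs to `AP^l(ℝ^N)`: it is `C^l`, and all its derivatives up to the order `l`
(including `g` itself, order `0`) are almost periodic. -/
def IsAPSmooth {N : ℕ} (l : ℕ) (g : E N → ℝ) : Prop :=
  ContDiff ℝ l g ∧ ∀ m ≤ l, ∀ v : Fin m → E N, IsAP fun x => iteratedFDeriv ℝ m g x v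

/-- The Besicovitch seminorm `N_1(h) = limsup_{R → ∞} R^{-N} ∫_{C_R} |h|`, with values in
`[0, ∞]`. -/
def N1 {N : ℕ} (h : E N → ℝ) : ℝ≥0∞ :=
  limsup (fun R : ℝ => (ENNReal.ofReal (R ^ N))⁻¹ * ∫⁻ x in cube N R, ‖h x‖ₑ) atTop

lemma N1_add_lt {N : ℕ} {h k : E N → ℝ} (hh : AEStronglyMeasurable h volume) {ε δ : ℝ≥0∞}
    (h1 : N1 h < ε) (h2 : N1 k < δ) : N1 (h + k) ≤ ε + δ := by
  refine limsup_le_of_le (by isBoundedDefault) ?_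
  filter_upwards [eventually_lt_of_limsup_lt h1, eventually_lt_of_limsup_lt h2] with R hR hR'
  refine le_trans ?_ (add_le_add hR.le hR'.le)
  rw [← mul_add, ← lintegral_add_left' hh.restrict.enorm]
  gcongr
  exact enorm_add_le _ _

lemma N1_smul {N : ℕ} (c : ℝ) (h : E N → ℝ) : N1 (c • h) = ‖c‖ₑ * N1 h := by
  unfold N1
  rw [← ENNReal.limsup_const_mul_of_ne_top enorm_ne_top]
  congr 1
  ext R
  simp only [Pi.smul_apply, smul_eq_mul, enorm_mul]
  rw [lintegral_const_mul' _ _ enorm_ne_top]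
  ring

/-- The space `L^1_loc ∩ B^1(ℝ^N)`: the locally integrable functions that represent an element of
the completion of `AP(ℝ^N)` for `N_1`, that is, that are limits of almost periodic functions for
the seminorm `N_1`. -/
def LocB1 (N : ℕ) : Submodule ℝ (E N → ℝ) where
  carrier := {h | LocallyIntegrable h volume ∧
    ∀ ε : ℝ≥0∞, 0 < ε → ∃ a ∈ AP N, N1 (h - (a : E N → ℝ)) < ε}
  zero_mem' := by
    refine ⟨locallyIntegrable_zero, fun ε hε => ⟨0, zero_mem _, ?_⟩⟩
    simpa [N1] using hε
  add_mem' := by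
    rintro h k ⟨hh, hha⟩ ⟨hk, hka⟩
    refine ⟨hh.add hk, fun ε hε => ?_⟩
    obtain ⟨δ, hδ, hδε⟩ := exists_between hε
    obtain ⟨a, ha, haε⟩ := hha (δ / 2) (ENNReal.half_pos hδ.ne')
    obtain ⟨b, hb, hbε⟩ := hka (δ / 2) (ENNReal.half_pos hδ.ne')
    refine ⟨a + b, add_mem ha hb, ?_⟩
    have e : h + k - ((a + b : E N →ᵇ ℝ) : E N → ℝ)
        = (h - (a : E N → ℝ)) + (k - (b : E N → ℝ)) := by
      ext x
      simp
      ring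
    rw [e]
    refine lt_of_le_of_lt (N1_add_lt (hh.aestronglyMeasurable.sub
      a.continuous.aestronglyMeasurable) haε hbε) ?_
    rwa [ENNReal.add_halves]
  smul_mem' := by
    rintro c h ⟨hh, hha⟩
    refine ⟨hh.smul c, fun ε hε => ?_⟩
    obtain ⟨a, ha, haε⟩ := hha (ε / ‖c‖ₑ) (ENNReal.div_pos hε.ne' enorm_ne_top)
    refine ⟨c • a, Submodule.smul_mem _ c ha, ?_⟩
    have e : c • h - ((c • a : E N →ᵇ ℝ) : E N → ℝ) = c • (h - (a : E N → ℝ)) := by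
      ext x
      simp
      ring
    rw [e, N1_smul]
    rw [mul_comm]
    exact ENNReal.mul_lt_of_lt_div haε

/-- The continuous linear functionals on `L^1_loc ∩ B^1(ℝ^N)`, whose topology is given by the
seminorms `h ↦ ∫_{|x| ≤ r} |h|`, `r > 0`, and `N_1`. -/
def IsContinuousFunctional {N : ℕ} (ℓ : LocB1 N →ₗ[ℝ] ℝ) : Prop :=
  ∃ r C : ℝ, ∀ h : LocB1 N,
    |ℓ h| ≤ C * ((∫ x in Metric.closedBall (0 : E N) r, |(h : E N → ℝ) x|)
      + (N1 (h : E N → ℝ)).toReal)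

/-- `m` is the mean value of `h`: the limit of `R^{-N} ∫_{C_R} h` as `R → ∞` exists and is `m`. -/
def HasMeanValue {N : ℕ} (h : E N → ℝ) (m : ℝ) : Prop :=
  Tendsto (fun R : ℝ => (R ^ N)⁻¹ * ∫ x in cube N R, h x) atTop (𝓝 m)

/-- The completed canonical filtration of the processes `β k`: the σ-algebra at time `t` is
generated by the `β k s`, `s ≤ t`, and by the null sets. -/
@[reducible] def completedFiltration {Ω : Type*} [MeasurableSpace Ω] (P : Measure Ω) (β : ℕ → ℝ≥0 → Ω → ℝ)
    (t : ℝ≥0) : MeasurableSpace Ω :=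
  (⨆ k, ⨆ s, ⨆ _ : s ≤ t, MeasurableSpace.comap (β k s) (borel ℝ)) ⊔
    MeasurableSpace.generateFrom {A : Set Ω | P A = 0}

/-- The noise `J(x, t) = ∑_k g_k(x) β_k(t)`, at times `t ≥ 0`. -/
def noise {Ω : Type*} {N : ℕ} (g : ℕ → E N → ℝ) (β : ℕ → ℝ≥0 → Ω → ℝ) (ω : Ω) (t : ℝ) (x : E N) :
    ℝ :=
  ∑' k, g k x * β k t.toNNReal ω

/-- The nonnegative test functions of class `C_c^∞((-T, T) × ℝ^N)`. -/
structure IsTestFunction {N : ℕ} (T : ℝ) (φ : ℝ × E N → ℝ) : Prop where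
  smooth : ContDiff ℝ (⊤ : ℕ∞) φ
  compact : HasCompactSupport φ
  support : tsupport φ ⊆ Ioo (-T) T ×ˢ univ
  nonneg : ∀ z, 0 ≤ φ z

/-- The integrand of the entropy inequality at the point `(t, x)`, where `J` is the (space-time)
noise, `w` the value of `u - J` at `(t, x)`, `c` the value of `u₀` at `x`, and `α` the level. -/
def entropyIntegrand {N : ℕ} (f : ℝ → E N) (J : ℝ → E N → ℝ) (φ : ℝ × E N → ℝ) (α : ℝ)
    (w c : ℝ) (t : ℝ) (x : E N) : ℝ :=
  (|w - α| - |c - α|) * deriv (fun s => φ (s, x)) t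
    + Real.sign (w - α) * inner ℝ (f (w + J t x) - f (α + J t x)) (gradient (fun y => φ (t, y)) x)
    - Real.sign (w - α) * inner ℝ (deriv f (α + J t x)) (gradient (J t) x) * φ (t, x)

/-- Besicovitch almost periodic entropy solutions on `[0, T]` of
`du + div f(u) dt = ∑_k g_k dβ_k`, `u(0) = u₀`. -/
structure IsBAPEntropySolution {Ω : Type*} [MeasurableSpace Ω] (P : Measure Ω) {N : ℕ}
    (f : ℝ → E N) (g : ℕ → E N → ℝ) (β : ℕ → ℝ≥0 → Ω → ℝ) (T : ℝ) (u₀ : E N → ℝ)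
    (u : ℝ → Ω → LocB1 N) : Prop where
  /-- The initial datum is in `L^∞ ∩ B^1`. -/
  initial_bounded : MemLp u₀ ∞ volume
  initial_mem : u₀ ∈ LocB1 N
  /-- The process is adapted; the Borel σ-algebra of `L^1_loc` is generated by the functionals
  `h ↦ ∫ h ψ`, `ψ ∈ C_c`. -/
  adapted : ∀ t ∈ Icc 0 T, ∀ ψ : E N → ℝ, Continuous ψ → HasCompactSupport ψ →
    Measurable[completedFiltration P β t.toNNReal]
      (fun ω => ∫ x, (u t ω : E N → ℝ) x * ψ x)
  /-- A.s., `u` is weakly continuous on `[0, T]` with values in `L^1_loc ∩ B^1`. -/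
  weaklyContinuous : ∀ᵐ ω ∂P, ∀ ℓ : LocB1 N →ₗ[ℝ] ℝ, IsContinuousFunctional ℓ →
    ContinuousOn (fun t => ℓ (u t ω)) (Icc 0 T)
  /-- A.s., `u ∈ L^∞([0, T]; L^1_loc ∩ B^1)`: measurability in `(t, x)`, and an essential bound in
  time for each of the seminorms. -/
  jointlyMeasurable : ∀ᵐ ω ∂P, AEStronglyMeasurable
    (fun z : ℝ × E N => (u z.1 ω : E N → ℝ) z.2) ((volume.restrict (Icc 0 T)).prod volume)
  bounded_loc : ∀ᵐ ω ∂P, ∀ r : ℝ, ∃ C : ℝ, ∀ᵐ t ∂volume.restrict (Icc 0 T),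
    ∫ x in Metric.closedBall (0 : E N) r, |(u t ω : E N → ℝ) x| ≤ C
  bounded_mean : ∀ᵐ ω ∂P, ∃ C : ℝ≥0, ∀ᵐ t ∂volume.restrict (Icc 0 T),
    N1 (u t ω : E N → ℝ) ≤ C
  /-- A.s., the entropy inequality, for `w = u - J`. -/
  entropy : ∀ᵐ ω ∂P, ∀ φ : ℝ × E N → ℝ, IsTestFunction T φ → ∀ α : ℝ,
    0 ≤ ∫ t in Icc 0 T, ∫ x, entropyIntegrand f (noise g β ω) φ α
      ((u t ω : E N → ℝ) x - noise g β ω t x) (u₀ x) t x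

end BAP

end

open MeasureTheory ProbabilityTheory Filter Topology Set
open scoped ENNReal NNReal BoundedContinuousFunction

noncomputable section

namespace BAP

/-! The argument is pathwise. For almost every path the noise agrees on [0, T] with a field J that
is C^{1,1} in space and uniformly continuous in time together with its gradient
(`ae_exists_isRegularField_noise`): chaining over dyadic times bounds the expectation of sup |β_k|
by a constant independent of k, so Σ α_k sup |β_k| is almost surely finite, and this sum dominates
the series for J and its derivatives. On such a path w = u - J and z = v - J are Kruzhkov solutions
of the deterministic equation w_t + div f(w + J(t, x)) = 0; the source in the entropy inequality is
the divergence of x ↦ f(α + J(t, x)).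

Kruzhkov's doubling of variables gives the Kato inequality (`kato_inequality`). Three points need
care. The initial datum is absorbed by extending w by u₀ to t ≤ 0 and switching the flux off there,
so that no initial trace is needed; the jump of the flux costs only an integral over a thin strip
around t = 0. Since J depends on x, comparing the fluxes at two points leaves a term of the size of
q · ∇k, where q is the space shift and k the mollifier; this term is not small, but added to the
difference of the sources it is a total derivative in q, and its integral vanishes
(`integral_crossDensity`). Finally J is merely continuous in time, so the width ε of the mollifier
in time is chosen after the width δ in space, small enough for the time oscillation of J to beat the
factor 1/δ coming from ∇k.

If L bounds |f'|, the Kato inequality tested with a cutoff that is nonincreasing in every direction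
(1, v), |v| ≤ L, bounds the integral of |u - v| at time t over a cube by that of |u₀ - v₀| over a
cube whose side is larger by a constant (`IsPathSolution.ae_setIntegral_cube_le`). Divided by the
volume, the constant disappears in the limit, and the mean values are compared.

The existence of the mean values is a separate fact (`exists_hasMeanValue_abs`). Waves have mean
values, because a nonconstant one changes sign under some translation. Trigonometric polynomials
form an algebra, so by Weierstrass |b| is a uniform limit of trigonometric polynomials when b is
one, and |h| is an N_1 limit of such |b|. -/

/-! ### Cubes and averages over them. -/

lemma measurableSet_cube (N : ℕ) (R : ℝ) : MeasurableSet (cube N R) := by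
  have : cube N R = ⋂ i, {x : E N | |x i| ≤ R / 2} := by ext x; simp [cube]
  rw [this]
  exact MeasurableSet.iInter fun i => measurableSet_le (by fun_prop) measurable_const

lemma cube_eq_preimage (N : ℕ) (R : ℝ) :
    cube N R = (MeasurableEquiv.toLp 2 (Fin N → ℝ)).symm ⁻¹'
      (Set.pi univ fun _ => Icc (-(R / 2)) (R / 2)) := by
  ext x
  simp only [cube, mem_ofPred_eq, abs_le, mem_preimage, mem_univ_pi, mem_Icc]
  rfl

lemma volume_cube (N : ℕ) {R : ℝ} (hR : 0 ≤ R) : volume (cube N R) = ENNReal.ofReal (R ^ N) := by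
  rw [cube_eq_preimage, (EuclideanSpace.volume_preserving_symm_measurableEquiv_toLp (Fin N)).measure_preimage
    (MeasurableSet.univ_pi fun _ => measurableSet_Icc).nullMeasurableSet, volume_pi_pi]
  simp [Real.volume_Icc, ENNReal.ofReal_pow hR]

lemma isCompact_cube (N : ℕ) (R : ℝ) : IsCompact (cube N R) := by
  refine Metric.isCompact_of_isClosed_isBounded ?_ ?_
  · have : cube N R = ⋂ i, {x : E N | |x i| ≤ R / 2} := by ext x; simp [cube]
    rw [this]
    exact isClosed_iInter fun i => isClosed_le (by fun_prop) continuous_const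
  · rw [cube_eq_preimage]
    have := (isCompact_univ_pi fun _ : Fin N => isCompact_Icc (a := -(R / 2)) (b := R / 2))
    have h2 := this.image (PiLp.continuous_toLp 2 (fun _ : Fin N => ℝ))
    refine h2.isBounded.subset ?_
    intro x hx
    exact ⟨_, hx, by ext; simp⟩

lemma measureReal_cube (N : ℕ) {R : ℝ} (hR : 0 ≤ R) : volume.real (cube N R) = R ^ N := by
  rw [Measure.real, volume_cube N hR, ENNReal.toReal_ofReal (by positivity)]

lemma HasMeanValue.add {N : ℕ} {h k : E N → ℝ} {m n : ℝ} (hh : LocallyIntegrable h)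
    (hk : LocallyIntegrable k) (hm : HasMeanValue h m) (hn : HasMeanValue k n) :
    HasMeanValue (h + k) (m + n) := by
  refine (Tendsto.add hm hn).congr fun R => ?_
  rw [← mul_add, ← integral_add (hh.integrableOn_isCompact (isCompact_cube N R))
    (hk.integrableOn_isCompact (isCompact_cube N R))]
  rfl

lemma HasMeanValue.smul {N : ℕ} {h : E N → ℝ} {m : ℝ} (c : ℝ) (hm : HasMeanValue h m) :
    HasMeanValue (c • h) (c * m) := by
  refine (Tendsto.const_mul c hm).congr fun R => ?_
  simp only [Pi.smul_apply, smul_eq_mul]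
  rw [integral_const_mul]
  ring

lemma tendsto_sub_pow_div_pow (N : ℕ) (c : ℝ) :
    Tendsto (fun R : ℝ => (R - c) ^ N / R ^ N) atTop (𝓝 1) := by
  have h : Tendsto (fun R : ℝ => 1 - c / R) atTop (𝓝 (1 - 0)) :=
    tendsto_const_nhds.sub (tendsto_const_nhds.div_atTop tendsto_id)
  have := h.pow N
  simp only [sub_zero, one_pow] at this
  refine this.congr' ?_
  filter_upwards [eventually_gt_atTop 0] with R hR
  rw [← div_pow, sub_div, div_self hR.ne']

/-- A bounded continuous function whose sign is reversed by some translation has mean value zero. -/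
lemma hasMeanValue_zero_of_antiperiodic {N : ℕ} (h : E N →ᵇ ℝ) (v : E N)
    (hv : ∀ x, h (x + v) = - h x) : HasMeanValue h 0 := by
  -- Translation by `v` moves each coordinate by at most ‖v‖, so the cube of side R - c lies in both
  -- the cube of side R and its translate.
  set c : ℝ := 2 * ‖v‖ with hc
  have key : ∀ᶠ R : ℝ in atTop, |(R ^ N)⁻¹ * ∫ x in cube N R, h x|
      ≤ ‖h‖ * (1 - (R - c) ^ N / R ^ N) := by
    filter_upwards [eventually_gt_atTop 0, eventually_ge_atTop c] with R hR hRc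
    set D : Set (E N) := (fun x => x + v) ⁻¹' cube N R with hD
    have hDm : MeasurableSet D := (measurable_add_const v) (measurableSet_cube N R)
    have hint : ∀ S : Set (E N), volume S ≠ ∞ → IntegrableOn h S := fun S hS =>
      Measure.integrableOn_of_bounded hS h.continuous.aestronglyMeasurable
        (M := ‖h‖) (ae_of_all _ fun x => h.norm_coe_le_norm x)
    have hvolD : volume D = volume (cube N R) := by
      rw [hD, measure_preimage_add_right]
    have hCf : volume (cube N R) ≠ ∞ := by rw [volume_cube N hR.le]; exact ENNReal.ofReal_ne_top
    have e1 : ∫ x in cube N R, h x = - ∫ x in D, h x := by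
      rw [← (measurePreserving_add_right volume v).setIntegral_preimage_emb
        (measurableEmbedding_addRight v) h (cube N R), ← integral_neg]
      simp_rw [hv]
      rfl
    have hsub : cube N (R - c) ⊆ cube N R ∩ D := by
      intro x hx
      have hvi : ∀ i, |v i| ≤ ‖v‖ := fun i => by
        simpa using PiLp.norm_apply_le v i
      have hc0 : 0 ≤ c := by positivity
      refine ⟨fun i => (hx i).trans (by linarith), fun i => ?_⟩
      have := abs_add_le (x i) (v i)
      have h1 := hx i
      have h2 := hvi i
      simp only [PiLp.add_apply]
      linarith
    have hvol : (R - c) ^ N ≤ volume.real (cube N R ∩ D) := by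
      rw [← measureReal_cube N (sub_nonneg.2 hRc)]
      exact measureReal_mono hsub (measure_ne_top_of_subset inter_subset_left hCf)
    -- By `e1` the integral over the overlap enters the integral over the cube with both signs. It
    -- cancels on adding, and twice the integral over the cube is a difference of integrals over C \
    -- D and D \ C, where C is the cube; each of these sets has measure at most R^N - (R - c)^N.
    have s1 : ∫ x in cube N R, h x = (∫ x in cube N R ∩ D, h x) + ∫ x in cube N R \ D, h x :=
      (integral_inter_add_sdiff hDm (hint _ hCf)).symm
    have s2 : ∫ x in D, h x = (∫ x in cube N R ∩ D, h x) + ∫ x in D \ cube N R, h x := by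
      rw [inter_comm]
      exact (integral_inter_add_sdiff (measurableSet_cube N R) (hint _ (hvolD ▸ hCf))).symm
    have b1 : ‖∫ x in cube N R \ D, h x‖ ≤ ‖h‖ * (R ^ N - (R - c) ^ N) := by
      refine (norm_setIntegral_le_of_norm_le_const
        (measure_ne_top_of_subset sdiff_subset hCf).lt_top
        fun x _ => h.norm_coe_le_norm x).trans ?_
      gcongr
      have := measureReal_inter_add_sdiff (s := cube N R) hDm hCf
      rw [measureReal_cube N hR.le] at this
      linarith
    have b2 : ‖∫ x in D \ cube N R, h x‖ ≤ ‖h‖ * (R ^ N - (R - c) ^ N) := by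
      refine (norm_setIntegral_le_of_norm_le_const
        (measure_ne_top_of_subset sdiff_subset (hvolD ▸ hCf)).lt_top
        fun x _ => h.norm_coe_le_norm x).trans ?_
      gcongr
      have := measureReal_inter_add_sdiff (s := D) (measurableSet_cube N R) (hvolD ▸ hCf)
      rw [show volume.real D = R ^ N by rw [Measure.real, hvolD, ← measureReal_cube N hR.le,
        Measure.real], inter_comm] at this
      linarith
    rw [Real.norm_eq_abs, abs_le] at b1 b2
    rw [abs_mul, abs_of_pos (by positivity : 0 < (R ^ N)⁻¹), inv_mul_le_iff₀ (by positivity)]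
    have e2 : R ^ N * (‖h‖ * (1 - (R - c) ^ N / R ^ N)) = ‖h‖ * (R ^ N - (R - c) ^ N) := by
      field_simp
    rw [e2, abs_le]
    constructor <;> linarith
  refine squeeze_zero_norm' key ?_
  have := ((tendsto_sub_pow_div_pow N c).const_sub 1).const_mul ‖h‖
  simpa using this

/-! ### The algebra of trigonometric polynomials and their mean values. -/

/-- The real trigonometric polynomials. -/
def trigPoly (N : ℕ) : Submodule ℝ (E N →ᵇ ℝ) :=
  Submodule.span ℝ (range (cosWave (N := N)) ∪ range (sinWave (N := N)))

lemma cosWave_apply {N : ℕ} (lam x : E N) :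
    cosWave lam x = Real.cos (2 * Real.pi * inner ℝ lam x) := rfl

lemma sinWave_apply {N : ℕ} (lam x : E N) :
    sinWave lam x = Real.sin (2 * Real.pi * inner ℝ lam x) := rfl

lemma cosWave_mem {N : ℕ} (lam : E N) : cosWave lam ∈ trigPoly N :=
  Submodule.subset_span (Or.inl ⟨lam, rfl⟩)

lemma sinWave_mem {N : ℕ} (lam : E N) : sinWave lam ∈ trigPoly N :=
  Submodule.subset_span (Or.inr ⟨lam, rfl⟩)

lemma one_mem_trigPoly (N : ℕ) : (1 : E N →ᵇ ℝ) ∈ trigPoly N := by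
  have : (1 : E N →ᵇ ℝ) = cosWave 0 := by ext x; simp [cosWave_apply]
  exact this ▸ cosWave_mem 0

/-- The product-to-sum formulas settle the generators, and bilinearity the rest. -/
lemma mul_mem_trigPoly {N : ℕ} {a b : E N →ᵇ ℝ} (ha : a ∈ trigPoly N) (hb : b ∈ trigPoly N) :
    a * b ∈ trigPoly N := by
  induction ha, hb using Submodule.span_induction₂ with
  | mem_mem a b ha hb =>
    rcases ha with ⟨l, rfl⟩ | ⟨l, rfl⟩ <;> rcases hb with ⟨m, rfl⟩ | ⟨m, rfl⟩
    · have : cosWave l * cosWave m = (1 / 2 : ℝ) • (cosWave (l + m) + cosWave (l - m)) := by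
        ext x
        simp [cosWave_apply, inner_add_left, inner_sub_left, mul_add, mul_sub, Real.cos_add,
          Real.cos_sub]
        ring
      rw [this]
      exact Submodule.smul_mem _ _ (add_mem (cosWave_mem _) (cosWave_mem _))
    · have : cosWave l * sinWave m = (1 / 2 : ℝ) • (sinWave (l + m) - sinWave (l - m)) := by
        ext x
        simp [cosWave_apply, sinWave_apply, inner_add_left, inner_sub_left, mul_add, mul_sub,
          Real.sin_add, Real.sin_sub]
        ring
      rw [this]
      exact Submodule.smul_mem _ _ (sub_mem (sinWave_mem _) (sinWave_mem _))
    · have : sinWave l * cosWave m = (1 / 2 : ℝ) • (sinWave (l + m) + sinWave (l - m)) := by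
        ext x
        simp [cosWave_apply, sinWave_apply, inner_add_left, inner_sub_left, mul_add, mul_sub,
          Real.sin_add, Real.sin_sub]
        ring
      rw [this]
      exact Submodule.smul_mem _ _ (add_mem (sinWave_mem _) (sinWave_mem _))
    · have : sinWave l * sinWave m = (1 / 2 : ℝ) • (cosWave (l - m) - cosWave (l + m)) := by
        ext x
        simp [cosWave_apply, sinWave_apply, inner_add_left, inner_sub_left, mul_add, mul_sub,
          Real.cos_add, Real.cos_sub]
        ring
      rw [this]
      exact Submodule.smul_mem _ _ (sub_mem (cosWave_mem _) (cosWave_mem _))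
  | zero_left b hb => simp
  | zero_right a ha => simp
  | add_left a a' b _ _ _ h1 h2 => rw [add_mul]; exact add_mem h1 h2
  | add_right a b b' _ _ _ h1 h2 => rw [mul_add]; exact add_mem h1 h2
  | smul_left c a b _ _ h => rw [smul_mul_assoc]; exact Submodule.smul_mem _ _ h
  | smul_right c a b _ _ h => rw [mul_smul_comm]; exact Submodule.smul_mem _ _ h

lemma aeval_mem_trigPoly {N : ℕ} {a : E N →ᵇ ℝ} (ha : a ∈ trigPoly N) (p : Polynomial ℝ) :
    Polynomial.aeval a p ∈ trigPoly N := by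
  have hpow : ∀ n : ℕ, a ^ n ∈ trigPoly N := fun n => by
    induction n with
    | zero => simpa using one_mem_trigPoly N
    | succ n ih => rw [pow_succ]; exact mul_mem_trigPoly ih ha
  rw [Polynomial.aeval_eq_sum_range]
  exact Submodule.sum_mem _ fun i _ => Submodule.smul_mem _ _ (hpow i)

lemma aeval_bcf_apply {X : Type*} [TopologicalSpace X] (a : X →ᵇ ℝ) (p : Polynomial ℝ) (x : X) :
    Polynomial.aeval a p x = p.eval (a x) := by
  rw [Polynomial.aeval_eq_sum_range, Polynomial.eval_eq_sum_range, BoundedContinuousFunction.sum_apply]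
  simp

lemma exists_inner_eq_half {N : ℕ} {lam : E N} (h : lam ≠ 0) : ∃ v, inner ℝ lam v = (1 / 2 : ℝ) := by
  refine ⟨(1 / 2 / ‖lam‖ ^ 2) • lam, ?_⟩
  rw [inner_smul_right, real_inner_self_eq_norm_sq]
  field_simp

/-- A wave of nonzero frequency λ changes sign under translation by v with λ · v = 1/2, since the
phase moves by π. Waves of frequency zero are constant. -/
lemma exists_hasMeanValue_trigPoly {N : ℕ} {a : E N →ᵇ ℝ} (ha : a ∈ trigPoly N) :
    ∃ m, HasMeanValue a m := by
  induction ha using Submodule.span_induction with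
  | mem a ha =>
    have hconst : ∀ c : ℝ, HasMeanValue (fun _ : E N => c) c := fun c => by
      refine tendsto_const_nhds.congr' ?_
      filter_upwards [eventually_gt_atTop 0] with R hR
      rw [setIntegral_const, measureReal_cube N hR.le, smul_eq_mul]
      field_simp
    rcases ha with ⟨l, rfl⟩ | ⟨l, rfl⟩
    · by_cases hl : l = 0
      · refine ⟨1, ?_⟩
        have : (cosWave l : E N → ℝ) = fun _ => 1 := by ext x; simp [cosWave_apply, hl]
        exact this ▸ hconst 1
      · obtain ⟨v, hv⟩ := exists_inner_eq_half hl
        refine ⟨0, hasMeanValue_zero_of_antiperiodic _ v fun x => ?_⟩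
        rw [cosWave_apply, cosWave_apply, inner_add_right, hv, ← Real.cos_add_pi]
        congr 1
        ring
    · by_cases hl : l = 0
      · refine ⟨0, ?_⟩
        have : (sinWave l : E N → ℝ) = fun _ => 0 := by ext x; simp [sinWave_apply, hl]
        exact this ▸ hconst 0
      · obtain ⟨v, hv⟩ := exists_inner_eq_half hl
        refine ⟨0, hasMeanValue_zero_of_antiperiodic _ v fun x => ?_⟩
        rw [sinWave_apply, sinWave_apply, inner_add_right, hv, ← Real.sin_add_pi]
        congr 1
        ring
  | zero => exact ⟨0, by simp [HasMeanValue]⟩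
  | add a b _ _ h1 h2 =>
    obtain ⟨m, hm⟩ := h1
    obtain ⟨n, hn⟩ := h2
    exact ⟨m + n, hm.add a.continuous.locallyIntegrable b.continuous.locallyIntegrable hn⟩
  | smul c a _ h =>
    obtain ⟨m, hm⟩ := h
    exact ⟨c * m, hm.smul c⟩

/-! ### Approximation for `N1` and mean values of absolute values. -/

lemma N1_mono {N : ℕ} {h k : E N → ℝ} (hhk : ∀ x, |h x| ≤ |k x|) : N1 h ≤ N1 k := by
  refine limsup_le_limsup (Eventually.of_forall fun R => ?_)
  dsimp only
  gcongr with x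
  simpa [enorm_le_iff_norm_le] using hhk x

lemma N1_le_of_bound {N : ℕ} {h : E N → ℝ} {ε : ℝ} (hε : ∀ x, |h x| ≤ ε) :
    N1 h ≤ ENNReal.ofReal ε := by
  refine limsup_le_of_le (by isBoundedDefault) ?_
  filter_upwards [eventually_gt_atTop 0] with R hR
  have hR' : 0 < R ^ N := by positivity
  calc (ENNReal.ofReal (R ^ N))⁻¹ * ∫⁻ x in cube N R, ‖h x‖ₑ
      ≤ (ENNReal.ofReal (R ^ N))⁻¹ * ∫⁻ x in cube N R, ENNReal.ofReal ε := by
        gcongr with x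
        rw [← ofReal_norm]
        exact ENNReal.ofReal_le_ofReal (hε x)
    _ = ENNReal.ofReal ε := by
        rw [setLIntegral_const, volume_cube N hR.le, mul_comm, mul_assoc, ENNReal.mul_inv_cancel,
          mul_one]
        · simpa using hR'
        · exact ENNReal.ofReal_ne_top

/-- A function that is approximated for `N1` by functions with a mean value has a mean value. -/
lemma exists_hasMeanValue_of_approx {N : ℕ} {h : E N → ℝ} (hh : LocallyIntegrable h)
    (H : ∀ ε : ℝ, 0 < ε → ∃ a : E N → ℝ, LocallyIntegrable a ∧ (∃ m, HasMeanValue a m) ∧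
      N1 (h - a) < ENNReal.ofReal ε) : ∃ m, HasMeanValue h m := by
  -- No candidate for the limit is at hand, so the averages are shown to be Cauchy: they are
  -- eventually close to the mean value of an approximant.
  refine cauchy_map_iff_exists_tendsto.1 (Metric.cauchy_iff.2 ⟨inferInstance, fun ε hε => ?_⟩)
  obtain ⟨a, ha, ⟨m, hm⟩, haN⟩ := H (ε / 4) (by positivity)
  have h1 := eventually_lt_of_limsup_lt haN
  have h2 := (Metric.tendsto_nhds.1 hm) (ε / 4) (by positivity)
  have key : ∀ᶠ R : ℝ in atTop, dist ((R ^ N)⁻¹ * ∫ x in cube N R, h x) m < ε / 2 := by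
    filter_upwards [h1, h2, eventually_gt_atTop 0] with R hR1 hR2 hR
    have hR' : 0 < R ^ N := by positivity
    have hhi := hh.integrableOn_isCompact (isCompact_cube N R)
    have hai := ha.integrableOn_isCompact (isCompact_cube N R)
    have e : dist ((R ^ N)⁻¹ * ∫ x in cube N R, h x) ((R ^ N)⁻¹ * ∫ x in cube N R, a x) < ε / 4 := by
      rw [Real.dist_eq, ← mul_sub, ← integral_sub hhi hai, abs_mul, abs_of_pos (inv_pos.2 hR')]
      have e1 : ENNReal.ofReal ((R ^ N)⁻¹ * |∫ x in cube N R, h x - a x|)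
          ≤ (ENNReal.ofReal (R ^ N))⁻¹ * ∫⁻ x in cube N R, ‖(h - a) x‖ₑ := by
        rw [ENNReal.ofReal_mul (inv_pos.2 hR').le, ENNReal.ofReal_inv_of_pos hR']
        gcongr
        rw [← Real.norm_eq_abs, ofReal_norm]
        exact enorm_integral_le_lintegral_enorm _
      exact (ENNReal.ofReal_lt_ofReal_iff (by positivity)).1 (e1.trans_lt hR1)
    have := dist_triangle ((R ^ N)⁻¹ * ∫ x in cube N R, h x) ((R ^ N)⁻¹ * ∫ x in cube N R, a x) m
    linarith
  refine ⟨Metric.ball m (ε / 2), key, fun x hx y hy => ?_⟩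
  have := dist_triangle_right x y m
  rw [Metric.mem_ball] at hx hy
  linarith

/-- Weierstrass on [-‖a‖, ‖a‖] gives a polynomial p with p(a) uniformly close to |a|, and p(a) is
again a trigonometric polynomial. -/
lemma exists_hasMeanValue_abs_trigPoly {N : ℕ} {a : E N →ᵇ ℝ} (ha : a ∈ trigPoly N) :
    ∃ m, HasMeanValue (fun x => |a x|) m := by
  refine exists_hasMeanValue_of_approx (by fun_prop : Continuous fun x => |a x|).locallyIntegrable
    fun ε hε => ?_
  obtain ⟨p, hp⟩ := exists_polynomial_near_of_continuousOn (-‖a‖) ‖a‖ (fun x => |x|)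
    continuous_abs.continuousOn (ε / 2) (by positivity)
  refine ⟨Polynomial.aeval a p, (Polynomial.aeval a p).continuous.locallyIntegrable,
    exists_hasMeanValue_trigPoly (aeval_mem_trigPoly ha p), ?_⟩
  refine (N1_le_of_bound (ε := ε / 2) fun x => ?_).trans_lt
    ((ENNReal.ofReal_lt_ofReal_iff hε).2 (by linarith))
  have := hp (a x) (abs_le.1 (by simpa using a.norm_coe_le_norm x))
  rw [Pi.sub_apply, aeval_bcf_apply, abs_sub_comm]
  exact this.le

/-- The absolute value of a function of `L^1_loc ∩ B^1` has a mean value. -/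
lemma exists_hasMeanValue_abs {N : ℕ} {h : E N → ℝ} (hh : h ∈ LocB1 N) :
    ∃ m, HasMeanValue (fun x => |h x|) m := by
  have hl : LocallyIntegrable h := hh.1
  have hln : LocallyIntegrable fun x => |h x| := fun x => (hl x).norm
  refine exists_hasMeanValue_of_approx hln fun ε hε => ?_
  obtain ⟨a, ha, haN⟩ := hh.2 (ENNReal.ofReal (ε / 4)) (by simpa using hε)
  obtain ⟨b, hb, hab⟩ := Metric.mem_closure_iff.1 ha (ε / 8) (by positivity)
  refine ⟨fun x => |b x|, (by fun_prop : Continuous fun x => |b x|).locallyIntegrable,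
    exists_hasMeanValue_abs_trigPoly hb, ?_⟩
  have h1 : N1 ((a : E N → ℝ) - (b : E N → ℝ)) < ENNReal.ofReal (ε / 4) := by
    refine (N1_le_of_bound (ε := ε / 8) fun x => ?_).trans_lt
      ((ENNReal.ofReal_lt_ofReal_iff (by positivity)).2 (by linarith))
    exact (BoundedContinuousFunction.dist_coe_le_dist (f := a) (g := b) x).trans hab.le
  have h2 := N1_add_lt (hl.aestronglyMeasurable.sub a.continuous.aestronglyMeasurable) haN h1
  rw [← ENNReal.ofReal_add (by positivity) (by positivity)] at h2
  refine ((N1_mono fun x => ?_).trans h2).trans_lt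
    ((ENNReal.ofReal_lt_ofReal_iff hε).2 (by linarith))
  simp only [Pi.sub_apply, Pi.add_apply, sub_add_sub_cancel]
  exact abs_abs_sub_abs_le _ _

/-! ### Chaining bound for the suprema of Brownian paths. -/

/-- Chaining along dyadic points. -/
lemma abs_dyadic_sub_le {c : ℝ → ℝ} {T : ℝ} {d : ℕ → ℝ} (hd : ∀ n, 0 ≤ d n)
    (h : ∀ n : ℕ, ∀ j < 2 ^ n, |c ((j + 1 : ℕ) * (T / 2 ^ n)) - c (j * (T / 2 ^ n))| ≤ d n)
    (n : ℕ) : ∀ j : ℕ, j ≤ 2 ^ n → |c (j * (T / 2 ^ n)) - c 0| ≤ ∑ m ∈ Finset.range (n + 1), d m := by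
  induction n with
  | zero =>
    intro j hj
    simp only [pow_zero] at hj
    interval_cases j
    · simpa using hd 0
    · simpa using h 0 0 (by norm_num)
  | succ n ih =>
    have even : ∀ i ≤ 2 ^ n, |c ((2 * i : ℕ) * (T / 2 ^ (n + 1))) - c 0|
        ≤ ∑ m ∈ Finset.range (n + 1), d m := fun i hi => by
      have e : ((2 * i : ℕ) : ℝ) * (T / 2 ^ (n + 1)) = i * (T / 2 ^ n) := by
        push_cast
        rw [pow_succ]
        field_simp
      rw [e]
      exact ih i hi
    intro j hj
    rw [Finset.sum_range_succ]
    rw [pow_succ] at hj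
    -- A point of even index already belongs to the previous level; one of odd index is a single
    -- increment away from such a point.
    obtain ⟨i, rfl | rfl⟩ := Nat.even_or_odd' j
    · exact (even i (by omega)).trans (by linarith [hd (n + 1)])
    · have h1 := even i (by omega)
      have h2 := h (n + 1) (2 * i) (by rw [pow_succ]; omega)
      have := abs_sub_le (c ((2 * i + 1 : ℕ) * (T / 2 ^ (n + 1))))
        (c ((2 * i : ℕ) * (T / 2 ^ (n + 1)))) (c 0)
      linarith

/-- Either x ≤ l or (x / l)^3 ≥ 1. This lets the largest of many increments be bounded by a
threshold plus a sum of fourth powers, whose expectation is computable. -/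
lemma le_add_pow_four_div {x l : ℝ} (hx : 0 ≤ x) (hl : 0 < l) : x ≤ l + x ^ 4 / l ^ 3 := by
  rcases le_total x l with h | h
  · have : 0 ≤ x ^ 4 / l ^ 3 := by positivity
    linarith
  · have : x ≤ x ^ 4 / l ^ 3 := by
      rw [le_div_iff₀ (by positivity), pow_succ' x 3]
      gcongr
    linarith

/-- The terms of a majorant of the oscillation of a path over `[0, T]`. -/
def oscTerm (c : ℝ → ℝ) (T : ℝ) (m : ℕ) : ℝ :=
  (9 / 10) ^ m + ∑ j ∈ Finset.range (2 ^ m),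
    |c ((j + 1 : ℕ) * (T / 2 ^ m)) - c (j * (T / 2 ^ m))| ^ 4 / ((9 / 10) ^ m) ^ 3

lemma oscTerm_nonneg (c : ℝ → ℝ) (T : ℝ) (m : ℕ) : 0 ≤ oscTerm c T m :=
  add_nonneg (by positivity) (Finset.sum_nonneg fun _ _ => by positivity)

lemma le_oscTerm (c : ℝ → ℝ) (T : ℝ) (m : ℕ) {j : ℕ} (hj : j < 2 ^ m) :
    |c ((j + 1 : ℕ) * (T / 2 ^ m)) - c (j * (T / 2 ^ m))| ≤ oscTerm c T m := by
  refine (le_add_pow_four_div (abs_nonneg _) (by positivity : (0 : ℝ) < (9 / 10) ^ m)).trans ?_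
  unfold oscTerm
  gcongr
  exact Finset.single_le_sum (f := fun j : ℕ =>
    |c ((j + 1 : ℕ) * (T / 2 ^ m)) - c (j * (T / 2 ^ m))| ^ 4 / ((9 / 10) ^ m) ^ 3)
    (fun _ _ => by positivity) (Finset.mem_range.2 hj)

/-- A majorant of the oscillation of a path over `[0, T]`. -/
def oscMajorant (c : ℝ → ℝ) (T : ℝ) : ℝ≥0∞ := ∑' m, ENNReal.ofReal (oscTerm c T m)

/-- The chaining bound holds at dyadic points with a majorant that does not depend on the level, and
passes to all times by continuity of the path. -/
lemma ofReal_abs_sub_le_oscMajorant {c : ℝ → ℝ} (hc : Continuous c) {T : ℝ} (hT : 0 < T) {t : ℝ}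
    (ht : t ∈ Icc 0 T) : ENNReal.ofReal |c t - c 0| ≤ oscMajorant c T := by
  have hcl : IsClosed {s | ENNReal.ofReal |c s - c 0| ≤ oscMajorant c T} :=
    isClosed_le (ENNReal.continuous_ofReal.comp (by fun_prop)) continuous_const
  have hfl : Tendsto (fun n : ℕ => (⌊t / T * 2 ^ n⌋₊ : ℝ) * (T / 2 ^ n)) atTop (𝓝 t) := by
    have h1 := (tendsto_nat_floor_mul_div_atTop (R := ℝ) (a := t / T) (div_nonneg ht.1 hT.le)).comp
      (tendsto_pow_atTop_atTop_of_one_lt (one_lt_two : (1 : ℝ) < 2))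
    have h2 := h1.mul_const T
    rw [div_mul_cancel₀ _ hT.ne'] at h2
    refine h2.congr fun n => ?_
    simp only [Function.comp]
    ring
  refine hcl.mem_of_tendsto hfl (Eventually.of_forall fun n => ?_)
  have hj : ⌊t / T * 2 ^ n⌋₊ ≤ 2 ^ n := by
    refine Nat.floor_le_of_le ?_
    push_cast
    exact mul_le_of_le_one_left (by positivity) ((div_le_one hT).2 ht.2)
  have := abs_dyadic_sub_le (oscTerm_nonneg c T) (fun n j hj => le_oscTerm c T n hj) n _ hj
  refine (ENNReal.ofReal_le_ofReal this).trans ?_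
  rw [ENNReal.ofReal_sum_of_nonneg fun _ _ => oscTerm_nonneg c T _]
  exact ENNReal.sum_le_tsum _

lemma lintegral_pow_four_gaussianReal (v : ℝ≥0) :
    ∫⁻ x, ENNReal.ofReal (|x| ^ 4) ∂(gaussianReal 0 v)
      = ENNReal.ofReal (v ^ 2 : ℝ) * ∫⁻ x, ENNReal.ofReal (|x| ^ 4) ∂(gaussianReal 0 1) := by
  have e : gaussianReal 0 v = (gaussianReal 0 1).map (√v * ·) := by
    rw [gaussianReal_map_const_mul]
    congr 1
    · simp
    · ext; simp
  rw [e, lintegral_map (by fun_prop) (by fun_prop), ← lintegral_const_mul _ (by fun_prop)]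
  congr 1 with x
  rw [← ENNReal.ofReal_mul (by positivity)]
  congr 1
  rw [abs_mul, mul_pow, abs_of_nonneg (Real.sqrt_nonneg _),
    show √(v : ℝ) ^ 4 = (√(v : ℝ) ^ 2) ^ 2 by ring, Real.sq_sqrt v.coe_nonneg]

lemma lintegral_pow_four_gaussianReal_lt_top :
    ∫⁻ x, ENNReal.ofReal (|x| ^ 4) ∂(gaussianReal 0 1) < ∞ := by
  have h := (memLp_id_gaussianReal (μ := 0) (v := 1) 4).integrable_norm_pow (by norm_num)
  have h2 := h.2
  rw [hasFiniteIntegral_iff_norm] at h2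
  simpa using h2

/-- The bound depends only on the laws of the increments, so one constant serves all Brownian
motions; this uniformity is what makes the weighted sum over k converge. -/
lemma exists_lintegral_oscMajorant_le {Ω : Type*} [MeasurableSpace Ω] (P : Measure Ω)
    [IsProbabilityMeasure P] {T : ℝ} (hT : 0 < T) :
    ∃ C : ℝ≥0∞, C < ∞ ∧ ∀ B : ℝ≥0 → Ω → ℝ, IsBrownianReal B P →
      AEMeasurable (fun ω => oscMajorant (fun s => B s.toNNReal ω) T) P ∧
      ∫⁻ ω, oscMajorant (fun s => B s.toNNReal ω) T ∂P ≤ C := by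
  set K : ℝ≥0∞ := ∫⁻ x, ENNReal.ofReal (|x| ^ 4) ∂(gaussianReal 0 1) with hK
  -- At level m there are 2^m increments of variance T / 2^m, hence with fourth moments K T² / 4^m.
  -- After division by (9/10)^{3m} the ratio is (1/2)(10/9)^3 = 500/729 < 1; any base between
  -- 2^{-1/3} and 1 in place of 9/10 would do.
  refine ⟨∑' m : ℕ, (ENNReal.ofReal ((9 / 10) ^ m)
    + ENNReal.ofReal (T ^ 2 * (500 / 729) ^ m) * K), ?_, fun B hB => ?_⟩
  · rw [ENNReal.tsum_add, ENNReal.tsum_mul_right]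
    have h1 : Summable fun m : ℕ => ((9 / 10 : ℝ)) ^ m :=
      summable_geometric_of_lt_one (by norm_num) (by norm_num)
    have h2 : Summable fun m : ℕ => T ^ 2 * (500 / 729 : ℝ) ^ m :=
      (summable_geometric_of_lt_one (by norm_num) (by norm_num)).mul_left _
    exact ENNReal.add_lt_top.2 ⟨h1.tsum_ofReal_lt_top,
      ENNReal.mul_lt_top h2.tsum_ofReal_lt_top lintegral_pow_four_gaussianReal_lt_top⟩
  · have hm : ∀ s, AEMeasurable (B s) P := hB.aemeasurable
    have hmt : ∀ m, AEMeasurable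
        (fun ω => ENNReal.ofReal (oscTerm (fun s => B s.toNNReal ω) T m)) P := fun m => by
      unfold oscTerm
      fun_prop
    refine ⟨AEMeasurable.tsum hmt, ?_⟩
    unfold oscMajorant
    rw [lintegral_tsum hmt]
    refine ENNReal.tsum_le_tsum fun m => ?_
    have hpos : (0 : ℝ) < ((9 / 10) ^ m) ^ 3 := by positivity
    have e : ∀ ω, ENNReal.ofReal (oscTerm (fun s => B s.toNNReal ω) T m)
        = ENNReal.ofReal ((9 / 10) ^ m) + ∑ j ∈ Finset.range (2 ^ m),
          ENNReal.ofReal (((9 / 10) ^ m) ^ 3)⁻¹ * ENNReal.ofReal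
            (|(B ((j + 1 : ℕ) * (T / 2 ^ m) : ℝ).toNNReal - B (j * (T / 2 ^ m) : ℝ).toNNReal) ω| ^ 4) := by
      intro ω
      unfold oscTerm
      rw [ENNReal.ofReal_add (by positivity) (Finset.sum_nonneg fun _ _ => by positivity),
        ENNReal.ofReal_sum_of_nonneg (fun _ _ => by positivity)]
      congr 1
      refine Finset.sum_congr rfl fun j _ => ?_
      rw [← ENNReal.ofReal_mul (by positivity), div_eq_mul_inv,
        mul_comm _ (((9 / 10 : ℝ) ^ m) ^ 3)⁻¹]
      rfl
    simp_rw [e]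
    have hmd : ∀ s t, AEMeasurable (fun ω => ENNReal.ofReal (|(B s - B t) ω| ^ 4)) P := fun s t => by
      have := (hm s).sub (hm t)
      fun_prop
    rw [lintegral_add_left measurable_const, lintegral_const, measure_univ, mul_one,
      lintegral_finsetSum' _ fun j _ => (hmd _ _).const_mul _]
    gcongr
    have each : ∀ j ∈ Finset.range (2 ^ m), ∫⁻ ω, ENNReal.ofReal (((9 / 10) ^ m) ^ 3)⁻¹ *
        ENNReal.ofReal (|(B ((j + 1 : ℕ) * (T / 2 ^ m) : ℝ).toNNReal
          - B (j * (T / 2 ^ m) : ℝ).toNNReal) ω| ^ 4) ∂P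
        = ENNReal.ofReal ((((9 / 10) ^ m) ^ 3)⁻¹ * (T / 2 ^ m) ^ 2) * K := by
      intro j _
      have hlaw := hB.hasLaw_sub ((j + 1 : ℕ) * (T / 2 ^ m) : ℝ).toNNReal (j * (T / 2 ^ m) : ℝ).toNNReal
      rw [lintegral_const_mul'' _ (hmd _ _),
        hlaw.lintegral_comp (f := fun x => ENNReal.ofReal (|x| ^ 4)) (by fun_prop),
        lintegral_pow_four_gaussianReal, ← mul_assoc, ← ENNReal.ofReal_mul (by positivity)]
      congr 4
      rw [coe_nndist, NNReal.val_eq_coe, NNReal.val_eq_coe, Real.coe_toNNReal _ (by positivity), Real.coe_toNNReal _ (by positivity),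
        Real.dist_eq]
      push_cast
      rw [← sub_mul, add_sub_cancel_left, one_mul, abs_of_nonneg (by positivity)]
    rw [Finset.sum_congr rfl each, Finset.sum_const, Finset.card_range, nsmul_eq_mul, ← mul_assoc]
    gcongr
    rw [← ENNReal.ofReal_natCast, ← ENNReal.ofReal_mul (by positivity)]
    refine ENNReal.ofReal_le_ofReal (le_of_eq ?_)
    push_cast
    have e5 : (500 / 729 : ℝ) ^ m = 2 ^ m * ((2 ^ m) ^ 2)⁻¹ * (((9 / 10) ^ m) ^ 3)⁻¹ := by
      rw [← pow_mul, ← pow_mul, mul_comm m 2, mul_comm m 3, pow_mul, pow_mul, ← inv_pow (2 ^ 2 : ℝ),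
        ← inv_pow ((9 / 10) ^ 3 : ℝ),
        ← mul_pow, ← mul_pow]
      norm_num
    rw [e5]
    ring

/-- Almost surely, the suprema over `[0, T]` of countably many Brownian motions are summable against
any given summable weights. -/
lemma ae_exists_summable_bound {Ω : Type*} [MeasurableSpace Ω] (P : Measure Ω)
    [IsProbabilityMeasure P] {T : ℝ} (hT : 0 < T) {β : ℕ → ℝ≥0 → Ω → ℝ}
    (hβ : ∀ k, IsBrownianReal (β k) P) {a : ℕ → ℝ} (ha : ∀ k, 0 < a k) (has : Summable a) :
    ∀ᵐ ω ∂P, ∃ S : ℕ → ℝ, (∀ k, ∀ t ∈ Icc 0 T, |β k t.toNNReal ω| ≤ S k) ∧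
      Summable fun k => a k * S k := by
  obtain ⟨C, hC, hB⟩ := exists_lintegral_oscMajorant_le P hT
  set D : ℕ → Ω → ℝ≥0∞ := fun k ω => oscMajorant (fun s => β k s.toNNReal ω) T with hD
  have hmeas : ∀ k, AEMeasurable (fun ω => ENNReal.ofReal (a k) * D k ω) P :=
    fun k => (hB _ (hβ k)).1.const_mul _
  -- Tonelli: the weighted sum of the majorants has finite expectation, hence is finite almost
  -- surely.
  have hfin : ∫⁻ ω, ∑' k, ENNReal.ofReal (a k) * D k ω ∂P ≠ ∞ := by
    rw [lintegral_tsum hmeas]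
    refine ne_top_of_le_ne_top (b := ∑' k, ENNReal.ofReal (a k) * C) ?_
      (ENNReal.tsum_le_tsum fun k => ?_)
    · rw [ENNReal.tsum_mul_right]
      exact (ENNReal.mul_lt_top has.tsum_ofReal_lt_top hC).ne
    · rw [lintegral_const_mul'' _ (hB _ (hβ k)).1]
      gcongr
      exact (hB _ (hβ k)).2
  filter_upwards [ae_lt_top' (AEMeasurable.tsum hmeas) hfin,
    ae_all_iff.2 fun k => (hβ k).cont, ae_all_iff.2 fun k => (hβ k).eval_zero_ae_eq_zero]
    with ω hω hcont h0
  have hDfin : ∀ k, D k ω ≠ ∞ := fun k hk => by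
    have := ENNReal.ne_top_of_tsum_ne_top hω.ne k
    rw [hk, ENNReal.mul_top (by simpa using ha k)] at this
    exact this rfl
  refine ⟨fun k => (D k ω).toReal, fun k t ht => ?_, ?_⟩
  · have h1 := ofReal_abs_sub_le_oscMajorant (c := fun s => β k s.toNNReal ω)
      ((hcont k).comp continuous_real_toNNReal) hT ht
    simp only [Real.toNNReal_zero, h0 k, sub_zero] at h1
    exact (ENNReal.ofReal_le_iff_le_toReal (hDfin k)).1 h1
  · have h := ENNReal.summable_toReal hω.ne
    refine h.congr fun k => ?_
    rw [ENNReal.toReal_mul, ENNReal.toReal_ofReal (ha k).le]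

/-! ### Regularity of the noise. -/

/-- A field on `ℝ × ℝ^N` that is `C^{1,1}` in space, uniformly in time, and continuous in time,
uniformly in space, together with its gradient. -/
structure IsRegularField {N : ℕ} (J : ℝ → E N → ℝ) (M : ℝ) : Prop where
  differentiable : ∀ t, Differentiable ℝ (J t)
  norm_gradient_le : ∀ t x, ‖gradient (J t) x‖ ≤ M
  norm_gradient_sub_le : ∀ t x y, ‖gradient (J t) x - gradient (J t) y‖ ≤ M * ‖x - y‖
  equicontinuous : ∀ η > 0, ∃ ε > 0, ∀ t t', |t - t'| ≤ ε → ∀ x, |J t x - J t' x| ≤ η ∧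
    ‖gradient (J t) x - gradient (J t') x‖ ≤ η

lemma norm_gradient {N : ℕ} (h : E N → ℝ) (x : E N) : ‖gradient h x‖ = ‖fderiv ℝ h x‖ := by
  simp [gradient]

lemma norm_gradient_sub {N : ℕ} (h k : E N → ℝ) (x y : E N) :
    ‖gradient h x - gradient k y‖ = ‖fderiv ℝ h x - fderiv ℝ k y‖ := by
  simp [gradient, ← map_sub]

lemma norm_fderiv_sub_le_of_iteratedFDeriv {N : ℕ} {g : E N → ℝ} (hg : ContDiff ℝ 2 g) {a : ℝ}
    (h : ∀ x, ‖iteratedFDeriv ℝ 2 g x‖ ≤ a) (x y : E N) :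
    ‖fderiv ℝ g x - fderiv ℝ g y‖ ≤ a * ‖x - y‖ := by
  have hd : Differentiable ℝ (fderiv ℝ g) :=
    (hg.fderiv_right (m := 1) (by norm_num)).differentiable (by norm_num)
  refine convex_univ.norm_image_sub_le_of_norm_fderiv_le (𝕜 := ℝ) (fun z _ => hd z) (fun z _ => ?_)
    (mem_univ y) (mem_univ x)
  refine le_trans (le_of_eq ?_) (h z)
  rw [← norm_iteratedFDeriv_one (𝕜 := ℝ), norm_iteratedFDeriv_fderiv]

lemma abs_clamp_sub_le (T t t' : ℝ) :
    |max 0 (min t T) - max 0 (min t' T)| ≤ |t - t'| := by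
  refine (abs_max_sub_max_le_max _ _ _ _).trans (max_le (by simp) ?_)
  exact (abs_min_sub_min_le_max _ _ _ _).trans (by simp)

section Series

variable {N : ℕ} {g : ℕ → E N → ℝ} {a S : ℕ → ℝ} {b : ℕ → ℝ → ℝ}

lemma hasFDerivAt_noiseSeries (hg : ∀ k, Differentiable ℝ (g k)) (hg0 : ∀ k x, |g k x| ≤ a k)
    (hg1 : ∀ k x, ‖fderiv ℝ (g k) x‖ ≤ a k) (hb : ∀ k t, |b k t| ≤ S k)
    (hs : Summable fun k => a k * S k) (t : ℝ) (x : E N) :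
    HasFDerivAt (fun x => ∑' k, g k x * b k t) (∑' k, b k t • fderiv ℝ (g k) x) x := by
  have ha : ∀ k, 0 ≤ a k := fun k => (abs_nonneg _).trans (hg0 k 0)
  refine hasFDerivAt_tsum hs (fun k y => ((hg k y).hasFDerivAt.mul_const (b k t))) (fun k y => ?_)
    (x₀ := 0) (Summable.of_norm_bounded hs fun k => ?_) x
  · rw [norm_smul, mul_comm, Real.norm_eq_abs]
    exact mul_le_mul (hg1 k y) (hb k t) (abs_nonneg _) (ha k)
  · rw [norm_mul, Real.norm_eq_abs, Real.norm_eq_abs]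
    exact mul_le_mul (hg0 k 0) (hb k t) (abs_nonneg _) (ha k)

/-- All the space bounds follow termwise from the majorant a_k S_k. In time both oscillations are at
most Σ a_k |b_k(t) - b_k(t')|, a continuous function of (t, t') that vanishes on the diagonal;
compactness of [0, T]² makes it uniformly small near the diagonal, and `hbT` extends this to all
times. -/
lemma isRegularField_series (hg : ∀ k, ContDiff ℝ 2 (g k)) (hg0 : ∀ k x, |g k x| ≤ a k)
    (hg1 : ∀ k x, ‖fderiv ℝ (g k) x‖ ≤ a k) (hg2 : ∀ k x, ‖iteratedFDeriv ℝ 2 (g k) x‖ ≤ a k)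
    (hbc : ∀ k, Continuous (b k)) (hb : ∀ k t, |b k t| ≤ S k)
    (hs : Summable fun k => a k * S k) {T : ℝ} (hbT : ∀ k t, b k (max 0 (min t T)) = b k t)
    (hT : 0 ≤ T) :
    IsRegularField (fun t x => ∑' k, g k x * b k t) (∑' k, a k * S k) := by
  have ha : ∀ k, 0 ≤ a k := fun k => (abs_nonneg _).trans (hg0 k 0)
  have hd := hasFDerivAt_noiseSeries (fun k => (hg k).differentiable (by norm_num)) hg0 hg1 hb hs
  have hsb : ∀ c : ℕ → ℝ, (∀ k, |c k| ≤ a k) → ∀ t, Summable fun k => ‖c k * b k t‖ := fun c hc t =>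
    Summable.of_nonneg_of_le (fun _ => norm_nonneg _) (fun k => by
      rw [norm_mul, Real.norm_eq_abs, Real.norm_eq_abs]
      exact mul_le_mul (hc k) (hb k t) (abs_nonneg _) (ha k)) hs
  have hsF : ∀ t x, Summable fun k => ‖b k t • fderiv ℝ (g k) x‖ := fun t x =>
    Summable.of_nonneg_of_le (fun _ => norm_nonneg _) (fun k => by
      rw [norm_smul, mul_comm, Real.norm_eq_abs]
      exact mul_le_mul (hg1 k x) (hb k t) (abs_nonneg _) (ha k)) hs
  have hmbound : ∀ k t t', a k * |b k t - b k t'| ≤ a k * (2 * S k) := fun k t t' => by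
    have := abs_sub (b k t) (b k t')
    gcongr
    · exact ha k
    · linarith [hb k t, hb k t']
  have hs2 : Summable fun k => a k * (2 * S k) := by
    refine (hs.mul_left 2).congr fun k => by ring
  have hsm : ∀ t t', Summable fun k => a k * |b k t - b k t'| := fun t t' =>
    Summable.of_nonneg_of_le (fun k => mul_nonneg (ha k) (abs_nonneg _)) (fun k => hmbound k t t') hs2
  refine ⟨fun t x => (hd t x).differentiableAt, fun t x => ?_, fun t x y => ?_, fun η hη => ?_⟩
  · rw [norm_gradient, (hd t x).fderiv]
    refine tsum_of_norm_bounded hs.hasSum fun k => ?_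
    rw [norm_smul, mul_comm, Real.norm_eq_abs]
    exact mul_le_mul (hg1 k x) (hb k t) (abs_nonneg _) (ha k)
  · rw [norm_gradient_sub, (hd t x).fderiv, (hd t y).fderiv,
      ← (hsF t x).of_norm.tsum_sub (hsF t y).of_norm, ← tsum_mul_right]
    refine tsum_of_norm_bounded (hs.mul_right _).hasSum fun k => ?_
    rw [← smul_sub, norm_smul, mul_comm, Real.norm_eq_abs]
    have h1 := norm_fderiv_sub_le_of_iteratedFDeriv (hg k) (hg2 k) x y
    calc _ ≤ a k * ‖x - y‖ * S k :=
        mul_le_mul h1 (hb k t) (abs_nonneg _) (mul_nonneg (ha k) (norm_nonneg _))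
      _ = _ := by ring
  · set m : ℝ × ℝ → ℝ := fun p => ∑' k, a k * |b k p.1 - b k p.2| with hm
    have hmc : Continuous m := continuous_tsum
      (fun k => by have := hbc k; fun_prop) hs2 fun k p => by
        rw [Real.norm_eq_abs, abs_of_nonneg (mul_nonneg (ha k) (abs_nonneg _))]
        exact hmbound k p.1 p.2
    have hu := (isCompact_Icc.prod isCompact_Icc).uniformContinuousOn_of_continuous
      (s := Icc (0 : ℝ) T ×ˢ Icc (0 : ℝ) T) hmc.continuousOn
    obtain ⟨ε, hε, h⟩ := Metric.uniformContinuousOn_iff.1 hu η hη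
    have key : ∀ t t', |t - t'| ≤ ε / 2 → m (t, t') ≤ η := by
      intro t t' htt
      have hc : ∀ t, max 0 (min t T) ∈ Icc 0 T := fun t =>
        ⟨le_max_left _ _, max_le hT (min_le_right _ _)⟩
      have h1 := h (max 0 (min t T), max 0 (min t' T)) ⟨hc t, hc t'⟩
        (max 0 (min t T), max 0 (min t T)) ⟨hc t, hc t⟩ (by
          rw [Prod.dist_eq, dist_self, max_eq_right dist_nonneg, dist_comm, Real.dist_eq]
          exact ((abs_clamp_sub_le T t t').trans htt).trans_lt (half_lt_self hε))
      have e1 : m (max 0 (min t T), max 0 (min t' T)) = m (t, t') := by simp [hm, hbT]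
      have e2 : m (max 0 (min t T), max 0 (min t T)) = 0 := by simp [hm]
      rw [e1, e2, Real.dist_eq, sub_zero] at h1
      exact (le_abs_self _).trans h1.le
    refine ⟨ε / 2, by positivity, fun t t' htt x => ⟨?_, ?_⟩⟩
    · refine le_trans ?_ (key t t' htt)
      rw [← (hsb _ (hg0 · x) t).of_norm.tsum_sub (hsb _ (hg0 · x) t').of_norm, ← Real.norm_eq_abs]
      refine tsum_of_norm_bounded (hsm t t').hasSum fun k => ?_
      rw [← mul_sub, norm_mul]
      exact mul_le_mul_of_nonneg_right (hg0 k x) (norm_nonneg _)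
    · refine le_trans ?_ (key t t' htt)
      rw [norm_gradient_sub, (hd t x).fderiv, (hd t' x).fderiv,
        ← (hsF t x).of_norm.tsum_sub (hsF t' x).of_norm]
      refine tsum_of_norm_bounded (hsm t t').hasSum fun k => ?_
      rw [← sub_smul, norm_smul, mul_comm]
      exact mul_le_mul_of_nonneg_right (hg1 k x) (norm_nonneg _)

end Series
/-- Almost surely, the noise coincides on `[0, T]` with a regular field. -/
lemma ae_exists_isRegularField_noise {Ω : Type*} [MeasurableSpace Ω] (P : Measure Ω)
    [IsProbabilityMeasure P] {N : ℕ} {T : ℝ} (hT : 0 < T) {β : ℕ → ℝ≥0 → Ω → ℝ}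
    (hβ : ∀ k, IsBrownianReal (β k) P) {g : ℕ → E N → ℝ} (hg : ∀ k, ContDiff ℝ 2 (g k))
    {a : ℕ → ℝ} (ha : ∀ k, 0 < a k) (has : Summable a)
    (hga : ∀ k x, |g k x| + ‖gradient (g k) x‖ + ‖iteratedFDeriv ℝ 2 (g k) x‖ ≤ a k) :
    ∀ᵐ ω ∂P, ∃ J : ℝ → E N → ℝ, ∃ M : ℝ, IsRegularField J M ∧
      ∀ t ∈ Icc 0 T, J t = noise g β ω t := by
  filter_upwards [ae_exists_summable_bound P hT hβ ha has, ae_all_iff.2 fun k => (hβ k).cont]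
    with ω ⟨S, hS, hs⟩ hc
  have hmem : ∀ t, max 0 (min t T) ∈ Icc 0 T := fun t =>
    ⟨le_max_left _ _, max_le hT.le (min_le_right _ _)⟩
  have hid : ∀ t ∈ Icc 0 T, max 0 (min t T) = t := fun t ht => by
    rw [min_eq_left ht.2, max_eq_right ht.1]
  -- The paths are frozen outside [0, T], which gives a field on all times without changing it on
  -- [0, T].
  refine ⟨_, _, isRegularField_series (b := fun k t => β k (max 0 (min t T)).toNNReal ω) (S := S)
    (T := T) hg (fun k x => ?_) (fun k x => ?_) (fun k x => ?_) (fun k => ?_)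
    (fun k t => hS k _ (hmem t)) hs (fun k t => ?_) hT.le, fun t ht => ?_⟩
  · linarith [hga k x, norm_nonneg (gradient (g k) x), norm_nonneg (iteratedFDeriv ℝ 2 (g k) x)]
  · rw [← norm_gradient]
    linarith [hga k x, abs_nonneg (g k x), norm_nonneg (iteratedFDeriv ℝ 2 (g k) x)]
  · linarith [hga k x, norm_nonneg (gradient (g k) x), abs_nonneg (g k x)]
  · exact (hc k).comp (continuous_real_toNNReal.comp (by fun_prop))
  · rw [hid _ (hmem t)]
  · ext x
    simp only [noise, hid t ht]

/-! ### Continuity of translations in L^1. -/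

/-- Translations preserve the measure and depend continuously on the shift in the compact-open
topology, so composition with them is continuous in L^1. -/
lemma tendsto_integral_abs_sub_translate {G : Type*} [NormedAddCommGroup G] [MeasurableSpace G]
    [BorelSpace G] [LocallyCompactSpace G] (μ : Measure G) [μ.IsAddHaarMeasure]
    [μ.InnerRegularCompactLTTop] {h : G → ℝ} (hh : Integrable h μ) :
    Tendsto (fun q => ∫ p, |h p - h (p - q)| ∂μ) (𝓝 0) (𝓝 0) := by
  have : Fact ((1 : ℝ≥0∞) ≤ 1) := ⟨le_rfl⟩
  let c : G → C(G, G) := fun q => ⟨fun p => p - q, by fun_prop⟩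
  have hc : Continuous c := ContinuousMap.continuous_of_continuous_uncurry _
    (show Continuous fun p : G × G => p.2 - p.1 by fun_prop)
  have hm : ∀ q, MeasurePreserving (c q) μ μ := fun q => measurePreserving_sub_right μ q
  have hl : MemLp h 1 μ := memLp_one_iff_integrable.2 hh
  have h1 := Filter.Tendsto.compMeasurePreservingLp (μ := μ) (ν := μ) (p := 1)
    (f := fun _ : G => hl.toLp h) (f₀ := hl.toLp h)
    tendsto_const_nhds (hc.tendsto 0) hm (hm 0) (by norm_num)
  have h0 : Lp.compMeasurePreserving (c 0) (hm 0) (hl.toLp h) = hl.toLp h := by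
    rw [Lp.toLp_compMeasurePreserving]
    congr 1
    ext p
    simp [c]
  rw [h0] at h1
  have h2 := (tendsto_const_nhds (x := hl.toLp h)).sub h1 |>.norm
  rw [sub_self, norm_zero] at h2
  refine h2.congr fun q => ?_
  rw [Lp.toLp_compMeasurePreserving, ← MemLp.toLp_sub, Lp.norm_toLp, eLpNorm_one_eq_lintegral_enorm,
    ← integral_norm_eq_lintegral_enorm]
  · rfl
  · exact hh.aestronglyMeasurable.sub (hh.aestronglyMeasurable.comp_measurePreserving (hm q))

instance isAddHaarMeasure_spaceTime (N : ℕ) : (volume : Measure (ℝ × E N)).IsAddHaarMeasure :=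
  inferInstanceAs ((volume : Measure ℝ).prod (volume : Measure (E N))).IsAddHaarMeasure

/-- Shifts of norm at most 1 keep points of K in the compact 1-neighbourhood `K1`, so z may be
replaced by its restriction to `K1`, which is integrable. -/
lemma exists_setIntegral_abs_sub_translate_le {N : ℕ} {z : ℝ × E N → ℝ} (hz : LocallyIntegrable z)
    {K : Set (ℝ × E N)} (hK : IsCompact K) {η : ℝ} (hη : 0 < η) :
    ∃ ρ > 0, ∀ Q, ‖Q‖ ≤ ρ → ∫ P in K, |z P - z (P - Q)| ≤ η := by
  set K1 := Metric.cthickening 1 K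
  have hK1 : IsCompact K1 := hK.cthickening
  have hint : Integrable (K1.indicator z) :=
    (hz.integrableOn_isCompact hK1).integrable_indicator hK1.measurableSet
  obtain ⟨ρ, hρ, h⟩ := Metric.eventually_nhds_iff.1
    ((tendsto_integral_abs_sub_translate volume hint).eventually (gt_mem_nhds hη))
  refine ⟨min (ρ / 2) 1, by positivity, fun Q hQ => ?_⟩
  have h1 := h (y := Q) (by
    rw [dist_zero_right]
    exact (hQ.trans (min_le_left _ _)).trans_lt (half_lt_self hρ))
  refine le_trans ?_ h1.le
  have hQ1 : ‖Q‖ ≤ 1 := hQ.trans (min_le_right _ _)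
  have hi2 : Integrable fun P => |K1.indicator z P - K1.indicator z (P - Q)| :=
    (hint.sub (hint.comp_sub_right Q)).abs
  rw [← integral_indicator hK.measurableSet]
  refine integral_mono_of_nonneg (ae_of_all _ fun P => indicator_nonneg (fun _ _ => abs_nonneg _) P)
    hi2 (ae_of_all _ fun P => ?_)
  by_cases hP : P ∈ K
  swap
  · rw [indicator_of_notMem hP]
    exact abs_nonneg _
  have hP1 : P ∈ K1 := Metric.self_subset_cthickening K hP
  rw [indicator_of_mem hP]
  beta_reduce
  rw [indicator_of_mem hP1, indicator_of_mem]
  exact Metric.mem_cthickening_of_dist_le _ P 1 K hP (by simpa [dist_eq_norm] using hQ1)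

/-! ### Derivatives and mollifiers on space-time. -/

/-- The time derivative of a function on space-time. -/
def timeDeriv {N : ℕ} (φ : ℝ × E N → ℝ) (P : ℝ × E N) : ℝ := deriv (fun s => φ (s, P.2)) P.1

/-- The space gradient of a function on space-time. -/
def spaceGrad {N : ℕ} (φ : ℝ × E N → ℝ) (P : ℝ × E N) : E N := gradient (fun y => φ (P.1, y)) P.2

section Derivatives

variable {N : ℕ} {φ : ℝ × E N → ℝ}

lemma hasDerivAt_time {P : ℝ × E N} (h : DifferentiableAt ℝ φ P) :
    HasDerivAt (fun s => φ (s, P.2)) (fderiv ℝ φ P (1, 0)) P.1 :=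
  HasFDerivAt.comp_hasDerivAt P.1 (f := fun s => (s, P.2)) h.hasFDerivAt
    ((hasDerivAt_id P.1).prodMk (hasDerivAt_const P.1 P.2))

lemma timeDeriv_eq {P : ℝ × E N} (h : DifferentiableAt ℝ φ P) :
    timeDeriv φ P = fderiv ℝ φ P (1, 0) := (hasDerivAt_time h).deriv

lemma hasFDerivAt_space {P : ℝ × E N} (h : DifferentiableAt ℝ φ P) :
    HasFDerivAt (fun y => φ (P.1, y))
      ((fderiv ℝ φ P).comp (ContinuousLinearMap.inr ℝ ℝ (E N))) P.2 :=
  HasFDerivAt.comp P.2 (f := fun y => (P.1, y)) h.hasFDerivAt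
    ((hasFDerivAt_const P.1 P.2).prodMk (hasFDerivAt_id P.2))

lemma spaceGrad_eq {P : ℝ × E N} (h : DifferentiableAt ℝ φ P) :
    spaceGrad φ P = (InnerProductSpace.toDual ℝ (E N)).symm
      ((fderiv ℝ φ P).comp (ContinuousLinearMap.inr ℝ ℝ (E N))) := by
  rw [spaceGrad, gradient, (hasFDerivAt_space h).fderiv]

lemma inner_spaceGrad {P : ℝ × E N} (h : DifferentiableAt ℝ φ P) (v : E N) :
    inner ℝ v (spaceGrad φ P) = fderiv ℝ φ P (0, v) := by
  rw [spaceGrad_eq h, real_inner_comm, InnerProductSpace.toDual_symm_apply]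
  simp

lemma continuous_timeDeriv (h : ContDiff ℝ (⊤ : ℕ∞) φ) : Continuous (timeDeriv φ) := by
  have : timeDeriv φ = fun P => fderiv ℝ φ P (1, 0) :=
    funext fun P => timeDeriv_eq (h.differentiable (by simp) P)
  rw [this]
  exact (h.continuous_fderiv (by simp)).clm_apply continuous_const

lemma continuous_spaceGrad (h : ContDiff ℝ (⊤ : ℕ∞) φ) : Continuous (spaceGrad φ) := by
  have : spaceGrad φ = fun P => (InnerProductSpace.toDual ℝ (E N)).symm
      ((fderiv ℝ φ P).comp (ContinuousLinearMap.inr ℝ ℝ (E N))) :=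
    funext fun P => spaceGrad_eq (h.differentiable (by simp) P)
  rw [this]
  exact (LinearIsometryEquiv.continuous _).comp
    ((h.continuous_fderiv (by simp)).clm_comp continuous_const)

lemma timeDeriv_eq_zero (h : ContDiff ℝ (⊤ : ℕ∞) φ) {P : ℝ × E N} (hP : P ∉ tsupport φ) :
    timeDeriv φ P = 0 := by
  rw [timeDeriv_eq (h.differentiable (by simp) P), fderiv_of_notMem_tsupport ℝ hP]
  simp

lemma spaceGrad_eq_zero (h : ContDiff ℝ (⊤ : ℕ∞) φ) {P : ℝ × E N} (hP : P ∉ tsupport φ) :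
    spaceGrad φ P = 0 := by
  rw [spaceGrad_eq (h.differentiable (by simp) P), fderiv_of_notMem_tsupport ℝ hP]
  simp

end Derivatives

/-- A mollifier on space-time of width `ε` in time and `δ` in space. -/
structure IsKernel {N : ℕ} (k : ℝ × E N → ℝ) (ε δ C : ℝ) : Prop where
  smooth : ContDiff ℝ (⊤ : ℕ∞) k
  nonneg : ∀ Q, 0 ≤ k Q
  support : tsupport k ⊆ Metric.closedBall 0 ε ×ˢ Metric.closedBall 0 δ
  integral_eq_one : ∫ Q, k Q = 1
  integral_grad_le : ∫ Q, ‖spaceGrad k Q‖ ≤ C / δ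

/-- A product of rescaled bumps. The space gradient scales like 1/δ whatever the width in time, so
C, the L^1 norm of the gradient of the unscaled bump, depends neither on ε nor on δ; this allows ε
to be chosen after δ. -/
lemma exists_isKernel (N : ℕ) : ∃ C : ℝ, 0 ≤ C ∧ ∀ ε δ : ℝ, 0 < ε → 0 < δ →
    ∃ k : ℝ × E N → ℝ, IsKernel k ε δ C := by
  let b : ContDiffBump (0 : E N) := ⟨1 / 2, 1, by norm_num, by norm_num⟩
  set r : E N → ℝ := b.normed volume with hr
  have hrs : ContDiff ℝ (⊤ : ℕ∞) r := b.contDiff_normed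
  refine ⟨∫ q, ‖gradient r q‖, integral_nonneg fun _ => norm_nonneg _, fun ε δ hε hδ => ?_⟩
  let c : ContDiffBump (0 : ℝ) := ⟨ε / 2, ε, by positivity, by linarith⟩
  set s : ℝ → ℝ := c.normed volume with hs
  have hss : ContDiff ℝ (⊤ : ℕ∞) s := c.contDiff_normed
  set k : ℝ × E N → ℝ := fun Q => s Q.1 * ((δ⁻¹) ^ N * r (δ⁻¹ • Q.2)) with hk
  have hks : ContDiff ℝ (⊤ : ℕ∞) k := by fun_prop
  have hgrad : ∀ Q, spaceGrad k Q = (s Q.1 * (δ⁻¹) ^ N * δ⁻¹) • gradient r (δ⁻¹ • Q.2) := by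
    intro Q
    refine HasGradientAt.gradient ?_
    have h1 : HasGradientAt r (gradient r (δ⁻¹ • Q.2)) (δ⁻¹ • Q.2) :=
      (hrs.differentiable (by simp) _).hasGradientAt
    rw [hasGradientAt_iff_hasFDerivAt] at h1 ⊢
    have h2 : HasFDerivAt (fun y : E N => δ⁻¹ • y) (δ⁻¹ • ContinuousLinearMap.id ℝ (E N)) Q.2 :=
      (δ⁻¹ • ContinuousLinearMap.id ℝ (E N)).hasFDerivAt
    have h3 := ((h1.comp Q.2 h2).const_mul ((δ⁻¹) ^ N)).const_mul (s Q.1)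
    refine h3.congr_fderiv ?_
    ext v
    simp
    ring
  have hint : ∀ h : E N → ℝ, ∫ q, (δ⁻¹) ^ N * h (δ⁻¹ • q) = ∫ q, h q := fun h => by
    rw [integral_const_mul, Measure.integral_comp_smul, finrank_euclideanSpace_fin, smul_eq_mul,
      ← mul_assoc, abs_of_nonneg (by positivity), mul_inv_cancel₀ (by positivity), one_mul]
  refine ⟨k, hks, fun Q => ?_, ?_, ?_, ?_⟩
  · exact mul_nonneg (c.nonneg_normed _) (mul_nonneg (by positivity) (b.nonneg_normed _))
  · refine closure_minimal (fun Q hQ => ?_)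
      (Metric.isClosed_closedBall.prod Metric.isClosed_closedBall)
    have h1 : s Q.1 ≠ 0 := left_ne_zero_of_mul hQ
    have h2 : r (δ⁻¹ • Q.2) ≠ 0 := right_ne_zero_of_mul (right_ne_zero_of_mul hQ)
    have h1' : Q.1 ∈ Function.support s := h1
    have h2' : δ⁻¹ • Q.2 ∈ Function.support r := h2
    rw [hs, ContDiffBump.support_normed_eq] at h1'
    rw [hr, ContDiffBump.support_normed_eq, mem_ball_zero_iff, norm_smul, norm_inv,
      Real.norm_of_nonneg hδ.le, inv_mul_lt_iff₀ hδ] at h2'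
    refine ⟨Metric.ball_subset_closedBall h1', ?_⟩
    rw [mem_closedBall_zero_iff]
    simpa [b] using h2'.le
  · rw [hk, Measure.volume_eq_prod, integral_prod_mul s (fun q => (δ⁻¹) ^ N * r (δ⁻¹ • q)), hint,
      c.integral_normed, b.integral_normed, one_mul]
  · have e : ∀ Q, ‖spaceGrad k Q‖
        = s Q.1 * ((δ⁻¹) ^ N * (δ⁻¹ * ‖gradient r (δ⁻¹ • Q.2)‖)) := fun Q => by
      rw [hgrad, norm_smul, Real.norm_of_nonneg]
      · ring
      · exact mul_nonneg (mul_nonneg (c.nonneg_normed _) (by positivity)) (by positivity)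
    simp_rw [e]
    rw [Measure.volume_eq_prod,
      integral_prod_mul s (fun q => (δ⁻¹) ^ N * (δ⁻¹ * ‖gradient r (δ⁻¹ • q)‖)),
      hint (fun q => δ⁻¹ * ‖gradient r q‖), c.integral_normed, integral_const_mul, one_mul,
      div_eq_inv_mul]

/-! ### Fluxes composed with regular fields. -/

/-- A `C^1` flux with bounded and Lipschitz derivative. -/
structure IsFlux {N : ℕ} (f : ℝ → E N) (L : ℝ) : Prop where
  differentiable : Differentiable ℝ f
  norm_deriv_le : ∀ ξ, ‖deriv f ξ‖ ≤ L
  norm_deriv_sub_le : ∀ ξ ζ, ‖deriv f ξ - deriv f ζ‖ ≤ L * |ξ - ζ|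

lemma IsFlux.nonneg {N : ℕ} {f : ℝ → E N} {L : ℝ} (hf : IsFlux f L) : 0 ≤ L :=
  (norm_nonneg _).trans (hf.norm_deriv_le 0)

lemma IsFlux.norm_sub_le {N : ℕ} {f : ℝ → E N} {L : ℝ} (hf : IsFlux f L) (ξ ζ : ℝ) :
    ‖f ξ - f ζ‖ ≤ L * |ξ - ζ| :=
  convex_univ.norm_image_sub_le_of_norm_deriv_le (𝕜 := ℝ) (fun z _ => hf.differentiable z)
    (fun z _ => hf.norm_deriv_le z) (mem_univ ζ) (mem_univ ξ)

lemma IsFlux.continuous_deriv {N : ℕ} {f : ℝ → E N} {L : ℝ} (hf : IsFlux f L) :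
    Continuous (deriv f) :=
  (LipschitzWith.of_dist_le_mul (K := ⟨L, hf.nonneg⟩) fun ξ ζ => by
    rw [dist_eq_norm, Real.dist_eq]; exact hf.norm_deriv_sub_le ξ ζ).continuous

lemma IsRegularField.nonneg {N : ℕ} {J : ℝ → E N → ℝ} {M : ℝ} (hJ : IsRegularField J M) : 0 ≤ M :=
  (norm_nonneg _).trans (hJ.norm_gradient_le 0 0)

lemma IsRegularField.abs_sub_le {N : ℕ} {J : ℝ → E N → ℝ} {M : ℝ} (hJ : IsRegularField J M)
    (t : ℝ) (x y : E N) : |J t x - J t y| ≤ M * ‖x - y‖ :=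
  convex_univ.norm_image_sub_le_of_norm_fderiv_le (𝕜 := ℝ) (fun z _ => hJ.differentiable t z)
    (fun z _ => (norm_gradient (J t) z) ▸ hJ.norm_gradient_le t z) (mem_univ y) (mem_univ x)

lemma IsRegularField.continuous {N : ℕ} {J : ℝ → E N → ℝ} {M : ℝ} (hJ : IsRegularField J M) :
    Continuous fun P : ℝ × E N => J P.1 P.2 := by
  refine Metric.continuous_iff.2 fun P η hη => ?_
  obtain ⟨ε, hε, h⟩ := hJ.equicontinuous (η / 2) (by positivity)
  have hM := hJ.nonneg
  refine ⟨min ε (η / (2 * (M + 1))), by positivity, fun Q hQ => ?_⟩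
  rw [Prod.dist_eq, max_lt_iff, lt_min_iff, lt_min_iff, Real.dist_eq, dist_eq_norm] at hQ
  have h1 := (h Q.1 P.1 hQ.1.1.le Q.2).1
  have h2 := hJ.abs_sub_le P.1 Q.2 P.2
  have h3 : (M + 1) * ‖Q.2 - P.2‖ < η / 2 := by
    have := hQ.2.2
    rw [lt_div_iff₀ (by positivity)] at this
    linarith
  have h4 := _root_.abs_sub_le (J Q.1 Q.2) (J P.1 Q.2) (J P.1 P.2)
  rw [Real.dist_eq]
  nlinarith [norm_nonneg (Q.2 - P.2)]

lemma IsRegularField.continuous_gradient {N : ℕ} {J : ℝ → E N → ℝ} {M : ℝ}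
    (hJ : IsRegularField J M) : Continuous fun P : ℝ × E N => gradient (J P.1) P.2 := by
  refine Metric.continuous_iff.2 fun P η hη => ?_
  obtain ⟨ε, hε, h⟩ := hJ.equicontinuous (η / 2) (by positivity)
  have hM := hJ.nonneg
  refine ⟨min ε (η / (2 * (M + 1))), by positivity, fun Q hQ => ?_⟩
  rw [Prod.dist_eq, max_lt_iff, lt_min_iff, lt_min_iff, Real.dist_eq, dist_eq_norm] at hQ
  have h1 := (h Q.1 P.1 hQ.1.1.le Q.2).2
  have h2 := hJ.norm_gradient_sub_le P.1 Q.2 P.2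
  have h3 : (M + 1) * ‖Q.2 - P.2‖ < η / 2 := by
    have := hQ.2.2
    rw [lt_div_iff₀ (by positivity)] at this
    linarith
  have h4 := norm_sub_le_norm_sub_add_norm_sub (gradient (J Q.1) Q.2) (gradient (J P.1) Q.2)
    (gradient (J P.1) P.2)
  rw [dist_eq_norm]
  nlinarith [norm_nonneg (Q.2 - P.2)]

/-- The first order Taylor estimate for `x ↦ f (ξ + J t x)`. -/
lemma norm_taylor_le {N : ℕ} {f : ℝ → E N} {L : ℝ} (hf : IsFlux f L) {J : ℝ → E N → ℝ} {M : ℝ}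
    (hJ : IsRegularField J M) (ξ t : ℝ) (x q : E N) :
    ‖f (ξ + J t x) - f (ξ + J t (x - q)) - inner ℝ (gradient (J t) x) q • deriv f (ξ + J t x)‖
      ≤ (L * M ^ 2 + L * M) * ‖q‖ ^ 2 := by
  have hL := hf.nonneg
  have hM := hJ.nonneg
  set D : E N → (E N →L[ℝ] E N) := fun y => (fderiv ℝ (J t) y).smulRight (deriv f (ξ + J t y)) with hD
  have hDa : ∀ y v, D y v = inner ℝ (gradient (J t) y) v • deriv f (ξ + J t y) := fun y v => by
    simp [hD, gradient, InnerProductSpace.toDual_symm_apply]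
  have hder : ∀ y, HasFDerivAt (fun y => f (ξ + J t y)) (D y) y := fun y => by
    have h1 : HasFDerivAt (fun y => ξ + J t y) (fderiv ℝ (J t) y) y :=
      (hJ.differentiable t y).hasFDerivAt.const_add ξ
    have h2 := (hf.differentiable (ξ + J t y)).hasDerivAt.hasFDerivAt.comp y h1
    refine h2.congr_fderiv ?_
    ext v
    simp [hD]
  -- Two sources of variation: ∇J is M-Lipschitz against |f'| ≤ L, which gives LM, and f'(ξ + J) is
  -- LM-Lipschitz against |∇J| ≤ M, which gives LM².
  have hbd : ∀ y ∈ Metric.closedBall x ‖q‖, ‖D y - D x‖ ≤ (L * M ^ 2 + L * M) * ‖q‖ := by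
    intro y hy
    rw [mem_closedBall_iff_norm] at hy
    refine ContinuousLinearMap.opNorm_le_bound _ (by positivity) fun v => ?_
    rw [sub_apply, hDa, hDa]
    have e : inner ℝ (gradient (J t) y) v • deriv f (ξ + J t y)
        - inner ℝ (gradient (J t) x) v • deriv f (ξ + J t x)
        = inner ℝ (gradient (J t) y - gradient (J t) x) v • deriv f (ξ + J t y)
          + inner ℝ (gradient (J t) x) v • (deriv f (ξ + J t y) - deriv f (ξ + J t x)) := by
      rw [inner_sub_left, sub_smul, smul_sub]
      abel
    rw [e]
    refine (norm_add_le _ _).trans ?_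
    rw [norm_smul, norm_smul]
    have a1 : ‖inner ℝ (gradient (J t) y - gradient (J t) x) v‖ ≤ M * ‖q‖ * ‖v‖ :=
      (norm_inner_le_norm _ _).trans (by
        gcongr
        exact (hJ.norm_gradient_sub_le t y x).trans (by gcongr))
    have a2 : ‖inner ℝ (gradient (J t) x) v‖ ≤ M * ‖v‖ :=
      (norm_inner_le_norm _ _).trans (by gcongr; exact hJ.norm_gradient_le t x)
    have a3 : ‖deriv f (ξ + J t y) - deriv f (ξ + J t x)‖ ≤ L * (M * ‖q‖) :=
      (hf.norm_deriv_sub_le _ _).trans (by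
        rw [add_sub_add_left_eq_sub]
        gcongr
        exact (hJ.abs_sub_le t y x).trans (by gcongr))
    calc _ ≤ M * ‖q‖ * ‖v‖ * L + M * ‖v‖ * (L * (M * ‖q‖)) := by
          gcongr
          exact hf.norm_deriv_le _
      _ = _ := by ring
  have h := (convex_closedBall x ‖q‖).norm_image_sub_le_of_norm_hasFDerivWithin_le'
    (fun y _ => (hder y).hasFDerivWithinAt) hbd (Metric.mem_closedBall_self (norm_nonneg _))
    (show x - q ∈ Metric.closedBall x ‖q‖ by simp)
  rw [sub_sub_cancel_left, map_neg, hDa, norm_neg] at h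
  calc _ = ‖f (ξ + J t (x - q)) - f (ξ + J t x)
        - -(inner ℝ (gradient (J t) x) q • deriv f (ξ + J t x))‖ := by
        rw [← norm_neg]
        congr 1
        abel
    _ ≤ _ := h
    _ = _ := by ring

/-- The Kruzhkov flux is Lipschitz in the level. -/
lemma norm_sign_smul_sub_le {F : Type*} [NormedAddCommGroup F] [NormedSpace ℝ F] {h : ℝ → F} {L : ℝ}
    (hh : ∀ ξ ζ, ‖h ξ - h ζ‖ ≤ L * |ξ - ζ|) (w z z' : ℝ) :
    ‖Real.sign (w - z') • (h w - h z') - Real.sign (w - z) • (h w - h z)‖ ≤ L * |z - z'| := by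
  have h1 := hh w z
  have h2 := hh w z'
  have h3 := hh z z'
  have h4 := hh z' z
  rw [abs_sub_comm] at h4
  have e1 : h w - h z' - (h w - h z) = h z - h z' := by abel
  have e2 : ∀ a b : F, ‖-a - b‖ ≤ ‖b‖ + ‖a‖ := fun a b => by
    rw [← norm_neg, neg_sub, sub_neg_eq_add]; exact norm_add_le _ _
  have e3 : -(h w - h z') - -(h w - h z) = h z' - h z := by abel
  -- If w lies on the same side of z and z', the w terms cancel. If w separates them, |w - z| + |w -
  -- z'| = |z - z'|.
  rcases lt_trichotomy (w - z) 0 with a | a | a <;> rcases lt_trichotomy (w - z') 0 with b | b | b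
  · rw [Real.sign_of_neg a, Real.sign_of_neg b, neg_one_smul, neg_one_smul, e3]
    exact h4
  · obtain rfl := sub_eq_zero.1 b
    rw [sub_self (h w), smul_zero, zero_sub, norm_neg, Real.sign_of_neg a, neg_one_smul, norm_neg,
      abs_sub_comm]
    exact h1
  · rw [Real.sign_of_neg a, Real.sign_of_pos b, neg_one_smul, one_smul, sub_neg_eq_add]
    refine (norm_add_le _ _).trans ((add_le_add h2 h1).trans (le_of_eq ?_))
    rw [abs_of_neg a, abs_of_pos b, abs_of_pos (by linarith)]
    ring
  · obtain rfl := sub_eq_zero.1 a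
    simpa [Real.sign_of_neg b] using h4
  · obtain rfl := sub_eq_zero.1 a
    obtain rfl := sub_eq_zero.1 b
    simp
  · obtain rfl := sub_eq_zero.1 a
    simpa [Real.sign_of_pos b] using h2
  · rw [Real.sign_of_pos a, Real.sign_of_neg b, neg_one_smul, one_smul]
    refine (e2 _ _).trans ((add_le_add h1 h2).trans (le_of_eq ?_))
    rw [abs_of_neg b, abs_of_pos a, abs_of_neg (by linarith)]
    ring
  · obtain rfl := sub_eq_zero.1 b
    rw [sub_self (h w), smul_zero, zero_sub, norm_neg, Real.sign_of_pos a, one_smul, abs_sub_comm]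
    exact h1
  · rw [Real.sign_of_pos a, Real.sign_of_pos b, one_smul, one_smul, e1]
    exact h3

/-! ### Entropy densities and the pointwise doubling estimate. -/

/-- The indicator function of the positive times. -/
def chi (t : ℝ) : ℝ := if 0 < t then 1 else 0

lemma chi_eq (t : ℝ) : chi t = 0 ∨ chi t = 1 := by
  unfold chi
  split_ifs <;> simp

lemma abs_chi_le (t : ℝ) : |chi t| ≤ 1 := by rcases chi_eq t with h | h <;> simp [h]

lemma abs_sign_le (r : ℝ) : |Real.sign r| ≤ 1 := by
  rcases Real.sign_apply_eq r with h | h | h <;> simp [h]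

/-- The integrand of the entropy inequality at the point `P` of space-time, for the value `w` and
the level `α`, where `a`, `G` and `Φ` are the time derivative, the gradient and the value of the test
function; the flux is cut off at negative times. -/
def entropyDensity {N : ℕ} (f : ℝ → E N) (J : ℝ → E N → ℝ) (P : ℝ × E N) (w α a : ℝ) (G : E N)
    (Φ : ℝ) : ℝ :=
  |w - α| * a + chi P.1 * (Real.sign (w - α) *
    (inner ℝ (f (w + J P.1 P.2) - f (α + J P.1 P.2)) G
      - inner ℝ (deriv f (α + J P.1 P.2)) (gradient (J P.1) P.2) * Φ))

/-- The integrand of the Kato inequality for the values `w`, `z` at the point `P`. -/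
def katoDensity {N : ℕ} (f : ℝ → E N) (J : ℝ → E N → ℝ) (P : ℝ × E N) (w z a : ℝ) (G : E N) : ℝ :=
  |w - z| * a + chi P.1 * inner ℝ
    (Real.sign (w - z) • (f (w + J P.1 P.2) - f (z + J P.1 P.2))) G

/-- The vector `sgn (w - z) (f' (w + J) - f' (z + J))`. -/
def signedDeriv {N : ℕ} (f : ℝ → E N) (J : ℝ → E N → ℝ) (P : ℝ × E N) (w z : ℝ) : E N :=
  Real.sign (w - z) • (deriv f (w + J P.1 P.2) - deriv f (z + J P.1 P.2))

section Pointwise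

variable {N : ℕ} {f : ℝ → E N} {L : ℝ} {J : ℝ → E N → ℝ} {M : ℝ}

/-- Expanding J to first order in the space shift q isolates the term (∇J · q) sgn(w - z') (f'(w +
J) - f'(z' + J)). What remains is quadratic in q, or comes from the change of J in time, or from the
jump of the flux at t = 0. -/
lemma norm_flux_error_le (hf : IsFlux f L) (hJ : IsRegularField J M) (w z' : ℝ) (P Q : ℝ × E N)
    {η : ℝ} (hη : |J P.1 (P.2 - Q.2) - J (P.1 - Q.1) (P.2 - Q.2)| ≤ η) :
    ‖Real.sign (w - z') • (chi P.1 • (f (w + J P.1 P.2) - f (z' + J P.1 P.2))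
        - chi (P.1 - Q.1) • (f (w + J (P.1 - Q.1) (P.2 - Q.2)) - f (z' + J (P.1 - Q.1) (P.2 - Q.2))))
      - (chi P.1 * inner ℝ (gradient (J P.1) P.2) Q.2) • signedDeriv f J P w z'‖
    ≤ 2 * (L * M ^ 2 + L * M) * ‖Q.2‖ ^ 2 + 2 * L * η
      + |chi P.1 - chi (P.1 - Q.1)| * (L * |w - z'|) := by
  have hL := hf.nonneg
  set b := inner ℝ (gradient (J P.1) P.2) Q.2
  have t1 := norm_taylor_le hf hJ w P.1 P.2 Q.2
  have t2 := norm_taylor_le hf hJ z' P.1 P.2 Q.2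
  set J0 := J P.1 P.2
  set Jm := J P.1 (P.2 - Q.2)
  set J1 := J (P.1 - Q.1) (P.2 - Q.2)
  have s1 : ‖f (w + Jm) - f (w + J1)‖ ≤ L * η :=
    (hf.norm_sub_le _ _).trans (by rw [add_sub_add_left_eq_sub]; gcongr)
  have s2 : ‖f (z' + Jm) - f (z' + J1)‖ ≤ L * η :=
    (hf.norm_sub_le _ _).trans (by rw [add_sub_add_left_eq_sub]; gcongr)
  have s3 : ‖f (w + J1) - f (z' + J1)‖ ≤ L * |w - z'| :=
    (hf.norm_sub_le _ _).trans (by rw [add_sub_add_right_eq_sub])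
  have e : Real.sign (w - z') • (chi P.1 • (f (w + J0) - f (z' + J0))
        - chi (P.1 - Q.1) • (f (w + J1) - f (z' + J1)))
      - (chi P.1 * b) • signedDeriv f J P w z'
      = Real.sign (w - z') • (chi P.1 • ((f (w + J0) - f (w + Jm) - b • deriv f (w + J0))
          - (f (z' + J0) - f (z' + Jm) - b • deriv f (z' + J0))
          + (f (w + Jm) - f (w + J1)) - (f (z' + Jm) - f (z' + J1)))
        + (chi P.1 - chi (P.1 - Q.1)) • (f (w + J1) - f (z' + J1))) := by
    unfold signedDeriv
    module
  rw [e, norm_smul]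
  have hs : ‖Real.sign (w - z')‖ ≤ 1 := abs_sign_le _
  have hc : ‖chi P.1‖ ≤ 1 := abs_chi_le _
  refine (mul_le_of_le_one_left (norm_nonneg _) hs).trans ((norm_add_le _ _).trans ?_)
  rw [norm_smul, norm_smul, Real.norm_eq_abs (chi P.1 - _)]
  refine add_le_add ((mul_le_of_le_one_left (norm_nonneg _) hc).trans ?_) (by gcongr)
  refine (norm_sub_le _ _).trans ((add_le_add (norm_add_le _ _) le_rfl).trans ?_)
  have := norm_sub_le (f (w + J0) - f (w + Jm) - b • deriv f (w + J0))
    (f (z' + J0) - f (z' + Jm) - b • deriv f (z' + J0))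
  linarith

/-- Each inequality carries the source at its own point with the other solution as level. Moving the
source from P - Q to P turns their difference into the signed difference of f' paired with ∇J, which
later balances the first-order flux term. -/
lemma abs_source_error_le (hf : IsFlux f L) (hJ : IsRegularField J M) (w z' : ℝ) (P Q : ℝ × E N)
    {η : ℝ} (hη : |J P.1 (P.2 - Q.2) - J (P.1 - Q.1) (P.2 - Q.2)| ≤ η)
    (hη' : ‖gradient (J P.1) (P.2 - Q.2) - gradient (J (P.1 - Q.1)) (P.2 - Q.2)‖ ≤ η) :
    |Real.sign (w - z') * (chi (P.1 - Q.1) * inner ℝ (deriv f (w + J (P.1 - Q.1) (P.2 - Q.2)))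
        (gradient (J (P.1 - Q.1)) (P.2 - Q.2))
        - chi P.1 * inner ℝ (deriv f (z' + J P.1 P.2)) (gradient (J P.1) P.2))
      - chi P.1 * inner ℝ (signedDeriv f J P w z') (gradient (J P.1) P.2)|
    ≤ L * (M + 1) * (η + M * ‖Q.2‖) + |chi P.1 - chi (P.1 - Q.1)| * (L * M) := by
  have hL := hf.nonneg
  have hM := hJ.nonneg
  have j1 := hJ.abs_sub_le P.1 P.2 (P.2 - Q.2)
  have b1 := hJ.norm_gradient_sub_le P.1 P.2 (P.2 - Q.2)
  rw [sub_sub_cancel] at j1 b1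
  set b0 := gradient (J P.1) P.2 with hb0
  set bm := gradient (J P.1) (P.2 - Q.2)
  set b2 := gradient (J (P.1 - Q.1)) (P.2 - Q.2) with hb2
  set J0 := J P.1 P.2
  set Jm := J P.1 (P.2 - Q.2)
  set J1 := J (P.1 - Q.1) (P.2 - Q.2)
  have j2 : |J1 - J0| ≤ η + M * ‖Q.2‖ := by
    rw [abs_sub_comm]
    have := abs_sub_le J0 Jm J1
    linarith
  have b3 : ‖b2 - b0‖ ≤ η + M * ‖Q.2‖ := by
    rw [norm_sub_rev]
    have := norm_sub_le_norm_sub_add_norm_sub b0 bm b2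
    linarith
  have e : Real.sign (w - z') * (chi (P.1 - Q.1) * inner ℝ (deriv f (w + J1)) b2
        - chi P.1 * inner ℝ (deriv f (z' + J0)) b0)
      - chi P.1 * inner ℝ (signedDeriv f J P w z') b0
      = Real.sign (w - z') * (chi P.1 * (inner ℝ (deriv f (w + J1) - deriv f (w + J0)) b0
          + inner ℝ (deriv f (w + J1)) (b2 - b0))
        - (chi P.1 - chi (P.1 - Q.1)) * inner ℝ (deriv f (w + J1)) b2) := by
    unfold signedDeriv
    rw [real_inner_smul_left, inner_sub_left, inner_sub_left, inner_sub_right]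
    ring
  rw [e, abs_mul]
  refine (mul_le_of_le_one_left (abs_nonneg _) (abs_sign_le _)).trans ((abs_sub _ _).trans ?_)
  rw [abs_mul, abs_mul]
  have hη0 : 0 ≤ η := (abs_nonneg _).trans hη
  have hb0M : ‖b0‖ ≤ M := hJ.norm_gradient_le _ _
  have hb2M : ‖b2‖ ≤ M := hJ.norm_gradient_le _ _
  have hdL : ‖deriv f (w + J1)‖ ≤ L := hf.norm_deriv_le _
  have hdd : ‖deriv f (w + J1) - deriv f (w + J0)‖ ≤ L * (η + M * ‖Q.2‖) := by
    refine (hf.norm_deriv_sub_le _ _).trans ?_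
    rw [add_sub_add_left_eq_sub]
    gcongr
  have i1 : |inner ℝ (deriv f (w + J1) - deriv f (w + J0)) b0| ≤ L * (η + M * ‖Q.2‖) * M :=
    (abs_real_inner_le_norm _ _).trans (mul_le_mul hdd hb0M (norm_nonneg _) (by positivity))
  have i2 : |inner ℝ (deriv f (w + J1)) (b2 - b0)| ≤ L * (η + M * ‖Q.2‖) :=
    (abs_real_inner_le_norm _ _).trans (mul_le_mul hdL b3 (norm_nonneg _) hL)
  have i3 : |inner ℝ (deriv f (w + J1)) b2| ≤ L * M :=
    (abs_real_inner_le_norm _ _).trans (mul_le_mul hdL hb2M (norm_nonneg _) hL)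
  refine add_le_add ((mul_le_of_le_one_left (abs_nonneg _) (abs_chi_le _)).trans ?_) (by gcongr)
  refine (abs_add_le _ _).trans ((add_le_add i1 i2).trans (le_of_eq (by ring)))

/-- The pointwise estimate for the doubled integrand: `φ`, `a`, `G` are the value, the time
derivative and the gradient of the test function at `P`, and `k`, `kt`, `κ` those of the mollifier
at `Q`. -/
lemma doubled_density_le (hf : IsFlux f L) (hJ : IsRegularField J M) (w z z' : ℝ) (P Q : ℝ × E N)
    {η : ℝ} (hη : |J P.1 (P.2 - Q.2) - J (P.1 - Q.1) (P.2 - Q.2)| ≤ η)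
    (hη' : ‖gradient (J P.1) (P.2 - Q.2) - gradient (J (P.1 - Q.1)) (P.2 - Q.2)‖ ≤ η)
    {φ k : ℝ} (hφ : 0 ≤ φ) (hk : 0 ≤ k) (a kt : ℝ) (G κ : E N) :
    entropyDensity f J P w z' (a * k + φ * kt) (k • G + φ • κ) (φ * k)
      + entropyDensity f J (P - Q) z' w (-(φ * kt)) (-(φ • κ)) (φ * k)
    ≤ k * katoDensity f J P w z a G
      + φ * chi P.1 * (inner ℝ (gradient (J P.1) P.2) Q.2 * inner ℝ (signedDeriv f J P w z) κ
        + k * inner ℝ (signedDeriv f J P w z) (gradient (J P.1) P.2))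
      + (|z - z'| * (k * (|a| + L * ‖G‖ + φ * (L * M)) + φ * (L * M * ‖Q.2‖ * ‖κ‖))
        + φ * ‖κ‖ * (2 * (L * M ^ 2 + L * M) * ‖Q.2‖ ^ 2 + 2 * L * η
          + |chi P.1 - chi (P.1 - Q.1)| * (L * |w - z'|))
        + φ * k * (L * (M + 1) * (η + M * ‖Q.2‖)
          + |chi P.1 - chi (P.1 - Q.1)| * (L * M))) := by
  have hL := hf.nonneg
  have hM := hJ.nonneg
  have V := norm_flux_error_le hf hJ w z' P Q hη
  have U := abs_source_error_le hf hJ w z' P Q hη hη'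
  have hG : ‖Real.sign (w - z') • (f (w + J P.1 P.2) - f (z' + J P.1 P.2))
      - Real.sign (w - z) • (f (w + J P.1 P.2) - f (z + J P.1 P.2))‖ ≤ L * |z - z'| :=
    norm_sign_smul_sub_le (h := fun ξ => f (ξ + J P.1 P.2)) (fun ξ ζ => by
      simpa using hf.norm_sub_le (ξ + J P.1 P.2) (ζ + J P.1 P.2)) w z z'
  have hK : ‖signedDeriv f J P w z' - signedDeriv f J P w z‖ ≤ L * |z - z'| :=
    norm_sign_smul_sub_le (h := fun ξ => deriv f (ξ + J P.1 P.2)) (fun ξ ζ => by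
      simpa using hf.norm_deriv_sub_le (ξ + J P.1 P.2) (ζ + J P.1 P.2)) w z z'
  set K' := signedDeriv f J P w z'
  set K := signedDeriv f J P w z
  set b0 := gradient (J P.1) P.2 with hb0
  set b2 := gradient (J (P.1 - Q.1)) (P.2 - Q.2) with hb2
  set J0 := J P.1 P.2
  set J1 := J (P.1 - Q.1) (P.2 - Q.2)
  set VV := Real.sign (w - z') • (chi P.1 • (f (w + J0) - f (z' + J0))
        - chi (P.1 - Q.1) • (f (w + J1) - f (z' + J1))) with hVV
  set UU := Real.sign (w - z') * (chi (P.1 - Q.1) * inner ℝ (deriv f (w + J1)) b2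
        - chi P.1 * inner ℝ (deriv f (z' + J0)) b0) with hUU
  -- Because |w - z'| is symmetric, the two time derivatives of the mollifier cancel. Because the
  -- sign is antisymmetric, the fluxes paired with κ combine into the difference `VV` and the
  -- sources into the difference `UU`.
  have e : entropyDensity f J P w z' (a * k + φ * kt) (k • G + φ • κ) (φ * k)
      + entropyDensity f J (P - Q) z' w (-(φ * kt)) (-(φ • κ)) (φ * k)
      = |w - z'| * a * k
        + k * (chi P.1 * inner ℝ (Real.sign (w - z') • (f (w + J0) - f (z' + J0))) G)
        + φ * inner ℝ VV κ + φ * k * UU := by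
    have hs : Real.sign (z' - w) = - Real.sign (w - z') := by rw [← Real.sign_neg, neg_sub]
    simp only [entropyDensity, Prod.fst_sub, Prod.snd_sub, hs, abs_sub_comm z' w, hVV, hUU,
      inner_add_right, inner_smul_right, real_inner_smul_left, inner_sub_left, inner_neg_right]
    ring
  rw [e]
  clear_value VV UU
  -- It remains to replace z' by z, the value at P itself, each time at a cost proportional to |z -
  -- z'|.
  have c1 : |w - z'| * a ≤ |w - z| * a + |z - z'| * |a| := by
    have h1 : |(|w - z'| - |w - z|)| ≤ |z - z'| := by
      refine (abs_abs_sub_abs_le _ _).trans (le_of_eq ?_)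
      congr 1
      ring
    have h2 : (|w - z'| - |w - z|) * a ≤ |z - z'| * |a| := by
      refine (le_abs_self _).trans ?_
      rw [abs_mul]
      gcongr
    linarith
  have c2 : chi P.1 * inner ℝ (Real.sign (w - z') • (f (w + J0) - f (z' + J0))) G
      ≤ chi P.1 * inner ℝ (Real.sign (w - z) • (f (w + J0) - f (z + J0))) G
        + |z - z'| * (L * ‖G‖) := by
    rw [← sub_le_iff_le_add', ← mul_sub, ← inner_sub_left]
    refine (le_abs_self _).trans ?_
    rw [abs_mul]
    refine (mul_le_of_le_one_left (abs_nonneg _) (abs_chi_le _)).trans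
      ((abs_real_inner_le_norm _ _).trans ?_)
    calc _ ≤ L * |z - z'| * ‖G‖ := by gcongr
      _ = _ := by ring
  have c3 : inner ℝ VV κ ≤ chi P.1 * (inner ℝ b0 Q.2 * inner ℝ K κ)
      + |z - z'| * (L * M * ‖Q.2‖ * ‖κ‖)
      + ‖κ‖ * (2 * (L * M ^ 2 + L * M) * ‖Q.2‖ ^ 2 + 2 * L * η
          + |chi P.1 - chi (P.1 - Q.1)| * (L * |w - z'|)) := by
    have e3 : inner ℝ VV κ = chi P.1 * (inner ℝ b0 Q.2 * inner ℝ K κ)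
        + chi P.1 * (inner ℝ b0 Q.2 * inner ℝ (K' - K) κ)
        + inner ℝ (VV - (chi P.1 * inner ℝ b0 Q.2) • K') κ := by
      simp only [inner_sub_left, real_inner_smul_left]
      ring
    rw [e3]
    refine add_le_add (add_le_add le_rfl ?_) ?_
    · refine (le_abs_self _).trans ?_
      rw [abs_mul, abs_mul]
      refine (mul_le_of_le_one_left (by positivity) (abs_chi_le _)).trans ?_
      calc _ ≤ (M * ‖Q.2‖) * (L * |z - z'| * ‖κ‖) := by
            gcongr
            · exact (abs_real_inner_le_norm _ _).trans (by gcongr; exact hJ.norm_gradient_le _ _)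
            · exact (abs_real_inner_le_norm _ _).trans (by gcongr)
        _ = _ := by ring
    · refine (real_inner_le_norm _ _).trans ?_
      rw [mul_comm]
      gcongr
  have c4 : UU ≤ chi P.1 * inner ℝ K b0 + |z - z'| * (L * M)
      + (L * (M + 1) * (η + M * ‖Q.2‖) + |chi P.1 - chi (P.1 - Q.1)| * (L * M)) := by
    have e4 : UU = chi P.1 * inner ℝ K b0 + chi P.1 * inner ℝ (K' - K) b0
        + (UU - chi P.1 * inner ℝ K' b0) := by
      rw [inner_sub_left]
      ring
    rw [e4]
    refine add_le_add (add_le_add le_rfl ?_) ((le_abs_self _).trans U)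
    refine (le_abs_self _).trans ?_
    rw [abs_mul]
    refine (mul_le_of_le_one_left (abs_nonneg _) (abs_chi_le _)).trans
      ((abs_real_inner_le_norm _ _).trans ?_)
    calc _ ≤ L * |z - z'| * M := by
          gcongr
          exact hJ.norm_gradient_le _ _
      _ = _ := by ring
  have d1 := mul_le_mul_of_nonneg_left c1 hk
  have d2 := mul_le_mul_of_nonneg_left c2 hk
  have d3 := mul_le_mul_of_nonneg_left c3 hφ
  have d4 := mul_le_mul_of_nonneg_left c4 (mul_nonneg hφ hk)
  unfold katoDensity
  linarith

end Pointwise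

/-! ### Test functions for the doubled variables. -/

section TestFunctions

variable {N : ℕ} {φ k : ℝ × E N → ℝ}

lemma timeDeriv_mul_comp_sub (hφ : ContDiff ℝ (⊤ : ℕ∞) φ) (hk : ContDiff ℝ (⊤ : ℕ∞) k)
    (P' P : ℝ × E N) : timeDeriv (fun P => φ P * k (P - P')) P
      = timeDeriv φ P * k (P - P') + φ P * timeDeriv k (P - P') := by
  have h1 : DifferentiableAt ℝ φ P := hφ.differentiable (by simp) P
  have hk' := hk.differentiable (by simp)
  have h2 : DifferentiableAt ℝ (fun P => k (P - P')) P := by fun_prop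
  rw [timeDeriv_eq (h1.fun_mul h2), fderiv_fun_mul h1 h2, fderiv_comp_sub, timeDeriv_eq h1,
    timeDeriv_eq (hk' _)]
  simp
  ring

lemma spaceGrad_mul_comp_sub (hφ : ContDiff ℝ (⊤ : ℕ∞) φ) (hk : ContDiff ℝ (⊤ : ℕ∞) k)
    (P' P : ℝ × E N) : spaceGrad (fun P => φ P * k (P - P')) P
      = k (P - P') • spaceGrad φ P + φ P • spaceGrad k (P - P') := by
  have h1 : DifferentiableAt ℝ φ P := hφ.differentiable (by simp) P
  have hk' := hk.differentiable (by simp)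
  have h2 : DifferentiableAt ℝ (fun P => k (P - P')) P := by fun_prop
  refine ext_inner_left ℝ fun v => ?_
  rw [inner_spaceGrad (h1.fun_mul h2), fderiv_fun_mul h1 h2, fderiv_comp_sub, inner_add_right,
    inner_smul_right, inner_smul_right, inner_spaceGrad h1, inner_spaceGrad (hk' _)]
  simp
  ring

lemma fderiv_const_mul_comp_const_sub (hk : ContDiff ℝ (⊤ : ℕ∞) k) (c : ℝ) (P P' : ℝ × E N) :
    fderiv ℝ (fun P' => c * k (P - P')) P' = -(c • fderiv ℝ k (P - P')) := by
  have hk' := hk.differentiable (by simp)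
  have h := (((hk' (P - P')).hasFDerivAt.comp P' ((hasFDerivAt_id P').const_sub P)).const_mul c)
  have h2 := h.fderiv
  simp only [Function.comp_def] at h2
  rw [h2]
  ext v <;> simp

lemma timeDeriv_const_mul_comp_const_sub (hk : ContDiff ℝ (⊤ : ℕ∞) k) (c : ℝ) (P P' : ℝ × E N) :
    timeDeriv (fun P' => c * k (P - P')) P' = -(c * timeDeriv k (P - P')) := by
  have hk' := hk.differentiable (by simp)
  rw [timeDeriv_eq (by fun_prop), fderiv_const_mul_comp_const_sub hk, timeDeriv_eq (hk' _)]
  simp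

lemma spaceGrad_const_mul_comp_const_sub (hk : ContDiff ℝ (⊤ : ℕ∞) k) (c : ℝ) (P P' : ℝ × E N) :
    spaceGrad (fun P' => c * k (P - P')) P' = -(c • spaceGrad k (P - P')) := by
  have hk' := hk.differentiable (by simp)
  refine ext_inner_left ℝ fun v => ?_
  rw [inner_spaceGrad (by fun_prop), fderiv_const_mul_comp_const_sub hk, inner_neg_right,
    inner_smul_right, inner_spaceGrad (hk' _)]
  simp

lemma IsKernel.compact {ε δ C : ℝ} (hk : IsKernel k ε δ C) : HasCompactSupport k :=
  HasCompactSupport.of_support_subset_isCompact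
    ((isCompact_closedBall (0 : ℝ) ε).prod (isCompact_closedBall (0 : E N) δ))
    ((subset_tsupport k).trans hk.support)

lemma IsTestFunction.mul_comp_sub {T : ℝ} (hφ : IsTestFunction T φ) {ε δ C : ℝ}
    (hk : IsKernel k ε δ C) (P' : ℝ × E N) : IsTestFunction T fun P => φ P * k (P - P') where
  smooth := by
    have h1 := hφ.smooth
    have h2 := hk.smooth
    fun_prop
  compact := hφ.compact.mul_right
  support := (closure_mono fun P hP => left_ne_zero_of_mul hP).trans hφ.support
  nonneg P := mul_nonneg (hφ.nonneg P) (hk.nonneg _)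

/-- The cutoff φ is evaluated at P only, so in the variable P' it is a constant factor. The
admissibility of the test function then rests on the mollifier alone, whence the margin ε from the
times ±T. -/
lemma IsKernel.isTestFunction {ε δ C T c : ℝ} (hk : IsKernel k ε δ C) {P : ℝ × E N} (hc : 0 ≤ c)
    (hP : |P.1| + ε < T) : IsTestFunction T fun P' => c * k (P - P') where
  smooth := by
    have h2 := hk.smooth
    fun_prop
  compact := by
    have : HasCompactSupport fun P' => k (P - P') :=
      hk.compact.comp_homeomorph (Homeomorph.subLeft P)
    exact this.mul_left
  support := by
    have hcl : IsClosed {P' : ℝ × E N | |P.1 - P'.1| ≤ ε} := isClosed_le (by fun_prop) (by fun_prop)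
    refine (closure_minimal (fun P' hP' => ?_) hcl).trans fun P' (hP' : |P.1 - P'.1| ≤ ε) => ?_
    · have := (hk.support (subset_tsupport k (right_ne_zero_of_mul hP'))).1
      simpa using this
    · have h1 := abs_le.1 hP'
      have h2 := abs_le.1 (le_refl |P.1|)
      exact ⟨⟨by linarith, by linarith⟩, mem_univ _⟩
  nonneg P' := mul_nonneg hc (hk.nonneg _)

/-- The support of a test function stays away from the times `-T` and `T`. -/
lemma IsTestFunction.exists_margin {T : ℝ} (hφ : IsTestFunction T φ) :
    ∃ μ > 0, ∀ P ∈ tsupport φ, |P.1| + μ < T := by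
  rcases (tsupport φ).eq_empty_or_nonempty with h | h
  · exact ⟨1, one_pos, fun P hP => by simp [h] at hP⟩
  · obtain ⟨P₀, hP₀, hmax⟩ := hφ.compact.isCompact.exists_isMaxOn h
      (f := fun P => |P.1|) (by fun_prop)
    have h0 : |P₀.1| < T := abs_lt.2 (hφ.support hP₀).1
    refine ⟨(T - |P₀.1|) / 2, by linarith, fun P hP => ?_⟩
    have : |P.1| ≤ |P₀.1| := hmax hP
    linarith

end TestFunctions

lemma measurable_sign : Measurable Real.sign := by
  unfold Real.sign
  exact Measurable.ite measurableSet_Iio measurable_const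
    (Measurable.ite measurableSet_Ioi measurable_const measurable_const)

lemma measurable_chi : Measurable chi :=
  Measurable.ite measurableSet_Ioi measurable_const measurable_const

/-! ### Measurability and domination of the densities. -/

section Integrability

variable {N : ℕ} {f : ℝ → E N} {L : ℝ} {J : ℝ → E N → ℝ} {M : ℝ}

lemma measurable_entropyDensity (hf : IsFlux f L) (hJ : IsRegularField J M) {X : Type*}
    [MeasurableSpace X] {p : X → ℝ × E N} {w α a Φ : X → ℝ} {G : X → E N} (hp : Measurable p)
    (hw : Measurable w) (hα : Measurable α) (ha : Measurable a) (hG : Measurable G)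
    (hΦ : Measurable Φ) :
    Measurable fun x => entropyDensity f J (p x) (w x) (α x) (a x) (G x) (Φ x) := by
  have h1 : Measurable fun x => J (p x).1 (p x).2 := hJ.continuous.measurable.comp hp
  have h2 : Measurable fun x => gradient (J (p x).1) (p x).2 :=
    hJ.continuous_gradient.measurable.comp hp
  have h3 := hf.differentiable.continuous.measurable
  have h4 := hf.continuous_deriv.measurable
  have h5 := measurable_sign
  have h6 := measurable_chi
  have h7 : Measurable fun x => inner ℝ (f (w x + J (p x).1 (p x).2) - f (α x + J (p x).1 (p x).2))
      (G x) :=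
    Measurable.inner ((h3.comp (hw.add h1)).sub (h3.comp (hα.add h1))) hG
  have h8 : Measurable fun x => inner ℝ (deriv f (α x + J (p x).1 (p x).2))
      (gradient (J (p x).1) (p x).2) :=
    Measurable.inner (h4.comp (hα.add h1)) h2
  unfold entropyDensity
  fun_prop

lemma measurable_katoDensity (hf : IsFlux f L) (hJ : IsRegularField J M) {X : Type*}
    [MeasurableSpace X] {p : X → ℝ × E N} {w z a : X → ℝ} {G : X → E N} (hp : Measurable p)
    (hw : Measurable w) (hz : Measurable z) (ha : Measurable a) (hG : Measurable G) :
    Measurable fun x => katoDensity f J (p x) (w x) (z x) (a x) (G x) := by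
  have h1 : Measurable fun x => J (p x).1 (p x).2 := hJ.continuous.measurable.comp hp
  have h3 := hf.differentiable.continuous.measurable
  have h5 := measurable_sign
  have h6 := measurable_chi
  have h7 : Measurable fun x => inner ℝ (Real.sign (w x - z x) • (f (w x + J (p x).1 (p x).2)
      - f (z x + J (p x).1 (p x).2))) (G x) :=
    Measurable.inner ((h5.comp (hw.sub hz)).smul ((h3.comp (hw.add h1)).sub (h3.comp (hz.add h1)))) hG
  unfold katoDensity
  fun_prop

lemma measurable_signedDeriv (hf : IsFlux f L) (hJ : IsRegularField J M) {w z : ℝ × E N → ℝ}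
    (hw : Measurable w) (hz : Measurable z) : Measurable fun P => signedDeriv f J P (w P) (z P) := by
  have h1 : Measurable fun P : ℝ × E N => J P.1 P.2 := hJ.continuous.measurable
  have h4 := hf.continuous_deriv.measurable
  have h5 := measurable_sign
  unfold signedDeriv
  fun_prop

lemma norm_signedDeriv_le (hf : IsFlux f L) (P : ℝ × E N) (w z : ℝ) :
    ‖signedDeriv f J P w z‖ ≤ 2 * L := by
  unfold signedDeriv
  rw [norm_smul]
  refine (mul_le_of_le_one_left (norm_nonneg _) (abs_sign_le _)).trans ((norm_sub_le _ _).trans ?_)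
  linarith [hf.norm_deriv_le (w + J P.1 P.2), hf.norm_deriv_le (z + J P.1 P.2)]

lemma abs_entropyDensity_le (hf : IsFlux f L) (hJ : IsRegularField J M) (P : ℝ × E N)
    (w α a : ℝ) (G : E N) (Φ : ℝ) : |entropyDensity f J P w α a G Φ|
      ≤ (1 + L + L * M) * ((1 + |w| + |α|) * (|a| + ‖G‖ + |Φ|)) := by
  have hL := hf.nonneg
  have hM := hJ.nonneg
  have hd : |w - α| ≤ 1 + |w| + |α| := (abs_sub _ _).trans (by linarith)
  have h1 : |inner ℝ (f (w + J P.1 P.2) - f (α + J P.1 P.2)) G| ≤ L * (1 + |w| + |α|) * ‖G‖ := by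
    refine (abs_real_inner_le_norm _ _).trans ?_
    gcongr
    refine (hf.norm_sub_le _ _).trans ?_
    rw [add_sub_add_right_eq_sub]
    gcongr
  have h2 : |inner ℝ (deriv f (α + J P.1 P.2)) (gradient (J P.1) P.2) * Φ| ≤ L * M * |Φ| := by
    rw [abs_mul]
    gcongr
    exact (abs_real_inner_le_norm _ _).trans
      (mul_le_mul (hf.norm_deriv_le _) (hJ.norm_gradient_le _ _) (norm_nonneg _) hL)
  unfold entropyDensity
  refine (abs_add_le _ _).trans ?_
  rw [abs_mul, abs_mul, abs_mul, abs_abs]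
  calc _ ≤ (1 + |w| + |α|) * |a| + 1 * (1 * (L * (1 + |w| + |α|) * ‖G‖ + L * M * |Φ|)) := by
        gcongr
        · exact abs_chi_le _
        · exact abs_sign_le _
        · exact (abs_sub _ _).trans (add_le_add h1 h2)
    _ ≤ _ := by
        have hw := abs_nonneg w
        have hα := abs_nonneg α
        have ha := abs_nonneg a
        have hΦ := abs_nonneg Φ
        have hG := norm_nonneg G
        have i1 : 0 ≤ L * M * (|w| + |α|) * |Φ| := by positivity
        have i2 : 0 ≤ (L + L * M) * (1 + |w| + |α|) * |a| := by positivity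
        have i3 : 0 ≤ (1 + L * M) * (1 + |w| + |α|) * ‖G‖ := by positivity
        have i4 : 0 ≤ (1 + L) * (1 + |w| + |α|) * |Φ| := by positivity
        nlinarith

lemma abs_katoDensity_le (hf : IsFlux f L) (P : ℝ × E N) (w z a : ℝ) (G : E N) :
    |katoDensity f J P w z a G| ≤ (1 + L) * ((1 + |w| + |z|) * (|a| + ‖G‖)) := by
  have hL := hf.nonneg
  have hd : |w - z| ≤ 1 + |w| + |z| := (abs_sub _ _).trans (by linarith)
  unfold katoDensity
  refine (abs_add_le _ _).trans ?_
  rw [abs_mul, abs_mul, abs_abs, real_inner_smul_left, abs_mul]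
  have h1 : |inner ℝ (f (w + J P.1 P.2) - f (z + J P.1 P.2)) G| ≤ L * (1 + |w| + |z|) * ‖G‖ := by
    refine (abs_real_inner_le_norm _ _).trans ?_
    gcongr
    refine (hf.norm_sub_le _ _).trans ?_
    rw [add_sub_add_right_eq_sub]
    gcongr
  calc _ ≤ (1 + |w| + |z|) * |a| + 1 * (1 * (L * (1 + |w| + |z|) * ‖G‖)) := by
        gcongr
        · exact abs_chi_le _
        · exact abs_sign_le _
    _ ≤ _ := by
        have i2 : 0 ≤ L * (1 + |w| + |z|) * |a| := by positivity
        have i3 : 0 ≤ (1 + |w| + |z|) * ‖G‖ := by positivity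
        nlinarith

/-- A measurable function that is dominated by an integrable function on `S` and vanishes outside
of `S` is integrable. -/
lemma integrable_of_abs_le_on {X : Type*} [MeasurableSpace X] {μ : Measure X} {S : Set X}
    (hS : MeasurableSet S) {F h : X → ℝ} (hF : AEStronglyMeasurable F μ) (hh : IntegrableOn h S μ)
    (h1 : ∀ x ∈ S, |F x| ≤ h x) (h2 : ∀ x ∉ S, F x = 0) : Integrable F μ := by
  refine Integrable.mono' (hh.integrable_indicator hS) hF (ae_of_all _ fun x => ?_)
  by_cases hx : x ∈ S
  · rw [indicator_of_mem hx]
    exact h1 x hx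
  · rw [indicator_of_notMem hx, h2 x hx, norm_zero]

lemma integrableOn_prod_one_add {N : ℕ} {w z : ℝ × E N → ℝ} (hw : LocallyIntegrable w)
    (hz : LocallyIntegrable z) {K K' : Set (ℝ × E N)} (hK : IsCompact K) (hK' : IsCompact K') :
    IntegrableOn (fun x : (ℝ × E N) × (ℝ × E N) => 1 + |w x.1| + |z x.2|) (K ×ˢ K')
      (volume.prod volume) := by
  have f1 : IsFiniteMeasure (volume.restrict K) := ⟨by simpa using hK.measure_lt_top⟩
  have f2 : IsFiniteMeasure (volume.restrict K') := ⟨by simpa using hK'.measure_lt_top⟩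
  rw [IntegrableOn, ← Measure.prod_restrict]
  exact ((integrable_const 1).add ((hw.integrableOn_isCompact hK).abs.comp_fst _)).add
    ((hz.integrableOn_isCompact hK').abs.comp_snd _)

end Integrability

/-! ### The cost of the jump of the flux at time zero. -/

/-- The integral of a locally integrable function over a thin strip of times is small. -/
lemma exists_setIntegral_strip_lt {N : ℕ} {h : ℝ × E N → ℝ} (hh : LocallyIntegrable h)
    {K : Set (ℝ × E N)} (hK : IsCompact K) {η : ℝ} (hη : 0 < η) :
    ∃ ε > 0, ∫ P in K ∩ {P | |P.1| ≤ ε}, h P < η := by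
  set S : ℕ → Set (ℝ × E N) := fun n => K ∩ {P | |P.1| ≤ 1 / ((n : ℝ) + 1)} with hS
  have hSm : ∀ n, MeasurableSet (S n) := fun n =>
    hK.measurableSet.inter (measurableSet_le (by fun_prop) measurable_const)
  have hanti : Antitone S := fun m n hmn => inter_subset_inter_right _ fun P hP =>
    le_trans (show |P.1| ≤ _ from hP) (Nat.one_div_le_one_div hmn)
  have hlim := tendsto_setIntegral_of_antitone hSm hanti
    ⟨0, (hh.integrableOn_isCompact hK).mono_set inter_subset_left⟩
  -- The strips shrink to a subset of the hyperplane t = 0.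
  have hnull : volume (⋂ n, S n) = 0 := by
    refine measure_mono_null (t := {0} ×ˢ univ) (fun P hP => ⟨?_, mem_univ _⟩) ?_
    · have h1 : ∀ n : ℕ, |P.1| ≤ 1 / ((n : ℝ) + 1) := fun n => (mem_iInter.1 hP n).2
      have := ge_of_tendsto' tendsto_one_div_add_atTop_nhds_zero_nat h1
      exact abs_nonpos_iff.1 this
    · rw [Measure.volume_eq_prod, Measure.prod_prod]
      simp
  rw [setIntegral_measure_zero _ hnull] at hlim
  obtain ⟨n, hn⟩ := (hlim.eventually (gt_mem_nhds hη)).exists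
  exact ⟨1 / ((n : ℝ) + 1), by positivity, hn⟩

lemma abs_chi_sub_eq_zero {t τ ε : ℝ} (hτ : |τ| ≤ ε) (h : ε < |t| ∨ ε < |t - τ|) :
    |chi t - chi (t - τ)| = 0 := by
  rw [abs_eq_zero, sub_eq_zero]
  rw [abs_le] at hτ
  unfold chi
  rcases h with h | h <;> rcases lt_abs.1 h with h | h
  · rw [if_pos (by linarith), if_pos (by linarith)]
  · rw [if_neg (by linarith), if_neg (by linarith)]
  · rw [if_pos (by linarith), if_pos (by linarith)]
  · rw [if_neg (by linarith), if_neg (by linarith)]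

lemma abs_chi_sub_le (t s : ℝ) : |chi t - chi s| ≤ 1 := by
  rcases chi_eq t with h | h <;> rcases chi_eq s with h' | h' <;> simp [h, h']

/-- The jump factor vanishes unless both P and P - Q have time at most ε in absolute value. The
integrand is then bounded by 1 + |w(P)| + |z(P - Q)|, and translating the z part by Q leaves a
single strip integral, independent of Q. -/
lemma exists_setIntegral_chi_le {N : ℕ} {w z : ℝ × E N → ℝ} (hw : LocallyIntegrable w)
    (hz : LocallyIntegrable z) {K : Set (ℝ × E N)} (hK : IsCompact K) {η : ℝ} (hη : 0 < η) :
    ∃ ε > 0, ∀ Q : ℝ × E N, |Q.1| ≤ ε → ‖Q‖ ≤ 1 →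
      ∫ P in K, |chi P.1 - chi (P.1 - Q.1)| * (1 + |w P - z (P - Q)|) ≤ η := by
  set K1 := Metric.cthickening 1 K
  have hK1 : IsCompact K1 := hK.cthickening
  have hwa : LocallyIntegrable fun P => 1 + |w P| :=
    (locallyIntegrable_const 1).add fun x => (hw x).norm
  have hza : LocallyIntegrable fun P => |z P| := fun x => (hz x).norm
  obtain ⟨ε, hε, h⟩ := exists_setIntegral_strip_lt (hwa.add hza) hK1 hη
  refine ⟨ε, hε, fun Q hQ hQ1 => le_trans ?_ h.le⟩
  set S := K1 ∩ {P : ℝ × E N | |P.1| ≤ ε} with hS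
  have hSm : MeasurableSet S :=
    hK1.measurableSet.inter (measurableSet_le (by fun_prop) measurable_const)
  have i1 : Integrable (S.indicator fun P => 1 + |w P|) :=
    ((hwa.integrableOn_isCompact hK1).mono_set inter_subset_left).integrable_indicator hSm
  have i2 : Integrable (S.indicator fun P => |z P|) :=
    ((hza.integrableOn_isCompact hK1).mono_set inter_subset_left).integrable_indicator hSm
  have e : ∫ P in S, ((fun P => 1 + |w P|) + fun P => |z P|) P
      = ∫ P, (S.indicator (fun P => 1 + |w P|) P + S.indicator (fun P => |z P|) (P - Q)) := by
    rw [integral_add i1 (i2.comp_sub_right Q),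
      integral_sub_right_eq_self (S.indicator fun P => |z P|) Q, integral_indicator hSm,
      integral_indicator hSm, ← integral_add ((integrable_indicator_iff hSm).1 i1)
        ((integrable_indicator_iff hSm).1 i2)]
    rfl
  rw [e, ← integral_indicator hK.measurableSet]
  refine integral_mono_of_nonneg (ae_of_all _ fun P => indicator_nonneg (fun _ _ => by positivity) P)
    (i1.add (i2.comp_sub_right Q)) (ae_of_all _ fun P => ?_)
  have n1 : 0 ≤ S.indicator (fun P => 1 + |w P|) P := indicator_nonneg (fun _ _ => by positivity) P
  have n2 : 0 ≤ S.indicator (fun P => |z P|) (P - Q) := indicator_nonneg (fun _ _ => by positivity) _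
  by_cases hP : P ∈ K
  swap
  · rw [indicator_of_notMem hP]
    exact add_nonneg n1 n2
  rw [indicator_of_mem hP]
  have hP1 : P ∈ K1 := Metric.self_subset_cthickening K hP
  have hPQ : P - Q ∈ K1 :=
    Metric.mem_cthickening_of_dist_le _ P 1 K hP (by simpa [dist_eq_norm] using hQ1)
  by_cases hc : ε < |P.1| ∨ ε < |P.1 - Q.1|
  · rw [abs_chi_sub_eq_zero hQ hc, zero_mul]
    exact add_nonneg n1 n2
  · rw [not_or, not_lt, not_lt] at hc
    beta_reduce
    rw [indicator_of_mem (show P ∈ S from ⟨hP1, hc.1⟩),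
      indicator_of_mem (show P - Q ∈ S from ⟨hPQ, hc.2⟩)]
    refine (mul_le_of_le_one_left (by positivity) (abs_chi_sub_le _ _)).trans ?_
    linarith [abs_sub (w P) (z (P - Q))]

/-! ### Doubling of variables. -/

section Bounds

variable {N : ℕ} {φ : ℝ × E N → ℝ}

lemma hasCompactSupport_timeDeriv (h : ContDiff ℝ (⊤ : ℕ∞) φ) (hc : HasCompactSupport φ) :
    HasCompactSupport (timeDeriv φ) :=
  HasCompactSupport.intro hc.isCompact fun _ hP => timeDeriv_eq_zero h hP

lemma hasCompactSupport_spaceGrad (h : ContDiff ℝ (⊤ : ℕ∞) φ) (hc : HasCompactSupport φ) :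
    HasCompactSupport (spaceGrad φ) :=
  HasCompactSupport.intro hc.isCompact fun _ hP => spaceGrad_eq_zero h hP

lemma exists_derivative_bound (h : ContDiff ℝ (⊤ : ℕ∞) φ) (hc : HasCompactSupport φ) :
    ∃ B, 0 ≤ B ∧ ∀ P, |φ P| ≤ B ∧ |timeDeriv φ P| ≤ B ∧ ‖spaceGrad φ P‖ ≤ B := by
  obtain ⟨B1, h1⟩ := hc.exists_bound_of_continuous h.continuous
  obtain ⟨B2, h2⟩ := (hasCompactSupport_timeDeriv h hc).exists_bound_of_continuous
    (continuous_timeDeriv h)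
  obtain ⟨B3, h3⟩ := (hasCompactSupport_spaceGrad h hc).exists_bound_of_continuous
    (continuous_spaceGrad h)
  have n1 := (norm_nonneg _).trans (h1 0)
  have n2 := (norm_nonneg _).trans (h2 0)
  have n3 := (norm_nonneg _).trans (h3 0)
  refine ⟨B1 + B2 + B3, by positivity, fun P => ⟨?_, ?_, ?_⟩⟩
  · linarith [h1 P, Real.norm_eq_abs (φ P)]
  · linarith [h2 P, Real.norm_eq_abs (timeDeriv φ P)]
  · linarith [h3 P]

end Bounds

/-- The entropy inequality on space-time, where the initial datum has been absorbed in the values of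
`w` at negative times. -/
def IsEntropySolution {N : ℕ} (f : ℝ → E N) (J : ℝ → E N → ℝ) (T : ℝ) (w : ℝ × E N → ℝ) : Prop :=
  ∀ φ, IsTestFunction T φ → ∀ α : ℝ,
    0 ≤ ∫ P, entropyDensity f J P (w P) α (timeDeriv φ P) (spaceGrad φ P) (φ P)

/-- The entropy density of `w` at `P` for the level `z P'` and the test function `φ P * k (P - P')`
of `P`. -/
def doubledDensityFst {N : ℕ} (f : ℝ → E N) (J : ℝ → E N → ℝ) (w z φ k : ℝ × E N → ℝ)
    (x : (ℝ × E N) × (ℝ × E N)) : ℝ :=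
  entropyDensity f J x.1 (w x.1) (z x.2)
    (timeDeriv φ x.1 * k (x.1 - x.2) + φ x.1 * timeDeriv k (x.1 - x.2))
    (k (x.1 - x.2) • spaceGrad φ x.1 + φ x.1 • spaceGrad k (x.1 - x.2)) (φ x.1 * k (x.1 - x.2))

/-- The entropy density of `z` at `P'` for the level `w P` and the test function `φ P * k (P - P')`
of `P'`. -/
def doubledDensitySnd {N : ℕ} (f : ℝ → E N) (J : ℝ → E N → ℝ) (w z φ k : ℝ × E N → ℝ)
    (x : (ℝ × E N) × (ℝ × E N)) : ℝ :=
  entropyDensity f J x.2 (z x.2) (w x.1) (-(φ x.1 * timeDeriv k (x.1 - x.2)))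
    (-(φ x.1 • spaceGrad k (x.1 - x.2))) (φ x.1 * k (x.1 - x.2))

section Doubling

variable {N : ℕ} {f : ℝ → E N} {L : ℝ} {J : ℝ → E N → ℝ} {M T : ℝ} {w z φ k : ℝ × E N → ℝ}

lemma entropyDensity_zero (P : ℝ × E N) (a b : ℝ) : entropyDensity f J P a b 0 0 0 = 0 := by
  simp [entropyDensity]

/-- The densities have linear growth in w and z, and vanish unless P is in supp φ and P - P' in supp
k. They therefore live on the compact product of supp φ and supp φ - supp k, which justifies Fubini
in both orders. -/
lemma integrable_doubledDensity (hf : IsFlux f L) (hJ : IsRegularField J M) (hw : Measurable w)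
    (hz : Measurable z) (hwl : LocallyIntegrable w) (hzl : LocallyIntegrable z)
    (hφ : IsTestFunction T φ) {ε δ C : ℝ} (hk : IsKernel k ε δ C) :
    Integrable (doubledDensityFst f J w z φ k) (volume.prod volume) ∧
      Integrable (doubledDensitySnd f J w z φ k) (volume.prod volume) := by
  have hL := hf.nonneg
  have hM := hJ.nonneg
  obtain ⟨B, hB0, hB⟩ := exists_derivative_bound hφ.smooth hφ.compact
  obtain ⟨D, hD0, hD⟩ := exists_derivative_bound hk.smooth hk.compact
  have hKc : IsCompact (tsupport φ) := hφ.compact.isCompact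
  set K' : Set (ℝ × E N) := (fun x : (ℝ × E N) × (ℝ × E N) => x.1 - x.2) '' (tsupport φ ×ˢ tsupport k)
  have hK' : IsCompact K' := (hKc.prod hk.compact.isCompact).image (by fun_prop)
  set S := tsupport φ ×ˢ K' with hS
  have hSm : MeasurableSet S := hKc.measurableSet.prod hK'.measurableSet
  have hint := (integrableOn_prod_one_add hwl hzl hKc hK').const_mul
    ((1 + L + L * M) * (5 * B * D))
  have hm1 : Measurable fun x : (ℝ × E N) × (ℝ × E N) => x.1 := measurable_fst
  have hm2 : Measurable fun x : (ℝ × E N) × (ℝ × E N) => x.2 := measurable_snd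
  have hms : Measurable fun x : (ℝ × E N) × (ℝ × E N) => x.1 - x.2 := hm1.sub hm2
  have mφ := hφ.smooth.continuous.measurable.comp hm1
  have mφt := (continuous_timeDeriv hφ.smooth).measurable.comp hm1
  have mφg := (continuous_spaceGrad hφ.smooth).measurable.comp hm1
  have mk := hk.smooth.continuous.measurable.comp hms
  have mkt := (continuous_timeDeriv hk.smooth).measurable.comp hms
  have mkg := (continuous_spaceGrad hk.smooth).measurable.comp hms
  have hout : ∀ x ∉ S, φ x.1 = 0 ∧ timeDeriv φ x.1 = 0 ∧ spaceGrad φ x.1 = 0 ∨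
      k (x.1 - x.2) = 0 ∧ timeDeriv k (x.1 - x.2) = 0 ∧ spaceGrad k (x.1 - x.2) = 0 := by
    intro x hx
    by_cases h1 : x.1 ∈ tsupport φ
    · have h2 : x.1 - x.2 ∉ tsupport k := fun h2 =>
        hx ⟨h1, ⟨(x.1, x.1 - x.2), ⟨h1, h2⟩, sub_sub_cancel _ _⟩⟩
      exact Or.inr ⟨image_eq_zero_of_notMem_tsupport h2, timeDeriv_eq_zero hk.smooth h2,
        spaceGrad_eq_zero hk.smooth h2⟩
    · exact Or.inl ⟨image_eq_zero_of_notMem_tsupport h1, timeDeriv_eq_zero hφ.smooth h1,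
        spaceGrad_eq_zero hφ.smooth h1⟩
  have p1 : ∀ x : (ℝ × E N) × (ℝ × E N), |φ x.1 * k (x.1 - x.2)| ≤ B * D := fun x => by
    rw [abs_mul]
    exact mul_le_mul (hB _).1 (hD _).1 (abs_nonneg _) hB0
  have p2 : ∀ x : (ℝ × E N) × (ℝ × E N), |φ x.1 * timeDeriv k (x.1 - x.2)| ≤ B * D := fun x => by
    rw [abs_mul]
    exact mul_le_mul (hB _).1 (hD _).2.1 (abs_nonneg _) hB0
  have p3 : ∀ x : (ℝ × E N) × (ℝ × E N), ‖φ x.1 • spaceGrad k (x.1 - x.2)‖ ≤ B * D := fun x => by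
    rw [norm_smul]
    exact mul_le_mul (hB _).1 (hD _).2.2 (norm_nonneg _) hB0
  have p4 : ∀ x : (ℝ × E N) × (ℝ × E N), |timeDeriv φ x.1 * k (x.1 - x.2)| ≤ B * D := fun x => by
    rw [abs_mul]
    exact mul_le_mul (hB _).2.1 (hD _).1 (abs_nonneg _) hB0
  have p5 : ∀ x : (ℝ × E N) × (ℝ × E N), ‖k (x.1 - x.2) • spaceGrad φ x.1‖ ≤ B * D := fun x => by
    rw [norm_smul, mul_comm]
    exact mul_le_mul (hB _).2.2 (hD _).1 (abs_nonneg _) hB0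
  have hBD : 0 ≤ B * D := mul_nonneg hB0 hD0
  constructor
  · refine integrable_of_abs_le_on hSm (measurable_entropyDensity hf hJ hm1 (hw.comp hm1)
      (hz.comp hm2) ((mφt.mul mk).add (mφ.mul mkt)) ((mk.smul mφg).add (mφ.smul mkg))
      (mφ.mul mk)).aestronglyMeasurable hint (fun x _ => ?_) fun x hx => ?_
    · refine (abs_entropyDensity_le hf hJ _ _ _ _ _ _).trans ?_
      rw [mul_assoc, mul_comm (5 * B * D)]
      gcongr
      have := abs_add_le (timeDeriv φ x.1 * k (x.1 - x.2)) (φ x.1 * timeDeriv k (x.1 - x.2))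
      have := norm_add_le (k (x.1 - x.2) • spaceGrad φ x.1) (φ x.1 • spaceGrad k (x.1 - x.2))
      linarith [p1 x, p2 x, p3 x, p4 x, p5 x]
    · unfold doubledDensityFst
      rcases hout x hx with ⟨h1, h2, h3⟩ | ⟨h1, h2, h3⟩
      · simp only [h1, h2, h3, zero_mul, smul_zero, zero_smul, add_zero, entropyDensity_zero]
      · simp only [h1, h2, h3, mul_zero, smul_zero, zero_smul, add_zero, entropyDensity_zero]
  · refine integrable_of_abs_le_on hSm (measurable_entropyDensity hf hJ hm2 (hz.comp hm2)
      (hw.comp hm1) (mφ.mul mkt).neg (mφ.smul mkg).neg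
      (mφ.mul mk)).aestronglyMeasurable hint (fun x _ => ?_) fun x hx => ?_
    · refine (abs_entropyDensity_le hf hJ _ _ _ _ _ _).trans ?_
      rw [mul_assoc, mul_comm (5 * B * D), add_right_comm 1 |z x.2| |w x.1|]
      gcongr
      rw [abs_neg, norm_neg]
      linarith [p1 x, p2 x, p3 x]
    · unfold doubledDensitySnd
      rcases hout x hx with ⟨h1, h2, h3⟩ | ⟨h1, h2, h3⟩
      · simp only [h1, zero_mul, zero_smul, neg_zero, entropyDensity_zero]
      · simp only [h1, h2, h3, mul_zero, smul_zero, neg_zero, entropyDensity_zero]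

lemma measurePreserving_prod_sub_left {G : Type*} [MeasurableSpace G] [AddGroup G] [MeasurableAdd₂ G]
    [MeasurableNeg G] (μ : Measure G) [SFinite μ] [μ.IsAddLeftInvariant] [μ.IsNegInvariant] :
    MeasurePreserving (fun x : G × G => (x.1, x.1 - x.2)) (μ.prod μ) (μ.prod μ) := by
  have h1 : MeasurePreserving (Prod.map (fun x : G => x) fun y : G => -y) (μ.prod μ) (μ.prod μ) :=
    (MeasurePreserving.id μ).prod (Measure.measurePreserving_neg μ)
  have h2 := (measurePreserving_prod_add μ μ).comp h1
  simpa [Function.comp_def, sub_eq_add_neg] using h2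

/-- The doubled entropy inequality, in terms of the point `P` and of the shift `Q = P - P'`. -/
lemma integral_doubledDensity_nonneg (hf : IsFlux f L) (hJ : IsRegularField J M) (hw : Measurable w)
    (hz : Measurable z) (hwl : LocallyIntegrable w) (hzl : LocallyIntegrable z)
    (hwe : IsEntropySolution f J T w) (hze : IsEntropySolution f J T z)
    (hφ : IsTestFunction T φ) {ε δ C : ℝ} (hk : IsKernel k ε δ C)
    (hε : ∀ P ∈ tsupport φ, |P.1| + ε < T) :
    Integrable (fun x : (ℝ × E N) × (ℝ × E N) => doubledDensityFst f J w z φ k (x.1, x.1 - x.2)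
        + doubledDensitySnd f J w z φ k (x.1, x.1 - x.2)) (volume.prod volume) ∧
    0 ≤ ∫ Q, ∫ P, (doubledDensityFst f J w z φ k (P, P - Q)
        + doubledDensitySnd f J w z φ k (P, P - Q)) := by
  obtain ⟨i1, i2⟩ := integrable_doubledDensity hf hJ hw hz hwl hzl hφ hk
  have n1 : 0 ≤ ∫ x, doubledDensityFst f J w z φ k x ∂(volume.prod volume) := by
    -- For frozen P' the number z(P') is an admissible level in the inequality for w; below, the
    -- roles are exchanged with P frozen.
    rw [integral_prod_symm _ i1]
    refine integral_nonneg fun P' => ?_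
    have h := hwe _ (hφ.mul_comp_sub hk P') (z P')
    simp_rw [timeDeriv_mul_comp_sub hφ.smooth hk.smooth, spaceGrad_mul_comp_sub hφ.smooth hk.smooth]
      at h
    exact h
  have n2 : 0 ≤ ∫ x, doubledDensitySnd f J w z φ k x ∂(volume.prod volume) := by
    rw [integral_prod _ i2]
    refine integral_nonneg fun P => ?_
    by_cases hP : P ∈ tsupport φ
    · have h := hze _ (hk.isTestFunction (hφ.nonneg P) (hε P hP)) (w P)
      simp_rw [timeDeriv_const_mul_comp_const_sub hk.smooth,
        spaceGrad_const_mul_comp_const_sub hk.smooth] at h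
      exact h
    · simp [doubledDensitySnd, image_eq_zero_of_notMem_tsupport hP, entropyDensity_zero]
  have mp := measurePreserving_prod_sub_left (volume : Measure (ℝ × E N))
  have i3 := mp.integrable_comp_of_integrable (i1.add i2)
  refine ⟨i3, ?_⟩
  have e := integral_prod_symm _ i3
  have hemb : MeasurableEmbedding fun x : (ℝ × E N) × (ℝ × E N) => (x.1, x.1 - x.2) := by
    -- The change of variables (P, P') ↦ (P, P - P') is its own inverse.
    have : Function.Involutive fun x : (ℝ × E N) × (ℝ × E N) => (x.1, x.1 - x.2) := fun x => by simp
    exact (MeasurableEquiv.ofInvolutive _ this mp.measurable).measurableEmbedding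
  have e2 := mp.integral_comp hemb (doubledDensityFst f J w z φ k + doubledDensitySnd f J w z φ k)
  refine le_of_le_of_eq ?_ e
  refine le_of_le_of_eq ?_ e2.symm
  rw [integral_add' i1 i2]
  exact add_nonneg n1 n2

end Doubling

/-- Bookkeeping: one constant absorbs every coefficient, and the errors are sorted by what makes
them small, namely the translation of z (d), the widths δ and η, and the jump of the flux (c). -/
lemma doubling_error_le {L M B δ η : ℝ} (hL : 0 ≤ L) (hM : 0 ≤ M) (hη : 0 ≤ η)
    {d k a g φ q κ c e : ℝ} (hd : 0 ≤ d) (hk : 0 ≤ k) (ha : |a| ≤ B) (hg : g ≤ B)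
    (hφ0 : 0 ≤ φ) (hφ : φ ≤ B) (hq0 : 0 ≤ q) (hq : q ≤ δ) (hκ : 0 ≤ κ) (hc : 0 ≤ c) (he : 0 ≤ e) :
    d * (k * (|a| + L * g + φ * (L * M)) + φ * (L * M * q * κ))
      + φ * κ * (2 * (L * M ^ 2 + L * M) * q ^ 2 + 2 * L * η + c * (L * e))
      + φ * k * (L * (M + 1) * (η + M * q) + c * (L * M))
    ≤ B * (1 + 6 * L * (1 + M) ^ 2) * ((k + δ * κ) * d + (κ * (δ ^ 2 + η) + k * (η + δ))
      + (κ + k) * (c * (1 + e))) := by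
  have hB : 0 ≤ B := hφ0.trans hφ
  set A := 1 + 6 * L * (1 + M) ^ 2 with hA
  have hLM : 0 ≤ L * M := by positivity
  have hLMM : 0 ≤ L * M ^ 2 := by positivity
  have eA : A = 1 + 6 * L + 12 * (L * M) + 6 * (L * M ^ 2) := by rw [hA]; ring
  have a1 : 1 + L + L * M ≤ A := by rw [eA]; linarith
  have a2 : L * M ≤ A := by linarith
  have a3 : 2 * (L * M ^ 2 + L * M) ≤ A := by rw [eA]; linarith
  have a4 : 2 * L ≤ A := by rw [eA]; linarith
  have a5 : L * (M + 1) ≤ A := by rw [eA]; linarith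
  have a6 : L * (M + 1) * M ≤ A := by rw [eA]; linarith
  have a7 : L ≤ A := by linarith
  have hA0 : 0 ≤ A := by positivity
  have t1 : d * (k * (|a| + L * g + φ * (L * M))) ≤ B * A * (k * d) := by
    calc _ ≤ d * (k * (B + L * B + B * (L * M))) := by gcongr
      _ = B * (1 + L + L * M) * (k * d) := by ring
      _ ≤ _ := by gcongr
  have t2 : d * (φ * (L * M * q * κ)) ≤ B * A * (δ * κ * d) := by
    calc _ ≤ d * (B * (A * δ * κ)) := by gcongr
      _ = _ := by ring
  have t3 : φ * κ * (2 * (L * M ^ 2 + L * M) * q ^ 2) ≤ B * A * (κ * δ ^ 2) := by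
    calc _ ≤ B * κ * (A * δ ^ 2) := by gcongr
      _ = _ := by ring
  have t4 : φ * κ * (2 * L * η) ≤ B * A * (κ * η) := by
    calc _ ≤ B * κ * (A * η) := by gcongr
      _ = _ := by ring
  have t5 : φ * κ * (c * (L * e)) ≤ B * A * (κ * (c * (1 + e))) := by
    calc _ ≤ B * κ * (c * (A * (1 + e))) := by gcongr; linarith
      _ = _ := by ring
  have t6 : φ * k * (L * (M + 1) * η) ≤ B * A * (k * η) := by
    calc _ ≤ B * k * (A * η) := by gcongr
      _ = _ := by ring
  have t7 : φ * k * (L * (M + 1) * M * q) ≤ B * A * (k * δ) := by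
    calc _ ≤ B * k * (A * δ) := by gcongr
      _ = _ := by ring
  have t8 : φ * k * (c * (L * M)) ≤ B * A * (k * (c * (1 + e))) := by
    have hAe : L * M ≤ A * (1 + e) := a2.trans (le_mul_of_one_le_right hA0 (by linarith))
    calc φ * k * (c * (L * M)) ≤ B * k * (c * (A * (1 + e))) :=
          mul_le_mul (by gcongr) (mul_le_mul_of_nonneg_left hAe hc) (by positivity) (by positivity)
      _ = _ := by ring
  linarith

/-! ### The Kato inequality. -/

section Kato

variable {N : ℕ} {f : ℝ → E N} {L : ℝ} {J : ℝ → E N → ℝ} {M T : ℝ} {w z φ k : ℝ × E N → ℝ}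

/-- The integrand is the derivative of (b · q) k(Q) in the direction (0, a), and k has compact
support. -/
lemma integral_inner_mul_spaceGrad (hk : ContDiff ℝ (⊤ : ℕ∞) k) (hkc : HasCompactSupport k)
    (a b : E N) : ∫ Q : ℝ × E N, (inner ℝ b Q.2 * inner ℝ a (spaceGrad k Q) + k Q * inner ℝ a b)
      = 0 := by
  have hd := hk.differentiable (by simp)
  have hl : ∀ Q : ℝ × E N, HasFDerivAt (fun Q : ℝ × E N => inner ℝ b Q.2)
      ((innerSL ℝ b).comp (ContinuousLinearMap.snd ℝ ℝ (E N))) Q := fun Q =>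
    ((innerSL ℝ b).comp (ContinuousLinearMap.snd ℝ ℝ (E N))).hasFDerivAt
  have hg := continuous_spaceGrad hk
  have i1 : Integrable fun Q : ℝ × E N => inner ℝ b Q.2 * inner ℝ a (spaceGrad k Q) := by
    refine Continuous.integrable_of_hasCompactSupport (by fun_prop) ?_
    refine HasCompactSupport.intro hkc.isCompact fun Q hQ => ?_
    simp [spaceGrad_eq_zero hk hQ]
  have i2 : Integrable fun Q : ℝ × E N => k Q * inner ℝ a b :=
    (hk.continuous.integrable_of_hasCompactSupport hkc).mul_const _
  have i3 : Integrable fun Q : ℝ × E N => inner ℝ b Q.2 * k Q :=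
    Continuous.integrable_of_hasCompactSupport (by have := hk.continuous; fun_prop) hkc.mul_left
  have key := integral_mul_fderiv_eq_neg_fderiv_mul_of_integrable (μ := volume)
    (f := fun Q : ℝ × E N => inner ℝ b Q.2) (g := k) (v := ((0 : ℝ), a))
    (by simpa [(hl _).fderiv, mul_comm, real_inner_comm] using i2)
    (by simpa [inner_spaceGrad (hd _)] using i1) i3
    (fun Q _ => (hl Q).differentiableAt) (fun Q _ => hd Q)
  rw [integral_add i1 i2]
  simp only [inner_spaceGrad (hd _)]
  rw [key, ← sub_eq_neg_add, sub_eq_zero]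
  refine integral_congr_ae (ae_of_all _ fun Q => ?_)
  simp [(hl _).fderiv, mul_comm, real_inner_comm]

/-- The main part of the doubled density that is left over by the mollified Kato density. -/
def crossDensity (f : ℝ → E N) (J : ℝ → E N → ℝ) (w z φ k : ℝ × E N → ℝ)
    (x : (ℝ × E N) × (ℝ × E N)) : ℝ :=
  φ x.1 * chi x.1.1 *
    (inner ℝ (gradient (J x.1.1) x.1.2) x.2.2 *
        inner ℝ (signedDeriv f J x.1 (w x.1) (z x.1)) (spaceGrad k x.2)
      + k x.2 * inner ℝ (signedDeriv f J x.1 (w x.1) (z x.1)) (gradient (J x.1.1) x.1.2))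

lemma integrable_crossDensity (hf : IsFlux f L) (hJ : IsRegularField J M) (hw : Measurable w)
    (hz : Measurable z) (hφ : IsTestFunction T φ) {ε δ C : ℝ} (hk : IsKernel k ε δ C) :
    Integrable (crossDensity f J w z φ k) (volume.prod volume) := by
  have hL := hf.nonneg
  have hM := hJ.nonneg
  have hg := continuous_spaceGrad hk.smooth
  have i1 : Integrable fun Q : ℝ × E N => ‖Q.2‖ * ‖spaceGrad k Q‖ + k Q := by
    refine Integrable.add (Continuous.integrable_of_hasCompactSupport (by fun_prop) ?_)
      (hk.smooth.continuous.integrable_of_hasCompactSupport hk.compact)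
    exact (hasCompactSupport_spaceGrad hk.smooth hk.compact).norm.mul_left
  have i2 := (hφ.smooth.continuous.integrable_of_hasCompactSupport (μ := volume) hφ.compact).mul_prod
    (i1.const_mul (2 * L * M))
  refine i2.mono' ?_ (ae_of_all _ fun x => ?_)
  · have m1 := (measurable_signedDeriv hf hJ hw hz).comp
      (measurable_fst : Measurable fun x : (ℝ × E N) × (ℝ × E N) => x.1)
    have m2 := hJ.continuous_gradient.measurable.comp
      (measurable_fst : Measurable fun x : (ℝ × E N) × (ℝ × E N) => x.1)
    have m3 := hg.measurable.comp
      (measurable_snd : Measurable fun x : (ℝ × E N) × (ℝ × E N) => x.2)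
    have m4 : Measurable fun x : (ℝ × E N) × (ℝ × E N) => inner ℝ (gradient (J x.1.1) x.1.2) x.2.2 :=
      Measurable.inner m2 (measurable_snd.comp measurable_snd)
    have m5 : Measurable fun x : (ℝ × E N) × (ℝ × E N) =>
        inner ℝ (signedDeriv f J x.1 (w x.1) (z x.1)) (spaceGrad k x.2) := Measurable.inner m1 m3
    have m6 : Measurable fun x : (ℝ × E N) × (ℝ × E N) =>
        inner ℝ (signedDeriv f J x.1 (w x.1) (z x.1)) (gradient (J x.1.1) x.1.2) :=
      Measurable.inner m1 m2
    have m7 := hφ.smooth.continuous.measurable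
    have m8 := hk.smooth.continuous.measurable
    have m9 := measurable_chi
    refine Measurable.aestronglyMeasurable ?_
    unfold crossDensity
    fun_prop
  · unfold crossDensity
    have hK : ‖signedDeriv f J x.1 (w x.1) (z x.1)‖ ≤ 2 * L := norm_signedDeriv_le hf _ _ _
    have hb := hJ.norm_gradient_le x.1.1 x.1.2
    have hk0 := hk.nonneg x.2
    rw [norm_mul, norm_mul, Real.norm_of_nonneg (hφ.nonneg _)]
    refine mul_le_mul (mul_le_of_le_one_right (hφ.nonneg _) (abs_chi_le _)) ?_ (norm_nonneg _)
      (hφ.nonneg _)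
    refine (norm_add_le _ _).trans ?_
    rw [norm_mul, norm_mul, Real.norm_of_nonneg hk0]
    calc _ ≤ M * ‖x.2.2‖ * (2 * L * ‖spaceGrad k x.2‖) + k x.2 * (2 * L * M) := by
          gcongr
          · exact (norm_inner_le_norm _ _).trans (by gcongr)
          · exact (norm_inner_le_norm _ _).trans (by gcongr)
          · exact (norm_inner_le_norm _ _).trans (by gcongr)
      _ = _ := by ring

/-- For frozen P the vectors paired with q, ∇k and k are constant in Q, so the integral over Q is
that of a total derivative. -/
lemma integral_crossDensity (hf : IsFlux f L) (hJ : IsRegularField J M) (hw : Measurable w)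
    (hz : Measurable z) (hφ : IsTestFunction T φ) {ε δ C : ℝ} (hk : IsKernel k ε δ C) :
    ∫ Q, ∫ P, crossDensity f J w z φ k (P, Q) = 0 := by
  have i := integrable_crossDensity hf hJ hw hz hφ hk
  rw [← integral_prod_symm _ i, integral_prod _ i]
  refine integral_eq_zero_of_ae (ae_of_all _ fun P => ?_)
  unfold crossDensity
  simp only
  rw [integral_const_mul, integral_inner_mul_spaceGrad hk.smooth hk.compact, mul_zero]
  rfl

lemma integrable_katoDensity (hf : IsFlux f L) (hJ : IsRegularField J M) (hw : Measurable w)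
    (hz : Measurable z) (hwl : LocallyIntegrable w) (hzl : LocallyIntegrable z)
    (hφ : ContDiff ℝ (⊤ : ℕ∞) φ) (hφc : HasCompactSupport φ) :
    Integrable fun P => katoDensity f J P (w P) (z P) (timeDeriv φ P) (spaceGrad φ P) := by
  have hL := hf.nonneg
  obtain ⟨B, hB0, hB⟩ := exists_derivative_bound hφ hφc
  have hi : LocallyIntegrable fun P => (1 + |w P|) + |z P| :=
    ((locallyIntegrable_const 1).add fun x => (hwl x).norm).add fun x => (hzl x).norm
  refine integrable_of_abs_le_on (S := tsupport φ) hφc.isCompact.measurableSet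
    (measurable_katoDensity hf hJ measurable_id hw hz (continuous_timeDeriv hφ).measurable
      (continuous_spaceGrad hφ).measurable).aestronglyMeasurable
    ((hi.integrableOn_isCompact hφc.isCompact).const_mul ((1 + L) * (2 * B))) (fun P _ => ?_)
    fun P hP => ?_
  · refine (abs_katoDensity_le hf _ _ _ _ _).trans ?_
    rw [mul_assoc, mul_comm (2 * B)]
    gcongr
    linarith [(hB P).2.1, (hB P).2.2]
  · simp [katoDensity, timeDeriv_eq_zero hφ hP, spaceGrad_eq_zero hφ hP]

end Kato

section KatoInequality

variable {N : ℕ} {f : ℝ → E N} {L : ℝ} {J : ℝ → E N → ℝ} {M T : ℝ} {w z φ k : ℝ × E N → ℝ}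

/-- The pointwise estimate of the doubled density, with uniform constants. -/
lemma doubledDensity_le (hf : IsFlux f L) (hJ : IsRegularField J M) (hφ : IsTestFunction T φ)
    {B : ℝ} (hB : ∀ P, |φ P| ≤ B ∧ |timeDeriv φ P| ≤ B ∧ ‖spaceGrad φ P‖ ≤ B)
    {ε δ C η : ℝ} (hη : 0 ≤ η) (hk : IsKernel k ε δ C)
    (hJη : ∀ t t', |t - t'| ≤ ε → ∀ x, |J t x - J t' x| ≤ η ∧
      ‖gradient (J t) x - gradient (J t') x‖ ≤ η) (P Q : ℝ × E N) :
    doubledDensityFst f J w z φ k (P, P - Q) + doubledDensitySnd f J w z φ k (P, P - Q)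
    ≤ k Q * katoDensity f J P (w P) (z P) (timeDeriv φ P) (spaceGrad φ P)
      + crossDensity f J w z φ k (P, Q)
      + (tsupport φ).indicator (fun P => B * (1 + 6 * L * (1 + M) ^ 2) *
        ((k Q + δ * ‖spaceGrad k Q‖) * |z P - z (P - Q)|
          + (‖spaceGrad k Q‖ * (δ ^ 2 + η) + k Q * (η + δ))
          + (‖spaceGrad k Q‖ + k Q) *
            (|chi P.1 - chi (P.1 - Q.1)| * (1 + |w P - z (P - Q)|)))) P := by
  by_cases hP : P ∈ tsupport φ
  swap
  · rw [indicator_of_notMem hP]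
    simp [doubledDensityFst, doubledDensitySnd, crossDensity, katoDensity,
      image_eq_zero_of_notMem_tsupport hP, timeDeriv_eq_zero hφ.smooth hP,
      spaceGrad_eq_zero hφ.smooth hP, entropyDensity_zero]
  rw [indicator_of_mem hP]
  by_cases hQ : Q ∈ tsupport k
  swap
  · simp [doubledDensityFst, doubledDensitySnd, crossDensity,
      image_eq_zero_of_notMem_tsupport hQ, timeDeriv_eq_zero hk.smooth hQ,
      spaceGrad_eq_zero hk.smooth hQ, entropyDensity_zero]
  have hQs := hk.support hQ
  have hQ1 : |Q.1| ≤ ε := by simpa using hQs.1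
  have hQ2 : ‖Q.2‖ ≤ δ := by simpa using hQs.2
  have hj := hJη P.1 (P.1 - Q.1) (by simpa using hQ1) (P.2 - Q.2)
  have h1 := doubled_density_le hf hJ (w P) (z P) (z (P - Q)) P Q hj.1 hj.2 (hφ.nonneg P)
    (hk.nonneg Q) (timeDeriv φ P) (timeDeriv k Q) (spaceGrad φ P) (spaceGrad k Q)
  have h2 := doubling_error_le hf.nonneg hJ.nonneg hη (abs_nonneg (z P - z (P - Q)))
    (hk.nonneg Q) (hB P).2.1 (hB P).2.2 (hφ.nonneg P)
    ((le_abs_self _).trans (hB P).1) (norm_nonneg Q.2) hQ2 (norm_nonneg (spaceGrad k Q))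
    (abs_nonneg (chi P.1 - chi (P.1 - Q.1))) (abs_nonneg (w P - z (P - Q)))
  simp only [doubledDensityFst, doubledDensitySnd, sub_sub_cancel, crossDensity]
  linarith

/-- The estimate of the doubled density, integrated in `P`. -/
lemma integral_doubledDensity_le (hf : IsFlux f L) (hJ : IsRegularField J M) (hw : Measurable w)
    (hz : Measurable z) (hwl : LocallyIntegrable w) (hzl : LocallyIntegrable z)
    (hφ : IsTestFunction T φ)
    {B : ℝ} (hB : ∀ P, |φ P| ≤ B ∧ |timeDeriv φ P| ≤ B ∧ ‖spaceGrad φ P‖ ≤ B)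
    {ε δ C η m n : ℝ} (hδ : 0 ≤ δ) (hη : 0 ≤ η) (hk : IsKernel k ε δ C)
    (hJη : ∀ t t', |t - t'| ≤ ε → ∀ x, |J t x - J t' x| ≤ η ∧
      ‖gradient (J t) x - gradient (J t') x‖ ≤ η) {Q : ℝ × E N}
    (hm : ∫ P in tsupport φ, |z P - z (P - Q)| ≤ m)
    (hn : ∫ P in tsupport φ, |chi P.1 - chi (P.1 - Q.1)| * (1 + |w P - z (P - Q)|) ≤ n)
    (hD : Integrable fun P => doubledDensityFst f J w z φ k (P, P - Q)
      + doubledDensitySnd f J w z φ k (P, P - Q))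
    (hcr : Integrable fun P => crossDensity f J w z φ k (P, Q)) :
    ∫ P, (doubledDensityFst f J w z φ k (P, P - Q) + doubledDensitySnd f J w z φ k (P, P - Q))
    ≤ k Q * (∫ P, katoDensity f J P (w P) (z P) (timeDeriv φ P) (spaceGrad φ P))
      + (∫ P, crossDensity f J w z φ k (P, Q))
      + B * (1 + 6 * L * (1 + M) ^ 2) * ((k Q + δ * ‖spaceGrad k Q‖) * m
          + (‖spaceGrad k Q‖ * (δ ^ 2 + η) + k Q * (η + δ)) * volume.real (tsupport φ)
          + (‖spaceGrad k Q‖ + k Q) * n) := by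
  have hL := hf.nonneg
  have hk0 := hk.nonneg Q
  have hB0 : 0 ≤ B := (abs_nonneg _).trans (hB 0).1
  set K := tsupport φ with hK
  have hKc : IsCompact K := hφ.compact.isCompact
  have hKm : MeasurableSet K := hKc.measurableSet
  have fin : IsFiniteMeasure (volume.restrict K) := ⟨by simpa using hKc.measure_lt_top⟩
  have hzq : IntegrableOn (fun P => z (P - Q)) K := by
    have hKQ : IsCompact ((fun P => P - Q) '' K) := hKc.image (by fun_prop)
    exact (((measurePreserving_sub_right volume Q).integrableOn_comp_preimage
      (MeasurableEquiv.subRight Q).measurableEmbedding).2 (hzl.integrableOn_isCompact hKQ)).mono_set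
      (subset_preimage_image _ _)
  have i1 : IntegrableOn (fun P => |z P - z (P - Q)|) K :=
    ((hzl.integrableOn_isCompact hKc).sub hzq).abs
  have i2 : IntegrableOn (fun P => |chi P.1 - chi (P.1 - Q.1)| * (1 + |w P - z (P - Q)|)) K := by
    have h1 : IntegrableOn (fun P => 1 + |w P - z (P - Q)|) K := (integrable_const 1).add
      ((hwl.integrableOn_isCompact hKc).sub hzq).abs
    refine h1.mono' ?_ (ae_of_all _ fun P => ?_)
    · have := measurable_chi
      exact Measurable.aestronglyMeasurable (by fun_prop)
    · rw [Real.norm_of_nonneg (by positivity)]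
      exact mul_le_of_le_one_left (by positivity) (abs_chi_sub_le _ _)
  have ik := integrable_katoDensity hf hJ hw hz hwl hzl hφ.smooth hφ.compact
  have i3 : IntegrableOn (fun P => B * (1 + 6 * L * (1 + M) ^ 2) *
        ((k Q + δ * ‖spaceGrad k Q‖) * |z P - z (P - Q)|
          + (‖spaceGrad k Q‖ * (δ ^ 2 + η) + k Q * (η + δ))
          + (‖spaceGrad k Q‖ + k Q) *
            (|chi P.1 - chi (P.1 - Q.1)| * (1 + |w P - z (P - Q)|)))) K :=
    (((i1.const_mul _).add (integrable_const _)).add (i2.const_mul _)).const_mul _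
  refine (integral_mono hD (((ik.const_mul (k Q)).add hcr).add (i3.integrable_indicator hKm))
    fun P => doubledDensity_le hf hJ hφ hB hη hk hJη P Q).trans ?_
  have e1 := integral_add ((ik.const_mul (k Q)).add hcr) (i3.integrable_indicator hKm)
  have e2 := integral_add (ik.const_mul (k Q)) hcr
  refine (le_of_eq e1).trans ?_
  refine add_le_add ((le_of_eq e2).trans (le_of_eq (by rw [integral_const_mul]))) ?_
  rw [integral_indicator hKm, integral_const_mul,
    integral_add ((i1.const_mul _).fun_add (integrable_const _)) (i2.const_mul _),
    integral_add (i1.const_mul _) (integrable_const _), integral_const_mul, integral_const_mul,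
    setIntegral_const, smul_eq_mul, mul_comm (volume.real K)]
  gcongr

/-- The **Kato inequality** for two entropy solutions. -/
theorem kato_inequality (hf : IsFlux f L) (hJ : IsRegularField J M) (hw : Measurable w)
    (hz : Measurable z) (hwl : LocallyIntegrable w) (hzl : LocallyIntegrable z)
    (hwe : IsEntropySolution f J T w) (hze : IsEntropySolution f J T z)
    (hφ : IsTestFunction T φ) :
    0 ≤ ∫ P, katoDensity f J P (w P) (z P) (timeDeriv φ P) (spaceGrad φ P) := by
  obtain ⟨B, hB0, hB⟩ := exists_derivative_bound hφ.smooth hφ.compact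
  obtain ⟨C, hC0, hker⟩ := exists_isKernel N
  obtain ⟨μ, hμ, hmargin⟩ := hφ.exists_margin
  have hL := hf.nonneg
  set K := tsupport φ with hK
  have hKc : IsCompact K := hφ.compact.isCompact
  set A := B * (1 + 6 * L * (1 + M) ^ 2) with hA
  have hA0 : 0 ≤ A := by positivity
  set V := volume.real K with hV
  have hV0 : 0 ≤ V := measureReal_nonneg
  set I := ∫ P, katoDensity f J P (w P) (z P) (timeDeriv φ P) (spaceGrad φ P) with hI
  have main : ∀ e : ℝ, 0 < e → 0 ≤ I + e * (A * ((1 + C) + (2 * C + 2) * V + (C + 1))) := by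
    intro e he
    -- The order of choice matters: e determines ρ through the translations of z, then δ ≤ ρ is
    -- fixed, and only afterwards ε, such that the time oscillation of J and the strip integral are
    -- at most δ e. The factor δ is there to pay for the 1/δ in the L^1 norm of ∇k.
    obtain ⟨ρ, hρ, hρt⟩ := exists_setIntegral_abs_sub_translate_le hzl hKc he
    set δ := min ρ (min e 1) with hδd
    have hδ : 0 < δ := by positivity
    have hδρ : δ ≤ ρ := min_le_left _ _
    have hδe : δ ≤ e := (min_le_right _ _).trans (min_le_left _ _)
    have hδ1 : δ ≤ 1 := (min_le_right _ _).trans (min_le_right _ _)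
    have hη : 0 < δ * e := by positivity
    obtain ⟨ε₁, hε₁, hJε⟩ := hJ.equicontinuous (δ * e) hη
    obtain ⟨ε₂, hε₂, hχ⟩ := exists_setIntegral_chi_le hwl hzl hKc hη
    set ε := min (min δ μ) (min ε₁ ε₂) with hεd
    have hε : 0 < ε := by positivity
    have hεδ : ε ≤ δ := (min_le_left _ _).trans (min_le_left _ _)
    have hεμ : ε ≤ μ := (min_le_left _ _).trans (min_le_right _ _)
    have hε1 : ε ≤ ε₁ := (min_le_right _ _).trans (min_le_left _ _)
    have hε2 : ε ≤ ε₂ := (min_le_right _ _).trans (min_le_right _ _)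
    obtain ⟨k, hk⟩ := hker ε δ hε hδ
    obtain ⟨iD, hD⟩ := integral_doubledDensity_nonneg hf hJ hw hz hwl hzl hwe hze hφ hk
      fun P hP => by linarith [hmargin P hP]
    have icr := integrable_crossDensity hf hJ hw hz hφ hk
    have ik : Integrable k := hk.smooth.continuous.integrable_of_hasCompactSupport hk.compact
    have ig : Integrable fun Q => ‖spaceGrad k Q‖ :=
      ((continuous_spaceGrad hk.smooth).integrable_of_hasCompactSupport
        (hasCompactSupport_spaceGrad hk.smooth hk.compact)).norm
    have bound : ∀ᵐ Q : ℝ × E N, ∫ P, (doubledDensityFst f J w z φ k (P, P - Q)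
        + doubledDensitySnd f J w z φ k (P, P - Q))
        ≤ k Q * I + (∫ P, crossDensity f J w z φ k (P, Q))
          + (k Q * (A * (e + (δ * e + δ) * V + δ * e))
            + ‖spaceGrad k Q‖ * (A * (δ * e + (δ ^ 2 + δ * e) * V + δ * e))) := by
      filter_upwards [iD.prod_left_ae, icr.prod_left_ae] with Q hQ1 hQ2
      by_cases hQ : Q ∈ tsupport k
      · have hQs := hk.support hQ
        have hq1 : |Q.1| ≤ ε := by simpa using hQs.1
        have hq2 : ‖Q.2‖ ≤ δ := by simpa using hQs.2
        have hQn : ‖Q‖ ≤ δ := max_le (hq1.trans hεδ) hq2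
        have h := integral_doubledDensity_le hf hJ hw hz hwl hzl hφ hB hδ.le hη.le hk
          (fun t t' htt x => hJε t t' (htt.trans hε1) x) (hρt Q (hQn.trans hδρ))
          (hχ Q (hq1.trans hε2) (hQn.trans hδ1)) hQ1 hQ2
        refine h.trans (le_of_eq ?_)
        ring
      · have h0 : ∀ P, doubledDensityFst f J w z φ k (P, P - Q)
            + doubledDensitySnd f J w z φ k (P, P - Q) = 0 := fun P => by
          simp [doubledDensityFst, doubledDensitySnd,
            image_eq_zero_of_notMem_tsupport hQ, timeDeriv_eq_zero hk.smooth hQ,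
            spaceGrad_eq_zero hk.smooth hQ, entropyDensity_zero]
        have h1 : ∀ P, crossDensity f J w z φ k (P, Q) = 0 := fun P => by
          simp [crossDensity, image_eq_zero_of_notMem_tsupport hQ, spaceGrad_eq_zero hk.smooth hQ]
        simp [h0, h1, image_eq_zero_of_notMem_tsupport hQ, spaceGrad_eq_zero hk.smooth hQ]
    have j1 : Integrable fun Q => k Q * I := ik.mul_const I
    have j2 : Integrable fun Q => ∫ P, crossDensity f J w z φ k (P, Q) := icr.integral_prod_right
    have j3 : Integrable fun Q => k Q * (A * (e + (δ * e + δ) * V + δ * e)) := ik.mul_const _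
    have j4 : Integrable fun Q => ‖spaceGrad k Q‖ * (A * (δ * e + (δ ^ 2 + δ * e) * V + δ * e)) :=
      ig.mul_const _
    have h := hD.trans (integral_mono_ae iD.integral_prod_right ((j1.add j2).add (j3.add j4)) bound)
    have e1 : ∫ Q, (k Q * I + (∫ P, crossDensity f J w z φ k (P, Q))
          + (k Q * (A * (e + (δ * e + δ) * V + δ * e))
            + ‖spaceGrad k Q‖ * (A * (δ * e + (δ ^ 2 + δ * e) * V + δ * e))))
        = I + A * (e + (δ * e + δ) * V + δ * e)
          + (∫ Q, ‖spaceGrad k Q‖) * (A * (δ * e + (δ ^ 2 + δ * e) * V + δ * e)) := by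
      rw [integral_add (j1.fun_add j2) (j3.fun_add j4), integral_add j1 j2, integral_add j3 j4,
        integral_mul_const, integral_mul_const, integral_mul_const,
        integral_crossDensity hf hJ hw hz hφ hk, hk.integral_eq_one]
      ring
    have h' := h.trans_eq e1
    -- Each term multiplying the gradient carries a factor δ, which cancels the bound C / δ.
    have g1 : (∫ Q, ‖spaceGrad k Q‖) * (A * (δ * e + (δ ^ 2 + δ * e) * V + δ * e))
        ≤ C * (A * (e + (e + e) * V + e)) := by
      calc _ ≤ C / δ * (A * (δ * e + (δ ^ 2 + δ * e) * V + δ * e)) := by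
            gcongr
            exact hk.integral_grad_le
        _ = C * (A * (e + (δ + e) * V + e)) := by field_simp
        _ ≤ _ := by gcongr
    have hde : δ * e ≤ e := mul_le_of_le_one_left he.le hδ1
    have g2 : A * (e + (δ * e + δ) * V + δ * e) ≤ A * (e + (e + e) * V + e) := by gcongr
    linarith
  by_contra hneg
  rw [not_le] at hneg
  set c := A * ((1 + C) + (2 * C + 2) * V + (C + 1))
  have hc : 0 ≤ c := by positivity
  -- With this value of e the error e c is at most -I / 2, so `main` yields I / 2 ≥ 0, contrary to I
  -- < 0.
  have h := main (-I / (2 * (c + 1))) (div_pos (by linarith) (by positivity))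
  have h2 : -I / (2 * (c + 1)) * c ≤ -I / 2 := by
    rw [div_mul_eq_mul_div, div_le_div_iff₀ (by positivity) (by positivity)]
    nlinarith
  linarith

end KatoInequality

/-! ### Weighted contraction from a time cutoff. -/

section Contraction

variable {N : ℕ} {f : ℝ → E N} {L : ℝ} {J : ℝ → E N → ℝ} {M T : ℝ}

lemma timeDeriv_mul_time {θ : ℝ → ℝ} {ψ : ℝ × E N → ℝ} (hθ : ContDiff ℝ (⊤ : ℕ∞) θ)
    (hψ : ContDiff ℝ (⊤ : ℕ∞) ψ) (P : ℝ × E N) :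
    timeDeriv (fun P => θ P.1 * ψ P) P = deriv θ P.1 * ψ P + θ P.1 * timeDeriv ψ P := by
  have h1 := (hθ.differentiable (by simp) P.1).hasDerivAt
  have h2 := hasDerivAt_time (hψ.differentiable (by simp) P)
  rw [timeDeriv_eq (hψ.differentiable (by simp) P)]
  exact (h1.mul h2).deriv

lemma spaceGrad_mul_time (θ : ℝ → ℝ) {ψ : ℝ × E N → ℝ}
    (hψ : ContDiff ℝ (⊤ : ℕ∞) ψ) (P : ℝ × E N) :
    spaceGrad (fun P => θ P.1 * ψ P) P = θ P.1 • spaceGrad ψ P := by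
  have h2 := (hasFDerivAt_space (hψ.differentiable (by simp) P)).const_mul (θ P.1)
  rw [spaceGrad_eq (hψ.differentiable (by simp) P), ← map_smul]
  rw [spaceGrad, gradient, h2.fderiv]

/-- A smooth cutoff function in time, equal to one at time zero, whose derivative at positive times
is a given mollifier up to sign. -/
lemma exists_time_cutoff {T : ℝ} {η : ℝ → ℝ} (hη : ContDiff ℝ (⊤ : ℕ∞) η) (hη0 : ∀ t, 0 ≤ η t)
    {t₁ t₂ : ℝ} (h1 : 0 < t₁) (h12 : t₁ ≤ t₂) (h2 : t₂ < T) (hs : ∀ t, t ∉ Ioo t₁ t₂ → η t = 0)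
    (hi : ∫ t, η t = 1) :
    ∃ θ : ℝ → ℝ, ContDiff ℝ (⊤ : ℕ∞) θ ∧ (∀ t, 0 ≤ θ t) ∧ θ 0 = 1 ∧
      (∀ t, 0 < t → deriv θ t = - η t) ∧ tsupport θ ⊆ Ioo (-T) T := by
  have hT : 0 < T := by linarith
  have hηi : Integrable η := by
    refine hη.continuous.integrable_of_hasCompactSupport
      (HasCompactSupport.intro isCompact_Icc fun t ht => hs t fun h => ht (Ioo_subset_Icc_self h))
  set H : ℝ → ℝ := fun t => ∫ s in (0 : ℝ)..t, η s with hH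
  have hHd : ∀ t, HasDerivAt H (η t) t := fun t =>
    intervalIntegral.integral_hasDerivAt_right (hη.continuous.intervalIntegrable _ _)
      hη.continuous.stronglyMeasurable.stronglyMeasurableAtFilter hη.continuous.continuousAt
  have hHs : ContDiff ℝ (⊤ : ℕ∞) H := by
    refine contDiff_infty_iff_deriv.2 ⟨fun t => (hHd t).differentiableAt, ?_⟩
    rw [show deriv H = η from funext fun t => (hHd t).deriv]
    exact hη
  have hHle : ∀ t, H t ≤ 1 := fun t => by
    rcases le_total 0 t with ht | ht
    · rw [hH, ← hi]
      simp only
      rw [intervalIntegral.integral_of_le ht]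
      exact setIntegral_le_integral hηi (ae_of_all _ hη0)
    · refine le_trans ?_ zero_le_one
      simp only [hH]
      rw [intervalIntegral.integral_symm]
      have := intervalIntegral.integral_nonneg (μ := volume) ht fun s _ => hη0 s
      linarith
  have hH1 : ∀ t, t₂ ≤ t → H t = 1 := fun t ht => by
    have ht0 : 0 ≤ t := by linarith
    simp only [hH]
    rw [intervalIntegral.integral_of_le ht0, ← hi]
    refine setIntegral_eq_integral_of_forall_compl_eq_zero fun s hs' => hs s fun h => hs' ?_
    exact ⟨by linarith [h.1], by linarith [h.2]⟩
  -- A factor that is 1 for t ≥ -T/3 and 0 for t ≤ -2T/3: it keeps the support away from -T and is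
  -- invisible at positive times.
  set c : ℝ → ℝ := fun t => Real.smoothTransition (3 / T * t + 2) with hc
  have hcs : ContDiff ℝ (⊤ : ℕ∞) c := Real.smoothTransition.contDiff.comp (by fun_prop)
  have hc1 : ∀ t, -(T / 3) ≤ t → c t = 1 := fun t ht => by
    refine Real.smoothTransition.one_of_one_le ?_
    have : 3 / T * (-(T / 3)) ≤ 3 / T * t := by gcongr
    have e : 3 / T * (-(T / 3)) = -1 := by field_simp
    linarith
  have hc0 : ∀ t, t ≤ -(2 * T / 3) → c t = 0 := fun t ht => by
    refine Real.smoothTransition.zero_of_nonpos ?_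
    have : 3 / T * t ≤ 3 / T * (-(2 * T / 3)) := by gcongr
    have e : 3 / T * (-(2 * T / 3)) = -2 := by field_simp
    linarith
  refine ⟨fun t => c t * (1 - H t), by fun_prop, fun t => ?_, ?_, fun t ht => ?_, ?_⟩
  · exact mul_nonneg (Real.smoothTransition.nonneg _) (by linarith [hHle t])
  · have : H 0 = 0 := by simp [hH]
    change c 0 * (1 - H 0) = 1
    rw [this, hc1 0 (by linarith)]
    simp
  · have : (fun t => c t * (1 - H t)) =ᶠ[𝓝 t] fun t => 1 - H t := by
      filter_upwards [lt_mem_nhds ht] with s hs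
      rw [hc1 s (by linarith), one_mul]
    rw [this.deriv_eq]
    exact ((hHd t).const_sub 1).deriv
  · refine (closure_minimal (t := Icc (-(2 * T / 3)) t₂) (fun t ht => ?_) isClosed_Icc).trans
      fun t ht => ⟨by linarith [ht.1], by linarith [ht.2]⟩
    constructor
    · by_contra h
      exact ht (by simp [hc0 t (by linarith)])
    · by_contra h
      exact ht (by simp [hH1 t (by linarith)])

/-- The Kruzhkov flux is transported by directions of norm at most `L`. -/
lemma flux_inner_le (hf : IsFlux f L) {ψ : ℝ × E N → ℝ} (hψ : ContDiff ℝ (⊤ : ℕ∞) ψ)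
    (hcone : ∀ P, ∀ v : E N, ‖v‖ ≤ L → fderiv ℝ ψ P (1, v) ≤ 0) (P : ℝ × E N) (a b j : ℝ) :
    |a - b| * timeDeriv ψ P
      + inner ℝ (Real.sign (a - b) • (f (a + j) - f (b + j))) (spaceGrad ψ P) ≤ 0 := by
  have hd := hψ.differentiable (by simp) P
  rcases eq_or_ne a b with rfl | hab
  · simp
  have hpos : 0 < |a - b| := abs_pos.2 (sub_ne_zero.2 hab)
  set F := Real.sign (a - b) • (f (a + j) - f (b + j)) with hF
  have hFn : ‖F‖ ≤ L * |a - b| := by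
    rw [hF, norm_smul]
    refine (mul_le_of_le_one_left (norm_nonneg _) (abs_sign_le _)).trans ?_
    simpa using hf.norm_sub_le (a + j) (b + j)
  -- The Kruzhkov flux divided by |a - b| is an admissible velocity, of norm at most L.
  have h := hcone P (|a - b|⁻¹ • F) (by
    rw [norm_smul, norm_inv, Real.norm_of_nonneg hpos.le, inv_mul_le_iff₀ hpos, mul_comm]
    exact hFn)
  have e : |a - b| * timeDeriv ψ P + inner ℝ F (spaceGrad ψ P)
      = |a - b| * fderiv ℝ ψ P (1, |a - b|⁻¹ • F) := by
    have : ((1 : ℝ), |a - b|⁻¹ • F) = (1, 0) + |a - b|⁻¹ • ((0 : ℝ), F) := by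
      ext <;> simp
    rw [this, map_add, map_smul, timeDeriv_eq hd, inner_spaceGrad hd, smul_eq_mul]
    field_simp
  rw [e]
  exact mul_nonpos_of_nonneg_of_nonpos hpos.le h

variable {w z ψ : ℝ × E N → ℝ} {w₀ z₀ : E N → ℝ}

lemma integrable_weighted (hwl : LocallyIntegrable w) (hzl : LocallyIntegrable z)
    (hψ : Continuous ψ) {K : Set (E N)} (hK : IsCompact K)
    (hsupp : ∀ P : ℝ × E N, |P.1| ≤ T → P.2 ∉ K → ψ P = 0) :
    Integrable ((Ioo 0 T ×ˢ univ).indicator fun P => |w P - z P| * ψ P) := by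
  have h1 : LocallyIntegrable fun P => |w P - z P| := fun x => ((hwl x).sub (hzl x)).norm
  have h2 : IntegrableOn (fun P => |w P - z P| * ψ P) (Icc 0 T ×ˢ K) :=
    (h1.integrableOn_isCompact (isCompact_Icc.prod hK)).mul_continuousOn hψ.continuousOn
      (isCompact_Icc.prod hK)
  have h3 := (h2.mono_set (prod_mono Ioo_subset_Icc_self subset_rfl)).integrable_indicator
    (measurableSet_Ioo.prod hK.measurableSet)
  refine h3.congr (ae_of_all _ fun P => ?_)
  by_cases hP : P.1 ∈ Ioo 0 T
  · rw [indicator_of_mem (show P ∈ Ioo 0 T ×ˢ univ from ⟨hP, mem_univ _⟩)]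
    by_cases hPK : P.2 ∈ K
    · rw [indicator_of_mem (show P ∈ Ioo 0 T ×ˢ K from ⟨hP, hPK⟩)]
    · rw [indicator_of_notMem (fun h => hPK h.2), hsupp P (abs_le.2 ⟨by linarith [hP.1, hP.2], hP.2.le⟩) hPK, mul_zero]
  · rw [indicator_of_notMem (fun h => hP h.1), indicator_of_notMem (fun h => hP h.1)]

/-- The Kato inequality, tested with a mollified indicator function of a cone. -/
lemma integral_mollified_le (hf : IsFlux f L) (hJ : IsRegularField J M) (hw : Measurable w)
    (hz : Measurable z) (hwl : LocallyIntegrable w) (hzl : LocallyIntegrable z)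
    (hkato : ∀ φ, IsTestFunction T φ →
      0 ≤ ∫ P, katoDensity f J P (w P) (z P) (timeDeriv φ P) (spaceGrad φ P))
    (hw0 : ∀ t ≤ 0, ∀ x, w (t, x) = w₀ x) (hz0 : ∀ t ≤ 0, ∀ x, z (t, x) = z₀ x)
    (hψ : ContDiff ℝ (⊤ : ℕ∞) ψ) (hψ0 : ∀ P, 0 ≤ ψ P) {K : Set (E N)} (hK : IsCompact K)
    (hsupp : ∀ P : ℝ × E N, |P.1| ≤ T → P.2 ∉ K → ψ P = 0)
    (hcone : ∀ P, ∀ v : E N, ‖v‖ ≤ L → fderiv ℝ ψ P (1, v) ≤ 0)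
    {η : ℝ → ℝ} (hη : ContDiff ℝ (⊤ : ℕ∞) η) (hη0 : ∀ t, 0 ≤ η t)
    {t₁ t₂ : ℝ} (h1 : 0 < t₁) (h12 : t₁ ≤ t₂) (h2 : t₂ < T) (hs : ∀ t, t ∉ Ioo t₁ t₂ → η t = 0)
    (hi : ∫ t, η t = 1) :
    ∫ t, η t * ∫ x, (Ioo 0 T ×ˢ univ).indicator (fun P => |w P - z P| * ψ P) (t, x)
      ≤ ∫ x, |w₀ x - z₀ x| * ψ (0, x) := by
  obtain ⟨θ, hθ, hθ0, hθ1, hθd, hθs⟩ := exists_time_cutoff hη hη0 h1 h12 h2 hs hi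
  set φ : ℝ × E N → ℝ := fun P => θ P.1 * ψ P with hφd
  set G := (Ioo 0 T ×ˢ univ).indicator fun P => |w P - z P| * ψ P with hG
  have hGi : Integrable G := integrable_weighted hwl hzl hψ.continuous hK hsupp
  have hθ' : ∀ t, t ∉ Ioo (-T) T → θ t = 0 := fun t ht =>
    image_eq_zero_of_notMem_tsupport fun h => ht (hθs h)
  have hφc : HasCompactSupport φ := by
    refine HasCompactSupport.intro ((isCompact_Icc (a := -T) (b := T)).prod hK) fun P hP => ?_
    by_cases hP1 : P.1 ∈ Icc (-T) T
    · have : P.2 ∉ K := fun h => hP ⟨hP1, h⟩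
      simp [hφd, hsupp P (abs_le.2 hP1) this]
    · simp [hφd, hθ' P.1 fun h => hP1 (Ioo_subset_Icc_self h)]
  have hφ : IsTestFunction T φ := by
    refine ⟨by fun_prop, hφc, ?_, fun P => mul_nonneg (hθ0 _) (hψ0 _)⟩
    have hcl : IsClosed (tsupport θ ×ˢ (univ : Set (E N))) := (isClosed_tsupport θ).prod isClosed_univ
    refine (closure_minimal (t := tsupport θ ×ˢ (univ : Set (E N)))
      (fun P hP => ⟨subset_tsupport θ (left_ne_zero_of_mul hP), mem_univ _⟩)
      hcl).trans (prod_mono hθs subset_rfl)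
  have habs : LocallyIntegrable fun P => |w P - z P| := fun x => ((hwl x).sub (hzl x)).norm
  set R : ℝ × E N → ℝ := (Iic 0 ×ˢ univ).indicator fun P => |w P - z P| * timeDeriv φ P with hR
  have hRm : MeasurableSet (Iic (0 : ℝ) ×ˢ (univ : Set (E N))) := measurableSet_Iic.prod .univ
  have hRi : Integrable R := by
    refine Integrable.indicator ?_ hRm
    have := habs.integrable_smul_right_of_hasCompactSupport (continuous_timeDeriv hφ.smooth)
      (hasCompactSupport_timeDeriv hφ.smooth hφc)
    simpa using this
  obtain ⟨Bη, hBη⟩ : ∃ C, ∀ t, ‖η t‖ ≤ C :=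
    (HasCompactSupport.intro (isCompact_Icc (a := t₁) (b := t₂)) fun t ht =>
      hs t fun h => ht (Ioo_subset_Icc_self h)).exists_bound_of_continuous hη.continuous
  have hηG : Integrable fun P : ℝ × E N => η P.1 * G P :=
    hGi.bdd_mul (c := Bη) (by have := hη.continuous; fun_prop) (ae_of_all _ fun P => hBη P.1)
  -- At t ≤ 0 the flux is off and only the time derivative survives. At t > 0 the derivative of θ is
  -- -η, and the derivatives of ψ contribute a nonpositive amount by the cone condition.
  have pt : ∀ P, katoDensity f J P (w P) (z P) (timeDeriv φ P) (spaceGrad φ P)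
      ≤ R P - η P.1 * G P := by
    intro P
    rcases le_or_gt P.1 0 with hP | hP
    · have e1 : η P.1 = 0 := hs _ fun h => by linarith [h.1]
      rw [hR, indicator_of_mem (show P ∈ Iic 0 ×ˢ univ from ⟨hP, mem_univ _⟩), e1]
      simp [katoDensity, chi, not_lt.2 hP]
    · rw [hR, indicator_of_notMem (fun h => not_le.2 hP h.1), zero_sub]
      have e1 := flux_inner_le hf hψ hcone P (w P) (z P) (J P.1 P.2)
      have e2 := mul_nonpos_of_nonneg_of_nonpos (hθ0 P.1) e1
      have e3 : η P.1 * G P = η P.1 * (|w P - z P| * ψ P) := by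
        by_cases hPT : P.1 < T
        · rw [hG, indicator_of_mem (show P ∈ Ioo 0 T ×ˢ univ from ⟨⟨hP, hPT⟩, mem_univ _⟩)]
        · rw [hs P.1 fun h => hPT (h.2.trans h2), zero_mul, zero_mul]
      rw [e3, katoDensity, timeDeriv_mul_time hθ hψ, spaceGrad_mul_time θ hψ, hθd _ hP, chi,
        if_pos hP, inner_smul_right]
      linarith
  have hle := (hkato φ hφ).trans (integral_mono
    (integrable_katoDensity hf hJ hw hz hwl hzl hφ.smooth hφc) (hRi.sub hηG) pt)
  have e1 : ∫ P, (R P - η P.1 * G P) = (∫ P, R P) - ∫ P : ℝ × E N, η P.1 * G P :=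
    integral_sub hRi hηG
  have e2 : ∫ P : ℝ × E N, η P.1 * G P = ∫ t, η t * ∫ x, G (t, x) := by
    rw [Measure.volume_eq_prod, integral_prod _ hηG]
    simp only [integral_const_mul]
  -- At t ≤ 0 the factor |w - z| does not depend on time, so the time integral is that of a
  -- derivative and leaves the boundary value at t = 0, where θ = 1.
  have e3 : ∫ P, R P = ∫ x, |w₀ x - z₀ x| * ψ (0, x) := by
    rw [Measure.volume_eq_prod, integral_prod_symm _ hRi]
    refine integral_congr_ae (ae_of_all _ fun x => ?_)
    have e4 : ∀ t, R (t, x) = (Iic 0).indicator (fun t => |w₀ x - z₀ x| * deriv (fun s => φ (s, x)) t) t := by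
      intro t
      by_cases ht : t ≤ 0
      · rw [hR, indicator_of_mem (show (t, x) ∈ Iic (0 : ℝ) ×ˢ (univ : Set (E N)) from ⟨ht, mem_univ _⟩),
          indicator_of_mem (show t ∈ Iic (0 : ℝ) from ht), hw0 t ht, hz0 t ht]
        rfl
      · rw [hR, indicator_of_notMem (fun h => ht h.1), 
          indicator_of_notMem (show t ∉ Iic (0 : ℝ) from ht)]
    simp only [e4]
    rw [integral_indicator measurableSet_Iic, integral_const_mul]
    have hcx : HasCompactSupport fun s => φ (s, x) := by
      refine HasCompactSupport.intro (isCompact_Icc (a := -T) (b := T)) fun s hs' => ?_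
      simp [hφd, hθ' s fun h => hs' (Ioo_subset_Icc_self h)]
    have hsx : ContDiff ℝ 1 fun s => φ (s, x) := by
      have := hφ.smooth.of_le (m := 1) (by exact_mod_cast le_top)
      fun_prop
    rw [hcx.integral_Iic_deriv_eq hsx 0]
    simp [hφd, hθ1]
  have hle2 : 0 ≤ ∫ P, (R P - η P.1 * G P) := hle
  rw [e1, e2, e3] at hle2
  linarith

/-- The weighted `L^1` contraction inside of a cone. -/
lemma ae_weighted_contraction (hf : IsFlux f L) (hJ : IsRegularField J M) (hw : Measurable w)
    (hz : Measurable z) (hwl : LocallyIntegrable w) (hzl : LocallyIntegrable z)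
    (hkato : ∀ φ, IsTestFunction T φ →
      0 ≤ ∫ P, katoDensity f J P (w P) (z P) (timeDeriv φ P) (spaceGrad φ P))
    (hw0 : ∀ t ≤ 0, ∀ x, w (t, x) = w₀ x) (hz0 : ∀ t ≤ 0, ∀ x, z (t, x) = z₀ x)
    (hψ : ContDiff ℝ (⊤ : ℕ∞) ψ) (hψ0 : ∀ P, 0 ≤ ψ P) {K : Set (E N)} (hK : IsCompact K)
    (hsupp : ∀ P : ℝ × E N, |P.1| ≤ T → P.2 ∉ K → ψ P = 0)
    (hcone : ∀ P, ∀ v : E N, ‖v‖ ≤ L → fderiv ℝ ψ P (1, v) ≤ 0) :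
    ∀ᵐ t ∂volume, t ∈ Ioo 0 T →
      ∫ x, |w (t, x) - z (t, x)| * ψ (t, x) ≤ ∫ x, |w₀ x - z₀ x| * ψ (0, x) := by
  set G := (Ioo 0 T ×ˢ univ).indicator fun P => |w P - z P| * ψ P with hG
  have hGi : Integrable G := integrable_weighted hwl hzl hψ.continuous hK hsupp
  have hgi : Integrable fun t => ∫ x, G (t, x) := hGi.integral_prod_left
  -- The fixed ratio 2 between the outer and inner radii is what the almost-everywhere convergence
  -- of mollifications requires. Only one null set of times arises, whatever the approximating
  -- sequence does at each t.
  let b : ℕ → ContDiffBump (0 : ℝ) := fun n =>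
    ⟨1 / ((n : ℝ) + 1) / 2, 1 / ((n : ℝ) + 1), by positivity, half_lt_self (by positivity)⟩
  have hb : Tendsto (fun n => (b n).rOut) atTop (𝓝 0) := tendsto_one_div_add_atTop_nhds_zero_nat
  filter_upwards [ContDiffBump.ae_convolution_tendsto_right_of_locallyIntegrable (K := 2)
    (μ := volume) hb (Eventually.of_forall fun n => by simp only [b]; linarith)
    hgi.locallyIntegrable] with t ht htT
  have hlim : ∫ x, G (t, x) = ∫ x, |w (t, x) - z (t, x)| * ψ (t, x) := by
    simp only [hG, indicator_of_mem (show (t, _) ∈ Ioo 0 T ×ˢ univ from ⟨htT, mem_univ _⟩)]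
  rw [← hlim]
  refine le_of_tendsto ht ?_
  have hmin : 0 < min t (T - t) / 2 := by
    have := htT.1
    have := sub_pos.2 htT.2
    positivity
  filter_upwards [hb.eventually (gt_mem_nhds hmin)] with n hn
  have hn1 : (b n).rOut < t / 2 := hn.trans_le (by gcongr; exact min_le_left _ _)
  have hn2 : (b n).rOut < (T - t) / 2 := hn.trans_le (by gcongr; exact min_le_right _ _)
  have h := integral_mollified_le hf hJ hw hz hwl hzl hkato hw0 hz0 hψ hψ0 hK hsupp hcone
    (η := fun s => (b n).normed volume (t - s)) (t₁ := t - (b n).rOut) (t₂ := t + (b n).rOut)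
    ((b n).contDiff_normed.comp (by fun_prop)) (fun s => (b n).nonneg_normed _)
    (by linarith [htT.1]) (by linarith [(b n).rOut_pos]) (by linarith [htT.2]) (fun s hs => ?_) ?_
  · rw [convolution_eq_swap]
    simpa using h
  · by_contra h0
    have h0' : t - s ∈ Function.support ((b n).normed volume) := h0
    rw [ContDiffBump.support_normed_eq, mem_ball_zero_iff, Real.norm_eq_abs, abs_lt] at h0'
    exact hs ⟨by linarith, by linarith⟩
  · rw [integral_sub_left_eq_self (fun s => (b n).normed volume s) volume t]
    exact (b n).integral_normed

end Contraction

/-! ### The cutoff function of a backward cone. -/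

section Cone

variable {N : ℕ} {L R T : ℝ}

/-- A smooth cutoff function of the backward cone with base the cube `cube N (2 * R)`, shrinking with
speed `L`. -/
def coneWeight (N : ℕ) (L R : ℝ) (P : ℝ × E N) : ℝ :=
  ∏ i, Real.smoothTransition (R - L * P.1 - P.2 i) * Real.smoothTransition (R - L * P.1 + P.2 i)

lemma contDiff_coneWeight (N : ℕ) (L R : ℝ) : ContDiff ℝ (⊤ : ℕ∞) (coneWeight N L R) := by
  have h : ∀ i : Fin N, ContDiff ℝ (⊤ : ℕ∞) fun P : ℝ × E N => P.2 i := fun i =>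
    (EuclideanSpace.proj (𝕜 := ℝ) i).contDiff.comp contDiff_snd
  refine contDiff_prod fun i _ => ContDiff.mul ?_ ?_
  · exact Real.smoothTransition.contDiff.comp
      ((contDiff_const.sub (contDiff_const.mul contDiff_fst)).sub (h i))
  · exact Real.smoothTransition.contDiff.comp
      ((contDiff_const.sub (contDiff_const.mul contDiff_fst)).add (h i))

lemma coneWeight_nonneg (P : ℝ × E N) : 0 ≤ coneWeight N L R P :=
  Finset.prod_nonneg fun _ _ =>
    mul_nonneg (Real.smoothTransition.nonneg _) (Real.smoothTransition.nonneg _)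

lemma coneWeight_le_one (P : ℝ × E N) : coneWeight N L R P ≤ 1 :=
  Finset.prod_le_one
    (fun _ _ => mul_nonneg (Real.smoothTransition.nonneg _) (Real.smoothTransition.nonneg _))
    fun _ _ => mul_le_one₀ (Real.smoothTransition.le_one _) (Real.smoothTransition.nonneg _)
      (Real.smoothTransition.le_one _)

lemma coneWeight_eq_zero {P : ℝ × E N} {S : ℝ} (hS : R - L * P.1 ≤ S)
    (hP : P.2 ∉ cube N (2 * S)) : coneWeight N L R P = 0 := by
  simp only [cube, mem_ofPred_eq, not_forall, not_le, mul_div_cancel_left₀ S two_ne_zero] at hP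
  obtain ⟨i, hi⟩ := hP
  refine Finset.prod_eq_zero (Finset.mem_univ i) (mul_eq_zero.2 ?_)
  rcases lt_abs.1 hi with h | h
  · exact Or.inl (Real.smoothTransition.zero_of_nonpos (by linarith))
  · exact Or.inr (Real.smoothTransition.zero_of_nonpos (by linarith))

/-- The unit of margin is the width of the smooth transition from 0 to 1. -/
lemma coneWeight_eq_one {P : ℝ × E N} {S : ℝ} (hS : S + 1 ≤ R - L * P.1)
    (hP : P.2 ∈ cube N (2 * S)) : coneWeight N L R P = 1 := by
  simp only [cube, mem_ofPred_eq, mul_div_cancel_left₀ S two_ne_zero] at hP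
  refine Finset.prod_eq_one fun i _ => ?_
  have := abs_le.1 (hP i)
  rw [Real.smoothTransition.one_of_one_le (by linarith),
    Real.smoothTransition.one_of_one_le (by linarith), one_mul]

/-- Along the line in the direction (1, v), every argument R - L t ∓ x_i of the product has slope -L
∓ v_i ≤ 0, because |v_i| ≤ ‖v‖ ≤ L. The weight is then nonincreasing on the line, as a product of
nonnegative nonincreasing factors. -/
lemma fderiv_coneWeight_nonpos (P : ℝ × E N) (v : E N) (hv : ‖v‖ ≤ L) :
    fderiv ℝ (coneWeight N L R) P (1, v) ≤ 0 := by
  have hd := (contDiff_coneWeight N L R).differentiable (by simp) P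
  have hline : HasDerivAt (fun s : ℝ => P + s • ((1 : ℝ), v)) (1, v) 0 := by
    simpa using ((hasDerivAt_id (0 : ℝ)).smul_const ((1 : ℝ), v)).const_add P
  have h := HasFDerivAt.comp_hasDerivAt_of_eq (0 : ℝ) hd.hasFDerivAt hline (by simp)
  rw [← h.deriv]
  refine Antitone.deriv_nonpos fun s s' hs => ?_
  simp only [Function.comp_apply, coneWeight]
  refine Finset.prod_le_prod (fun _ _ => mul_nonneg (Real.smoothTransition.nonneg _)
    (Real.smoothTransition.nonneg _)) fun i _ => ?_
  have hvi := abs_le.1 ((Real.norm_eq_abs _ ▸ PiLp.norm_apply_le v i).trans hv)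
  have h1 := mul_le_mul_of_nonneg_left hvi.1 (sub_nonneg.2 hs)
  have h2 := mul_le_mul_of_nonneg_left hvi.2 (sub_nonneg.2 hs)
  refine mul_le_mul (Real.smoothTransition.monotone ?_) (Real.smoothTransition.monotone ?_)
    (Real.smoothTransition.nonneg _) (Real.smoothTransition.nonneg _)
  · simp
    nlinarith
  · simp
    nlinarith

end Cone

/-! ### From solutions on [0, T] to entropy solutions on space-time. -/

/-- A flux with bounded first and second derivatives. -/
lemma exists_isFlux {N : ℕ} {f : ℝ → E N} (hf : ContDiff ℝ 2 f)
    (hfb : ∀ m : ℕ, 1 ≤ m → m ≤ 2 → ∃ C : ℝ, ∀ ξ : ℝ, ‖iteratedDeriv m f ξ‖ ≤ C) :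
    ∃ L, IsFlux f L := by
  obtain ⟨C1, h1⟩ := hfb 1 le_rfl one_le_two
  obtain ⟨C2, h2⟩ := hfb 2 one_le_two le_rfl
  have hd : Differentiable ℝ (deriv f) := by
    have := hf.differentiable_iteratedDeriv 1 (by norm_num)
    rwa [iteratedDeriv_one] at this
  refine ⟨max C1 C2, hf.differentiable (by norm_num), fun ξ => ?_, fun ξ ζ => ?_⟩
  · rw [← iteratedDeriv_one]
    exact (h1 ξ).trans (le_max_left _ _)
  · refine convex_univ.norm_image_sub_le_of_norm_deriv_le (fun x _ => hd x) (fun x _ => ?_)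
      (mem_univ ζ) (mem_univ ξ)
    have := h2 x
    rw [iteratedDeriv_succ, iteratedDeriv_one] at this
    exact this.trans (le_max_right _ _)

section Representative

variable {N : ℕ} {f : ℝ → E N} {L : ℝ} {J : ℝ → E N → ℝ} {M T : ℝ}

lemma integrable_entropyDensity (hf : IsFlux f L) (hJ : IsRegularField J M) {w φ : ℝ × E N → ℝ}
    (hw : Measurable w) (hwl : LocallyIntegrable w) (hφ : ContDiff ℝ (⊤ : ℕ∞) φ)
    (hφc : HasCompactSupport φ) (α : ℝ) :
    Integrable fun P => entropyDensity f J P (w P) α (timeDeriv φ P) (spaceGrad φ P) (φ P) := by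
  have hL := hf.nonneg
  have hM := hJ.nonneg
  obtain ⟨B, hB0, hB⟩ := exists_derivative_bound hφ hφc
  have hi : LocallyIntegrable fun P => (1 + |w P|) + |α| :=
    ((locallyIntegrable_const 1).add fun x => (hwl x).norm).add (locallyIntegrable_const _)
  refine integrable_of_abs_le_on (S := tsupport φ) hφc.isCompact.measurableSet
    (measurable_entropyDensity hf hJ measurable_id hw measurable_const
      (continuous_timeDeriv hφ).measurable (continuous_spaceGrad hφ).measurable
      hφ.continuous.measurable).aestronglyMeasurable
    ((hi.integrableOn_isCompact hφc.isCompact).const_mul ((1 + L + L * M) * (3 * B))) (fun P _ => ?_)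
    fun P hP => ?_
  · refine (abs_entropyDensity_le hf hJ _ _ _ _ _ _).trans ?_
    rw [mul_assoc, mul_comm (3 * B)]
    gcongr
    linarith [(hB P).1, (hB P).2.1, (hB P).2.2]
  · simp [entropyDensity, timeDeriv_eq_zero hφ hP, spaceGrad_eq_zero hφ hP,
      image_eq_zero_of_notMem_tsupport hP]

/-- Any multiple of this integral that depends on x alone may be added to the entropy inequality;
this is how the initial term is created from the extension of w to negative times. -/
lemma integral_timeDeriv_eq_zero {φ : ℝ × E N → ℝ} (hφ : ContDiff ℝ (⊤ : ℕ∞) φ)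
    (hφc : HasCompactSupport φ) (x : E N) : ∫ t, timeDeriv φ (t, x) = 0 := by
  have key : ∀ h : ℝ × E N → ℝ, Continuous h → HasCompactSupport h →
      Integrable fun t => h (t, x) := fun h hc hs => by
    refine Continuous.integrable_of_hasCompactSupport (by fun_prop) ?_
    refine HasCompactSupport.intro (hs.isCompact.image continuous_fst) fun t ht => ?_
    exact image_eq_zero_of_notMem_tsupport fun h' => ht ⟨(t, x), h', rfl⟩
  refine integral_eq_zero_of_hasDerivAt_of_integrable (f := fun t => φ (t, x)) (fun t => ?_)
    (key _ (continuous_timeDeriv hφ) (hasCompactSupport_timeDeriv hφ hφc))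
    (key _ hφ.continuous hφc)
  have hd := hφ.differentiable (by simp) (t, x)
  rw [timeDeriv_eq hd]
  exact hasDerivAt_time hd

lemma locallyIntegrable_comp_snd {h : E N → ℝ} (hh : LocallyIntegrable h) :
    LocallyIntegrable fun P : ℝ × E N => h P.2 := by
  refine locallyIntegrable_iff.2 fun K hK => ?_
  have h1 : IsCompact (Prod.fst '' K) := hK.image continuous_fst
  have h2 : IsCompact (Prod.snd '' K) := hK.image continuous_snd
  have f1 : IsFiniteMeasure (volume.restrict (Prod.fst '' K)) := ⟨by simpa using h1.measure_lt_top⟩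
  have : IntegrableOn (fun P : ℝ × E N => h P.2) ((Prod.fst '' K) ×ˢ (Prod.snd '' K)) := by
    rw [IntegrableOn, Measure.volume_eq_prod, ← Measure.prod_restrict]
    exact (hh.integrableOn_isCompact h2).comp_snd _
  exact this.mono_set fun P hP => ⟨⟨P, hP, rfl⟩, ⟨P, hP, rfl⟩⟩

/-- A jointly measurable function that is essentially bounded in time with values in `L^1_loc` is
locally integrable on the strip. -/
lemma locallyIntegrable_indicator_strip {u : ℝ → E N → ℝ} {U : ℝ × E N → ℝ} (hU : Measurable U)
    (hul : ∀ t, LocallyIntegrable (u t))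
    (hb : ∀ r : ℝ, ∃ C : ℝ, ∀ᵐ t ∂volume.restrict (Icc 0 T),
      ∫ x in Metric.closedBall (0 : E N) r, |u t x| ≤ C)
    (hs : ∀ᵐ t ∂volume.restrict (Icc 0 T), ∀ᵐ x, u t x = U (t, x)) :
    LocallyIntegrable ((Ioc 0 T ×ˢ univ).indicator U) := by
  refine locallyIntegrable_iff.2 fun K hK => ?_
  obtain ⟨r, hr⟩ := (hK.image continuous_snd).isBounded.subset_closedBall (0 : E N)
  obtain ⟨C, hC⟩ := hb r
  have hm : MeasurableSet (Ioc 0 T ×ˢ (univ : Set (E N))) := measurableSet_Ioc.prod .univ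
  have main : IntegrableOn U (Icc 0 T ×ˢ Metric.closedBall (0 : E N) r) := by
    rw [IntegrableOn, Measure.volume_eq_prod, ← Measure.prod_restrict,
      integrable_prod_iff hU.aestronglyMeasurable]
    refine ⟨?_, ?_⟩
    · filter_upwards [hs] with t ht
      exact ((hul t).integrableOn_isCompact (isCompact_closedBall _ _)).congr (ae_restrict_of_ae ht)
    · refine Integrable.of_bound (C := C)
        (hU.norm.aestronglyMeasurable.integral_prod_right') ?_
      filter_upwards [hs, hC] with t ht htC
      rw [Real.norm_of_nonneg (integral_nonneg fun x => norm_nonneg _)]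
      refine le_trans (le_of_eq ?_) htC
      refine integral_congr_ae ?_
      filter_upwards [ae_restrict_of_ae ht] with x hx
      rw [hx, Real.norm_eq_abs]
  rw [integrableOn_indicator_iff hm]
  exact main.mono_set fun P hP => ⟨Ioc_subset_Icc_self hP.1.1, hr ⟨P, hP.2, rfl⟩⟩

/-- A path of an entropy solution on `[0, T]` with noise `J` and initial datum `u₀`. -/
structure IsPathSolution (f : ℝ → E N) (J : ℝ → E N → ℝ) (T : ℝ) (u₀ : E N → ℝ)
    (u : ℝ → E N → ℝ) : Prop where
  initial : LocallyIntegrable u₀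
  locallyIntegrable : ∀ t, LocallyIntegrable (u t)
  measurable : AEStronglyMeasurable (fun P : ℝ × E N => u P.1 P.2)
    ((volume.restrict (Icc 0 T)).prod volume)
  bounded : ∀ r : ℝ, ∃ C : ℝ, ∀ᵐ t ∂volume.restrict (Icc 0 T),
    ∫ x in Metric.closedBall (0 : E N) r, |u t x| ≤ C
  entropy : ∀ φ, IsTestFunction T φ → ∀ α : ℝ, 0 ≤ ∫ t in Icc 0 T, ∫ x,
    entropyIntegrand f J φ α (u t x - J t x) (u₀ x) t x

/-- Entropy solutions on `[0, T]`, extended by their initial datum to negative times, are entropy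
solutions on space-time, up to the choice of a measurable representative. -/
lemma IsPathSolution.exists_isEntropySolution {u₀ : E N → ℝ} {u : ℝ → E N → ℝ}
    (hu : IsPathSolution f J T u₀ u) (hf : IsFlux f L) (hJ : IsRegularField J M) :
    ∃ (w : ℝ × E N → ℝ) (w₀ : E N → ℝ), Measurable w ∧ LocallyIntegrable w ∧
      IsEntropySolution f J T w ∧ (∀ t ≤ 0, ∀ x, w (t, x) = w₀ x) ∧ w₀ =ᵐ[volume] u₀ ∧
      ∀ᵐ t ∂volume.restrict (Icc 0 T), t ∈ Ioo 0 T → ∀ᵐ x, w (t, x) = u t x - J t x := by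
  obtain ⟨hu₀, hul, hm, hb, he⟩ := hu
  set U := hm.mk with hUd
  have hU : Measurable U := hm.stronglyMeasurable_mk.measurable
  have hs : ∀ᵐ t ∂volume.restrict (Icc 0 T), ∀ᵐ x, u t x = U (t, x) :=
    Measure.ae_ae_of_ae_prod hm.ae_eq_mk
  set w₀ := hu₀.aestronglyMeasurable.mk with hw₀
  have hw₀m : Measurable w₀ := hu₀.aestronglyMeasurable.stronglyMeasurable_mk.measurable
  have hw₀e : u₀ =ᵐ[volume] w₀ := hu₀.aestronglyMeasurable.ae_eq_mk
  have hw₀l : LocallyIntegrable w₀ := hu₀.congr hw₀e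
  have m1 : MeasurableSet (Iic (0 : ℝ) ×ˢ (univ : Set (E N))) := measurableSet_Iic.prod .univ
  have m2 : MeasurableSet (Ioc 0 T ×ˢ (univ : Set (E N))) := measurableSet_Ioc.prod .univ
  have hJc : Continuous fun P : ℝ × E N => J P.1 P.2 := hJ.continuous
  set w : ℝ × E N → ℝ := fun P => (Iic 0 ×ˢ univ).indicator (fun P => w₀ P.2) P
    + ((Ioc 0 T ×ˢ univ).indicator U P - (Ioc 0 T ×ˢ univ).indicator (fun P => J P.1 P.2) P) with hwd
  have hwneg : ∀ P : ℝ × E N, P.1 ≤ 0 → w P = w₀ P.2 := fun P hP => by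
    have h1 : P ∈ Iic (0 : ℝ) ×ˢ (univ : Set (E N)) := ⟨hP, mem_univ _⟩
    have h2 : P ∉ Ioc 0 T ×ˢ (univ : Set (E N)) := fun h => not_lt.2 hP h.1.1
    simp only [hwd, indicator_of_mem h1, indicator_of_notMem h2]
    ring
  have hwpos : ∀ P : ℝ × E N, P.1 ∈ Ioc 0 T → w P = U P - J P.1 P.2 := fun P hP => by
    have h1 : P ∉ Iic (0 : ℝ) ×ˢ (univ : Set (E N)) := fun h => not_lt.2 h.1 hP.1
    have h2 : P ∈ Ioc 0 T ×ˢ (univ : Set (E N)) := ⟨hP, mem_univ _⟩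
    simp only [hwd, indicator_of_notMem h1, indicator_of_mem h2]
    ring
  have hwm : Measurable w := ((hw₀m.comp measurable_snd).indicator m1).add
    ((hU.indicator m2).sub (hJc.measurable.indicator m2))
  have hwl : LocallyIntegrable w := ((locallyIntegrable_comp_snd hw₀l).indicator m1).add
    ((locallyIntegrable_indicator_strip hU hul hb hs).sub (hJc.locallyIntegrable.indicator m2))
  refine ⟨w, w₀, hwm, hwl, fun φ hφ α => ?_, fun t ht x => hwneg (t, x) ht, hw₀e.symm, ?_⟩
  · set D : ℝ × E N → ℝ := fun P =>
      entropyDensity f J P (w P) α (timeDeriv φ P) (spaceGrad φ P) (φ P) with hD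
    have hDi : Integrable D := integrable_entropyDensity hf hJ hwm hwl hφ.smooth hφ.compact α
    -- The integral of `F` vanishes. Subtracting `F` cancels the density at t ≤ 0, where w = w₀ and
    -- the flux is off, and produces the initial term of the entropy inequality at t > 0.
    set F : ℝ × E N → ℝ := fun P => |w₀ P.2 - α| * timeDeriv φ P with hF
    have hFl : LocallyIntegrable fun P : ℝ × E N => |w₀ P.2 - α| :=
      fun x => ((locallyIntegrable_comp_snd hw₀l x).sub (locallyIntegrable_const α x)).norm
    have hFi : Integrable F := by
      simpa using hFl.integrable_smul_right_of_hasCompactSupport (continuous_timeDeriv hφ.smooth)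
        (hasCompactSupport_timeDeriv hφ.smooth hφ.compact)
    have hF0 : ∫ P, F P = 0 := by
      rw [Measure.volume_eq_prod, integral_prod_symm _ hFi]
      simp only [hF, integral_const_mul, integral_timeDeriv_eq_zero hφ.smooth hφ.compact, mul_zero,
        integral_zero]
    set G : ℝ × E N → ℝ := (Ioc 0 T ×ˢ univ).indicator fun P =>
      entropyIntegrand f J φ α (w P) (w₀ P.2) P.1 P.2 with hG
    have hDG : ∀ P, D P - F P = G P := by
      intro P
      by_cases hP : P.1 ∈ Ioc 0 T
      · rw [hG, indicator_of_mem (show P ∈ Ioc 0 T ×ˢ univ from ⟨hP, mem_univ _⟩)]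
        simp only [hD, hF, entropyDensity, entropyIntegrand, chi, if_pos hP.1, timeDeriv, spaceGrad]
        ring
      · rw [hG, indicator_of_notMem fun h => hP h.1]
        rcases le_or_gt P.1 0 with h0 | h0
        · simp [hD, hF, entropyDensity, chi, not_lt.2 h0, hwneg P h0]
        · have hPs : P ∉ tsupport φ := fun h => hP ⟨h0, (hφ.support h).1.2.le⟩
          simp [hD, hF, entropyDensity, timeDeriv_eq_zero hφ.smooth hPs,
            spaceGrad_eq_zero hφ.smooth hPs, image_eq_zero_of_notMem_tsupport hPs]
    have hGi : Integrable G := (hDi.sub hFi).congr (ae_of_all _ hDG)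
    have e1 : ∫ P, D P = ∫ P, G P := by
      rw [← integral_congr_ae (ae_of_all _ hDG), integral_sub hDi hFi, hF0, sub_zero]
    change 0 ≤ ∫ P, D P
    rw [e1, Measure.volume_eq_prod, integral_prod _ hGi]
    refine (he φ hφ α).trans (le_of_eq ?_)
    -- The time 0 counts among the extended times in the construction of w, and is negligible.
    rw [integral_Icc_eq_integral_Ioc, ← integral_indicator measurableSet_Ioc]
    have hs' := (ae_restrict_iff' measurableSet_Icc).1 hs
    refine integral_congr_ae ?_
    filter_upwards [hs'] with t ht
    by_cases htT : t ∈ Ioc 0 T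
    · rw [indicator_of_mem htT]
      refine integral_congr_ae ?_
      filter_upwards [ht (Ioc_subset_Icc_self htT), hw₀e] with x hx hx0
      rw [hG, indicator_of_mem (show (t, x) ∈ Ioc 0 T ×ˢ univ from ⟨htT, mem_univ _⟩)]
      simp only [hwpos (t, x) htT, hx, hx0]
    · rw [indicator_of_notMem htT]
      have : ∀ x, G (t, x) = 0 := fun x => indicator_of_notMem (fun h => htT h.1) _
      simp [this]
  · filter_upwards [hs] with t ht htT
    filter_upwards [ht] with x hx
    rw [hwpos (t, x) (Ioo_subset_Ioc_self htT), hx]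

end Representative

/-! ### From cubes to mean values. -/

section MeanContraction

variable {N : ℕ} {f : ℝ → E N} {L : ℝ} {J : ℝ → E N → ℝ} {M T : ℝ}

/-- Shrinking the side of the cube by a constant changes its volume by a factor tending to 1, so
both averages may be normalised by the larger volume. -/
lemma HasMeanValue.le_of_cube_le {h h₀ : E N → ℝ} {m m₀ c : ℝ} (hm : HasMeanValue h m)
    (hm₀ : HasMeanValue h₀ m₀)
    (hle : ∀ n : ℕ, ∫ x in cube N (2 * (n - c)), h x ≤ ∫ x in cube N (2 * n), h₀ x) : m ≤ m₀ := by
  have t1 : Tendsto (fun n : ℕ => 2 * (n : ℝ)) atTop atTop :=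
    tendsto_natCast_atTop_atTop.const_mul_atTop two_pos
  have t2 : Tendsto (fun n : ℕ => 2 * (n : ℝ) - 2 * c) atTop atTop :=
    tendsto_atTop_add_const_right _ _ t1
  have l1 := ((tendsto_sub_pow_div_pow N (2 * c)).comp t1).mul (hm.comp t2)
  rw [one_mul] at l1
  refine le_of_tendsto_of_tendsto l1 (hm₀.comp t1) ?_
  filter_upwards [t2.eventually_gt_atTop 0] with n hn
  have hp : (2 * (n : ℝ) - 2 * c) ^ N ≠ 0 := by positivity
  have e : 2 * (n : ℝ) - 2 * c = 2 * (n - c) := by ring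
  simp only [Function.comp_apply]
  rw [div_mul_eq_mul_div, ← mul_assoc, mul_inv_cancel₀ hp, one_mul, div_eq_inv_mul, e]
  gcongr
  exact hle n

/-- The `L^1` contraction between a cube and a smaller one. -/
lemma IsPathSolution.ae_setIntegral_cube_le {u₀ v₀ : E N → ℝ} {u v : ℝ → E N → ℝ}
    (hu : IsPathSolution f J T u₀ u) (hv : IsPathSolution f J T v₀ v) (hf : IsFlux f L)
    (hJ : IsRegularField J M) :
    ∀ᵐ t ∂volume.restrict (Icc 0 T), ∀ R : ℕ,
      ∫ x in cube N (2 * (R - (1 + L * T))), |u t x - v t x|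
        ≤ ∫ x in cube N (2 * R), |u₀ x - v₀ x| := by
  obtain ⟨w, w₀, hwm, hwl, hwe, hw0, hw₀, hwu⟩ := hu.exists_isEntropySolution hf hJ
  obtain ⟨z, z₀, hzm, hzl, hze, hz0, hz₀, hzv⟩ := hv.exists_isEntropySolution hf hJ
  have hL := hf.nonneg
  have hIoo : ∀ᵐ t ∂volume.restrict (Icc 0 T), t ∈ Ioo 0 T := by
    rw [← restrict_Ioo_eq_restrict_Icc]
    exact ae_restrict_mem measurableSet_Ioo
  -- Integer radii suffice for the limit and keep the exceptional set of times null.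
  have hcontr : ∀ᵐ t ∂volume, ∀ R : ℕ, t ∈ Ioo 0 T →
      ∫ x, |w (t, x) - z (t, x)| * coneWeight N L R (t, x)
        ≤ ∫ x, |w₀ x - z₀ x| * coneWeight N L R (0, x) := by
    refine ae_all_iff.2 fun R => ae_weighted_contraction hf hJ hwm hzm hwl hzl
      (fun φ hφ => kato_inequality hf hJ hwm hzm hwl hzl hwe hze hφ) hw0 hz0
      -- The cone is wider at negative times; the compact set must contain its section at time -T,
      -- whence R + L T.
      (contDiff_coneWeight N L R) coneWeight_nonneg (isCompact_cube N (2 * (R + L * T)))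
      (fun P hP hPK => coneWeight_eq_zero ?_ hPK) fderiv_coneWeight_nonpos
    have := mul_le_mul_of_nonneg_left (neg_le_of_abs_le hP) hL
    linarith
  filter_upwards [hIoo, ae_restrict_of_ae hcontr, hwu, hzv] with t ht hc htu htv R
  have hsub : ∀ᵐ x, |w (t, x) - z (t, x)| = |u t x - v t x| := by
    filter_upwards [htu ht, htv ht] with x h1 h2
    rw [h1, h2]
    congr 1
    ring
  have hsub₀ : ∀ᵐ x, |w₀ x - z₀ x| = |u₀ x - v₀ x| := by
    filter_upwards [hw₀, hz₀] with x h1 h2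
    rw [h1, h2]
  have hloc : LocallyIntegrable fun x => |u t x - v t x| :=
    fun x => ((hu.locallyIntegrable t x).sub (hv.locallyIntegrable t x)).norm
  have hloc₀ : LocallyIntegrable fun x => |u₀ x - v₀ x| :=
    fun x => ((hu.initial x).sub (hv.initial x)).norm
  have hψc : Continuous fun x => coneWeight N L R (t, x) := by
    have := (contDiff_coneWeight N L R).continuous
    fun_prop
  have hψs : HasCompactSupport fun x => coneWeight N L R (t, x) :=
    HasCompactSupport.intro (isCompact_cube N (2 * R)) fun x hx =>
      coneWeight_eq_zero (by nlinarith [ht.1]) hx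
  have hint : Integrable fun x => |u t x - v t x| * coneWeight N L R (t, x) := by
    simpa using hloc.integrable_smul_right_of_hasCompactSupport hψc hψs
  -- The loss 1 + L T is the transition width of the cutoff plus the distance by which the cone
  -- shrinks up to time T.
  calc ∫ x in cube N (2 * (R - (1 + L * T))), |u t x - v t x|
      ≤ ∫ x, |u t x - v t x| * coneWeight N L R (t, x) := by
        rw [← integral_indicator (measurableSet_cube N _)]
        refine integral_mono_of_nonneg
          (ae_of_all _ fun x => indicator_nonneg (fun _ _ => abs_nonneg _) x) hint
          (ae_of_all _ fun x => ?_)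
        beta_reduce
        by_cases hx : x ∈ cube N (2 * (R - (1 + L * T)))
        · rw [indicator_of_mem hx, coneWeight_eq_one (P := (t, x)) _ hx, mul_one]
          have := mul_le_mul_of_nonneg_left ht.2.le hL
          linarith
        · rw [indicator_of_notMem hx]
          exact mul_nonneg (abs_nonneg _) (coneWeight_nonneg _)
    _ = ∫ x, |w (t, x) - z (t, x)| * coneWeight N L R (t, x) := by
        refine integral_congr_ae ?_
        filter_upwards [hsub] with x hx
        rw [hx]
    _ ≤ ∫ x, |w₀ x - z₀ x| * coneWeight N L R (0, x) := hc R ht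
    _ ≤ ∫ x in cube N (2 * R), |u₀ x - v₀ x| := by
        rw [← integral_indicator (measurableSet_cube N _)]
        refine integral_mono_of_nonneg
          (ae_of_all _ fun x => mul_nonneg (abs_nonneg _) (coneWeight_nonneg _))
          ((hloc₀.integrableOn_isCompact (isCompact_cube N _)).integrable_indicator
            (measurableSet_cube N _)) ?_
        filter_upwards [hsub₀] with x hx
        rw [hx]
        by_cases hxc : x ∈ cube N (2 * R)
        · rw [indicator_of_mem hxc]
          exact mul_le_of_le_one_right (abs_nonneg _) (coneWeight_le_one _)
        · rw [indicator_of_notMem hxc, coneWeight_eq_zero (P := (0, x)) (by simp) hxc, mul_zero]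

/-- The field is quantified inside the almost sure event, so the exceptional set does not depend on
it and the same field can be used for both solutions. -/
lemma IsBAPEntropySolution.ae_isPathSolution {Ω : Type*} [MeasurableSpace Ω] {P : Measure Ω}
    {g : ℕ → E N → ℝ} {β : ℕ → ℝ≥0 → Ω → ℝ} {u₀ : E N → ℝ} {u : ℝ → Ω → LocB1 N}
    (hu : IsBAPEntropySolution P f g β T u₀ u) :
    ∀ᵐ ω ∂P, ∀ J : ℝ → E N → ℝ, (∀ t ∈ Icc 0 T, J t = noise g β ω t) →
      IsPathSolution f J T u₀ fun t => (u t ω : E N → ℝ) := by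
  filter_upwards [hu.jointlyMeasurable, hu.bounded_loc, hu.entropy] with ω hm hb he J hJ
  refine ⟨hu.initial_mem.1, fun t => (u t ω).2.1, hm, hb, fun φ hφ α => ?_⟩
  refine (he φ hφ α).trans_eq (setIntegral_congr_fun measurableSet_Icc fun t ht => ?_)
  simp only [entropyIntegrand, hJ t ht]

end MeanContraction

end BAP

end

theorem propositionP {Ω : Type*} [MeasurableSpace Ω] (P : Measure Ω) [IsProbabilityMeasure P]
    {N : ℕ} (T : ℝ) (hT : 0 < T)
    (f : ℝ → BAP.E N) (hf : ContDiff ℝ 2 f)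
    (hfb : ∀ m : ℕ, 1 ≤ m → m ≤ 2 → ∃ C : ℝ, ∀ ξ : ℝ, ‖iteratedDeriv m f ξ‖ ≤ C)
    (β : ℕ → ℝ≥0 → Ω → ℝ) (hβ : ∀ k, IsBrownianReal (β k) P)
    (hβi : iIndepFun (fun k ω t => β k t ω) P)
    (g : ℕ → BAP.E N → ℝ) (hg : ∀ k, BAP.IsAPSmooth 2 (g k))
    (a : ℕ → ℝ) (ha : ∀ k, 0 < a k) (has : Summable fun k => a k + a k ^ 2)
    (hga : ∀ k x, |g k x| + ‖gradient (g k) x‖ + ‖iteratedFDeriv ℝ 2 (g k) x‖ ≤ a k)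
    (u₀ v₀ : BAP.E N → ℝ) (u v : ℝ → Ω → BAP.LocB1 N)
    (hu : BAP.IsBAPEntropySolution P f g β T u₀ u)
    (hv : BAP.IsBAPEntropySolution P f g β T v₀ v) :
    ∃ m₀ : ℝ, BAP.HasMeanValue (fun x => |u₀ x - v₀ x|) m₀ ∧
      ∀ᵐ ω ∂P, ∀ᵐ t ∂volume.restrict (Icc 0 T), ∃ m : ℝ,
        BAP.HasMeanValue (fun x => |(u t ω : BAP.E N → ℝ) x - (v t ω : BAP.E N → ℝ) x|) m ∧
        m ≤ m₀ := by
  obtain ⟨m₀, hm₀⟩ := BAP.exists_hasMeanValue_abs (sub_mem hu.initial_mem hv.initial_mem)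
  refine ⟨m₀, hm₀, ?_⟩
  obtain ⟨L, hL⟩ := BAP.exists_isFlux hf hfb
  have hsum : Summable a := has.of_nonneg_of_le (fun k => (ha k).le) fun k => by
    linarith [sq_nonneg (a k)]
  filter_upwards [BAP.ae_exists_isRegularField_noise P hT hβ (fun k => (hg k).1) ha hsum hga,
    hu.ae_isPathSolution, hv.ae_isPathSolution] with ω ⟨J, M, hJ, hJn⟩ hωu hωv
  filter_upwards [(hωu J hJn).ae_setIntegral_cube_le (hωv J hJn) hL hJ] with t ht
  obtain ⟨m, hm⟩ := BAP.exists_hasMeanValue_abs (sub_mem (u t ω).2 (v t ω).2)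
  exact ⟨m, hm, hm.le_of_cube_le hm₀ ht⟩
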